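/- There are an algorithm for a unit-cost real random access machine and an absolute constant $C$ such that the following holds. Let $b$ be prime, $m,d\in\mathbb N$, $N=b^m$, and let $\gamma_1,\dots,\gamma_d>0$. On input $b,m,d,\gamma_1,\dots,\gamma_d$ the algorithm computes, in at most $C\,d\,N\log N$ operations, an irreducible polynomial $p\in\mathbb F_b[x]$ with $\deg p=m$ and a vector $(g_1,\dots,g_d)$ of nonzero polynomials over $\mathbb F_b$ of degree less than $m$ such that $g_1=1$ and, for $s=2,\dots,d$, $$g_s\in\operatorname*{argmin}_{g\in G^*_{b,m}}K_s(g_1,\dots,g_{s-1},g),\qquad G^*_{b,m}=\{g\in\mathbb F_b[x]\setminus\{0\}:\deg g<m\},$$ where $$K_s(g_1,\dots,g_s)=\sum_{\emptyset\ne\mathfrak u\subseteq\{1,\dots,s\}}\Bigl(\prod_{j\in\mathfrak u}\gamma_j\Bigr)\sum_{n=1}^{N-1}\ \prod_{j\in\mathfrak u}\Bigl((1-b)\Bigl\lfloor\log_b v_m\Bigl(\frac{n(x)\,g_j(x)}{p(x)}\Bigr)\Bigr\rfloor-b\Bigr),$$ $n(x)=\sum_k n_kx^k\in\mathbb F_b[x]$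 for $n=\sum_k n_kb^k$ with digits $n_k\in\{0,\dots,b-1\}$, and $v_m\bigl(\sum_{\ell\ge w}t_\ell x^{-\ell}\bigr)=\sum_{\ell=\max(1,w)}^m t_\ell b^{-\ell}$ for formal Laurent series in $x^{-1}$ over $\mathbb F_b$. That is, the component-by-component construction for product weights can be carried out with $O(dN\log N)$ operations. The same bound holds (for a suitable algorithm and constant) if an arbitrary irreducible $p\in\mathbb F_b[x]$ of degree $m$ is prescribed as part of the input. Here an operation is an exact arithmetic operation $+,-,\times,/,\sqrt{\cdot}$ or a comparison of real numbers, an arithmetic operation or a comparison of nonnegative integers below $(dN)^C$ (that is, of $O(\log(dN))$ bits), a conversion of such an integer to a real number, or a memory access or other elementary machine step; polynomials over $\mathbb F_b$ are encoded by integers through $n\leftrightarrow n(x)$. -/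

import Mathlib

/-! ## Polynomial lattice rules: the component-by-component construction -/

namespace PolyLattice

open Polynomial

/-- The polynomial `n(x) = n₀ + n₁ x + ⋯ + n_a x^a` over `𝔽_b` that is associated with the integer
`n = n₀ + n₁ b + ⋯ + n_a b^a` (base `b` digits). -/
noncomputable def digitPoly (b n : ℕ) : (ZMod b)[X] :=
  Nat.ofDigits (X : (ZMod b)[X]) (Nat.digits b n)

/-- The embedding of `𝔽_b[x]` into the field `𝔽_b((x⁻¹))` of formal Laurent series in `x⁻¹`.
The uniformizer of Mathlib's `LaurentSeries` plays the role of `x⁻¹`, so that `x` is mapped to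
`single (-1) 1`, and the coefficient of index `ℓ` of a series is its coefficient at `x^{-ℓ}`. -/
noncomputable def toLaurentInv (b : ℕ) [Fact b.Prime] :
    (ZMod b)[X] →ₐ[ZMod b] LaurentSeries (ZMod b) :=
  Polynomial.aeval (HahnSeries.single (-1 : ℤ) (1 : ZMod b))

/-- The map `v_m : 𝔽_b((x⁻¹)) → [0,1)`, `∑_ℓ t_ℓ x^{-ℓ} ↦ ∑_{ℓ=1}^m t_ℓ b^{-ℓ}`
(coefficients below the order of the series vanish). -/
noncomputable def vm (b m : ℕ) (L : LaurentSeries (ZMod b)) : ℝ :=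
  ∑ l ∈ Finset.Icc 1 m, ((L.coeff (l : ℤ)).val : ℝ) / (b : ℝ) ^ l

/-- The coordinate `v_m (n(x) g(x) / p(x))` of the `n`-th point of a polynomial lattice. -/
noncomputable def point (b m : ℕ) [Fact b.Prime] (p g : (ZMod b)[X]) (n : ℕ) : ℝ :=
  vm b m (toLaurentInv b (digitPoly b n * g) / toLaurentInv b p)

/-- `L_u (x_u) = ∏_{j ∈ u} ((1 - b) ⌊log_b x_j⌋ - b)`. -/
noncomputable def Lfun (b : ℕ) (u : Finset ℕ) (x : ℕ → ℝ) : ℝ :=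
  ∏ j ∈ u, ((1 - (b : ℝ)) * (⌊Real.logb b (x j)⌋ : ℝ) - b)

/-- The quality function
`K_{b^m,s,η}(g) = ∑_{∅ ≠ u ⊆ {1,…,s}} η_u ∑_{n=1}^{b^m-1} L_u (v_m (n(x) g_u(x) / p(x)))`;
it only depends on the components `g 1, …, g s`. -/
noncomputable def quality (b m : ℕ) [Fact b.Prime] (η : Finset ℕ → ℝ) (p : (ZMod b)[X])
    (s : ℕ) (g : ℕ → (ZMod b)[X]) : ℝ :=
  ∑ u ∈ (Finset.Icc 1 s).powerset.filter (fun u => u.Nonempty),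
    η u * ∑ n ∈ Finset.Icc 1 (b ^ m - 1), Lfun b u (fun j => point b m p (g j) n)

/-- The product weights `γ_u = ∏_{j ∈ u} γ_j`. -/
noncomputable def productWeights (γ : ℕ → ℝ) (u : Finset ℕ) : ℝ := ∏ j ∈ u, γ j

/-- `G*_{b,m}`: the nonzero polynomials over `𝔽_b` of degree less than `m`. -/
def Gstar (b m : ℕ) : Set (ZMod b)[X] := {g | g ≠ 0 ∧ g.degree < m}

/-- `(g 1, …, g d)` is a generating vector that is returned by the component-by-component
construction for the modulus `p` and the weights `η`: `g 1 = 1` and, for `s = 2, …, d`, the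
component `g s` minimizes `h ↦ K_{b^m,s,η} (g 1, …, g (s-1), h)` over `G*_{b,m}`. -/
def IsCBCVector (b m d : ℕ) [Fact b.Prime] (η : Finset ℕ → ℝ) (p : (ZMod b)[X])
    (g : ℕ → (ZMod b)[X]) : Prop :=
  g 1 = 1 ∧ ∀ s ∈ Finset.Icc 2 d, g s ∈ Gstar b m ∧
    ∀ h ∈ Gstar b m, quality b m η p s g ≤ quality b m η p s (Function.update g s h)

end PolyLattice

/-! ## A real random access machine with unit costs

Programs of a small imperative language, acting on integer and real registers and on integer and
real arrays. Arithmetic on reals is exact; integers have to fit into a machine word. Every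
arithmetic operation, comparison, Boolean connective, memory access, constant and assignment
costs one step. -/

namespace RealRAM

/-- A memory state. Arrays are addressed by array name and index. -/
structure Store where
  ireg : ℕ → ℕ
  rreg : ℕ → ℝ
  iarr : ℕ → ℕ → ℕ
  rarr : ℕ → ℕ → ℝ

/-- Integer expressions. -/
inductive IExpr where
  | lit (k : ℕ)
  | reg (x : ℕ)
  | get (a : ℕ) (i : IExpr)
  | add (e f : IExpr)
  | sub (e f : IExpr)
  | mul (e f : IExpr)
  | div (e f : IExpr)
  | mod (e f : IExpr)

/-- Real expressions; `ofInt` converts an integer to a real number. There is no conversion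
(such as rounding) in the other direction. -/
inductive RExpr where
  | ofInt (e : IExpr)
  | reg (x : ℕ)
  | get (a : ℕ) (i : IExpr)
  | add (e f : RExpr)
  | sub (e f : RExpr)
  | mul (e f : RExpr)
  | div (e f : RExpr)
  | sqrt (e : RExpr)

/-- Tests. -/
inductive BExpr where
  | ieq (e f : IExpr)
  | ilt (e f : IExpr)
  | rle (e f : RExpr)
  | not (c : BExpr)
  | and (c c' : BExpr)

/-- Programs. -/
inductive Cmd where
  | skip
  | iset (x : ℕ) (e : IExpr)
  | iput (a : ℕ) (i e : IExpr)
  | rset (x : ℕ) (e : RExpr)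
  | rput (a : ℕ) (i : IExpr) (e : RExpr)
  | seq (c c' : Cmd)
  | ite (q : BExpr) (c c' : Cmd)
  | while (q : BExpr) (c : Cmd)

/-- Value of an integer expression (subtraction is truncated at `0`). -/
def IExpr.eval (σ : Store) : IExpr → ℕ
  | lit k => k
  | reg x => σ.ireg x
  | get a i => σ.iarr a (i.eval σ)
  | add e f => e.eval σ + f.eval σ
  | sub e f => e.eval σ - f.eval σ
  | mul e f => e.eval σ * f.eval σ
  | div e f => e.eval σ / f.eval σ
  | mod e f => e.eval σ % f.eval σ

/-- Evaluation succeeds: all intermediate results are less than `W`, and no division by `0`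
occurs. -/
def IExpr.Ok (W : ℕ) (σ : Store) : IExpr → Prop
  | lit k => k < W
  | reg x => σ.ireg x < W
  | get a i => i.Ok W σ ∧ σ.iarr a (i.eval σ) < W
  | add e f => e.Ok W σ ∧ f.Ok W σ ∧ e.eval σ + f.eval σ < W
  | sub e f => e.Ok W σ ∧ f.Ok W σ
  | mul e f => e.Ok W σ ∧ f.Ok W σ ∧ e.eval σ * f.eval σ < W
  | div e f => e.Ok W σ ∧ f.Ok W σ ∧ f.eval σ ≠ 0
  | mod e f => e.Ok W σ ∧ f.Ok W σ ∧ f.eval σ ≠ 0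

/-- Number of steps of an evaluation. -/
def IExpr.cost : IExpr → ℕ
  | lit _ => 1
  | reg _ => 1
  | get _ i => i.cost + 1
  | add e f => e.cost + f.cost + 1
  | sub e f => e.cost + f.cost + 1
  | mul e f => e.cost + f.cost + 1
  | div e f => e.cost + f.cost + 1
  | mod e f => e.cost + f.cost + 1

/-- Value of a real expression. -/
noncomputable def RExpr.eval (σ : Store) : RExpr → ℝ
  | ofInt e => (e.eval σ : ℝ)
  | reg x => σ.rreg x
  | get a i => σ.rarr a (i.eval σ)
  | add e f => e.eval σ + f.eval σ
  | sub e f => e.eval σ - f.eval σ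
  | mul e f => e.eval σ * f.eval σ
  | div e f => e.eval σ / f.eval σ
  | sqrt e => Real.sqrt (e.eval σ)

/-- Evaluation succeeds: integer subexpressions succeed, no division by `0` and no square root of a
negative number occurs. -/
def RExpr.Ok (W : ℕ) (σ : Store) : RExpr → Prop
  | ofInt e => e.Ok W σ
  | reg _ => True
  | get _ i => i.Ok W σ
  | add e f => e.Ok W σ ∧ f.Ok W σ
  | sub e f => e.Ok W σ ∧ f.Ok W σ
  | mul e f => e.Ok W σ ∧ f.Ok W σ
  | div e f => e.Ok W σ ∧ f.Ok W σ ∧ f.eval σ ≠ 0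
  | sqrt e => e.Ok W σ ∧ 0 ≤ e.eval σ

/-- Number of steps of an evaluation. -/
def RExpr.cost : RExpr → ℕ
  | ofInt e => e.cost + 1
  | reg _ => 1
  | get _ i => i.cost + 1
  | add e f => e.cost + f.cost + 1
  | sub e f => e.cost + f.cost + 1
  | mul e f => e.cost + f.cost + 1
  | div e f => e.cost + f.cost + 1
  | sqrt e => e.cost + 1

/-- The test holds. -/
def BExpr.Holds (σ : Store) : BExpr → Prop
  | ieq e f => e.eval σ = f.eval σ
  | ilt e f => e.eval σ < f.eval σ
  | rle e f => e.eval σ ≤ f.eval σ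
  | not c => ¬ c.Holds σ
  | and c c' => c.Holds σ ∧ c'.Holds σ

/-- The evaluation of the test succeeds (both sides of `and` are always evaluated). -/
def BExpr.Ok (W : ℕ) (σ : Store) : BExpr → Prop
  | ieq e f => e.Ok W σ ∧ f.Ok W σ
  | ilt e f => e.Ok W σ ∧ f.Ok W σ
  | rle e f => e.Ok W σ ∧ f.Ok W σ
  | not c => c.Ok W σ
  | and c c' => c.Ok W σ ∧ c'.Ok W σ

/-- Number of steps of the evaluation of a test. -/
def BExpr.cost : BExpr → ℕ
  | ieq e f => e.cost + f.cost + 1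
  | ilt e f => e.cost + f.cost + 1
  | rle e f => e.cost + f.cost + 1
  | not c => c.cost + 1
  | and c c' => c.cost + c'.cost + 1

/-- Assignment to an integer register. -/
def Store.setIreg (σ : Store) (x v : ℕ) : Store :=
  { σ with ireg := Function.update σ.ireg x v }

/-- Assignment to a real register. -/
def Store.setRreg (σ : Store) (x : ℕ) (v : ℝ) : Store :=
  { σ with rreg := Function.update σ.rreg x v }

/-- Assignment to a cell of an integer array. -/
def Store.setIarr (σ : Store) (a i v : ℕ) : Store :=
  { σ with iarr := Function.update σ.iarr a (Function.update (σ.iarr a) i v) }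

/-- Assignment to a cell of a real array. -/
def Store.setRarr (σ : Store) (a i : ℕ) (v : ℝ) : Store :=
  { σ with rarr := Function.update σ.rarr a (Function.update (σ.rarr a) i v) }

/-- `Exec W c σ t τ`: on a machine whose integers are restricted to `{0, …, W - 1}`, the program `c`
started in the state `σ` runs without failure and halts after exactly `t` steps in the state
`τ`. -/
inductive Exec (W : ℕ) : Cmd → Store → ℕ → Store → Prop
  | skip (σ : Store) : Exec W Cmd.skip σ 1 σ
  | iset (σ : Store) (x : ℕ) (e : IExpr) (he : e.Ok W σ) :
      Exec W (Cmd.iset x e) σ (e.cost + 1) (σ.setIreg x (e.eval σ))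
  | iput (σ : Store) (a : ℕ) (i e : IExpr) (hi : i.Ok W σ) (he : e.Ok W σ) :
      Exec W (Cmd.iput a i e) σ (i.cost + e.cost + 1) (σ.setIarr a (i.eval σ) (e.eval σ))
  | rset (σ : Store) (x : ℕ) (e : RExpr) (he : e.Ok W σ) :
      Exec W (Cmd.rset x e) σ (e.cost + 1) (σ.setRreg x (e.eval σ))
  | rput (σ : Store) (a : ℕ) (i : IExpr) (e : RExpr) (hi : i.Ok W σ) (he : e.Ok W σ) :
      Exec W (Cmd.rput a i e) σ (i.cost + e.cost + 1) (σ.setRarr a (i.eval σ) (e.eval σ))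
  | seq (σ σ' σ'' : Store) (c c' : Cmd) (t t' : ℕ) (h : Exec W c σ t σ')
      (h' : Exec W c' σ' t' σ'') : Exec W (Cmd.seq c c') σ (t + t') σ''
  | iteTrue (σ σ' : Store) (q : BExpr) (c c' : Cmd) (t : ℕ) (hq : q.Ok W σ) (hh : q.Holds σ)
      (h : Exec W c σ t σ') : Exec W (Cmd.ite q c c') σ (q.cost + t) σ'
  | iteFalse (σ σ' : Store) (q : BExpr) (c c' : Cmd) (t : ℕ) (hq : q.Ok W σ) (hh : ¬ q.Holds σ)
      (h : Exec W c' σ t σ') : Exec W (Cmd.ite q c c') σ (q.cost + t) σ'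
  | whileTrue (σ σ' σ'' : Store) (q : BExpr) (c : Cmd) (t t' : ℕ) (hq : q.Ok W σ)
      (hh : q.Holds σ) (h : Exec W c σ t σ') (h' : Exec W (Cmd.while q c) σ' t' σ'') :
      Exec W (Cmd.while q c) σ (q.cost + t + t') σ''
  | whileFalse (σ : Store) (q : BExpr) (c : Cmd) (hq : q.Ok W σ) (hh : ¬ q.Holds σ) :
      Exec W (Cmd.while q c) σ q.cost σ

/-- The initial state for the input `b, m, d, e` and `γ 1, …, γ d`: the four integers stand in the
integer registers `0, 1, 2, 3`, the number `γ j` stands in cell `j` of the real array `0`, and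
everything else is `0`. -/
noncomputable def input (b m d e : ℕ) (γ : ℕ → ℝ) : Store where
  ireg := fun x => if x = 0 then b else if x = 1 then m else if x = 2 then d
    else if x = 3 then e else 0
  rreg := fun _ => 0
  iarr := fun _ _ => 0
  rarr := fun a j => if a = 0 ∧ 1 ≤ j ∧ j ≤ d then γ j else 0

end RealRAM

namespace PolyLattice

/-- The polynomial over `𝔽_b` in integer register `0` (encoded by an integer through its base `b`
digits). -/
noncomputable def outModulus (b : ℕ) (σ : RealRAM.Store) : Polynomial (ZMod b) :=
  digitPoly b (σ.ireg 0)

/-- The sequence of polynomials over `𝔽_b` in integer array `0`; cell `j` encodes component `j`. -/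
noncomputable def outVector (b : ℕ) (σ : RealRAM.Store) (j : ℕ) : Polynomial (ZMod b) :=
  digitPoly b (σ.iarr 0 j)

end PolyLattice

/-! ## A program logic for the real random access machine -/

/-! For product weights, expanding `∏ (1 + γ_j κ_j)` over subsets turns the quality function into
`∑_n (∏_{j ≤ s} (1 + γ_j κ(n g_j)) - 1)`, the empty subset accounting for the `-1`
(`quality_productWeights`). The kernel `κ` sees only the residue `r` of `n g_j` modulo `p`: the
first nonzero digit of `r / p` stands at `x^{-(m - deg r)}`, so `κ` is a function of `deg r`
(`kernel_point`). The residue ring is a field with `N` elements, and its multiplicative group has a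
generator `ζ`. With `n = ζ^i` and `g_j = ζ^{J_j}` the quality becomes `∑_i (∏_k (1 + γ_k ψ(i + J_k))
- 1)` (`quality_eq_sum_weightProd`). As a function of the exponent `t` of the newest component it is
a constant plus `γ_s ∑_i a_i ψ(i + t)`, where `a` is the product over the earlier components. Since
`γ_s > 0`, a step of the construction minimizes a cyclic correlation of length `N - 1`
(`isCBCVector_of_objective_le`). All its values come from one fast Fourier transform of length `2 ^
K` with `2 N ≤ 2 ^ K ≤ 4 N`, and updating `a` costs `O(N)`. Each component therefore costs `O(N log
N)`.

The transform has to be exact using only field operations and square roots. The roots of unity are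
obtained by repeatedly bisecting angles with real square roots (`roots_spec`). The correlation is
read off the imaginary part of the convolution square of a single complex sequence (`im_cconv_eq`),
which the inverse transform recovers from the squared transform (`bwd_sq_fwd`).

The preparation must also stay within `O(N log N)`, uniformly in `b` and `m`. Polynomials are added
in constant time through a table of the sums of blocks of `m / 2` digits (`addE_eval`).
Multiplication by a fixed element is tabulated by Horner's rule, at constant cost per entry after
`O(b)` operations (`mulTable_spec`). An irreducible modulus is found by a sieve over pairs of monic
factors, in `O(m N)` operations (`sieve_spec`). A generator is found by passing from an element of
order `n` to one of order at least `2 n`, so that `O(log N)` rounds of cost `O(N)` suffice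
(`grow_spec`, `findGenerator_spec`).

The programs are verified with a small program logic. Loop-free code is handled by weakest
preconditions (`Run.of_wp`) and counting loops by invariants (`Run.for`). Which cells a program
leaves alone, and whether its expressions fit into a word, are Boolean functions of its text, so
these side conditions mostly hold by computation. Stored integers stay below `V = 32 d N ^ 2`, and
expressions of degree at most `8` in them stay below a fixed power of `d N`. -/

namespace RealRAM

/-- All integer registers and integer array cells hold values below `V`. -/
structure Bdd (V : ℕ) (σ : Store) : Prop where
  ireg : ∀ x, σ.ireg x < V
  iarr : ∀ a i, σ.iarr a i < V

/-- An exponent `k` such that the value of the expression is below `V ^ k`. -/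
def IExpr.deg : IExpr → ℕ
  | lit k => k
  | reg _ => 1
  | get _ _ => 1
  | add e f => max e.deg f.deg + 1
  | sub e _ => e.deg
  | mul e f => e.deg + f.deg
  | div e _ => e.deg
  | mod e _ => e.deg

/-- All subexpressions have degree at most `8`. -/
def IExpr.fits : IExpr → Bool
  | lit k => Nat.ble k 8
  | reg _ => true
  | get _ i => i.fits
  | add e f => e.fits && f.fits && Nat.ble (max e.deg f.deg + 1) 8
  | sub e f => e.fits && f.fits
  | mul e f => e.fits && f.fits && Nat.ble (e.deg + f.deg) 8
  | div e f => e.fits && f.fits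
  | mod e f => e.fits && f.fits

/-- No division by `0` occurs. -/
def IExpr.Safe (σ : Store) : IExpr → Prop
  | lit _ => True
  | reg _ => True
  | get _ i => i.Safe σ
  | add e f => e.Safe σ ∧ f.Safe σ
  | sub e f => e.Safe σ ∧ f.Safe σ
  | mul e f => e.Safe σ ∧ f.Safe σ
  | div e f => e.Safe σ ∧ f.Safe σ ∧ f.eval σ ≠ 0
  | mod e f => e.Safe σ ∧ f.Safe σ ∧ f.eval σ ≠ 0

def RExpr.fits : RExpr → Bool
  | ofInt e => e.fits
  | reg _ => true
  | get _ i => i.fits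
  | add e f => e.fits && f.fits
  | sub e f => e.fits && f.fits
  | mul e f => e.fits && f.fits
  | div e f => e.fits && f.fits
  | sqrt e => e.fits

/-- No division by `0` and no square root of a negative number occurs. -/
def RExpr.Safe (σ : Store) : RExpr → Prop
  | ofInt e => e.Safe σ
  | reg _ => True
  | get _ i => i.Safe σ
  | add e f => e.Safe σ ∧ f.Safe σ
  | sub e f => e.Safe σ ∧ f.Safe σ
  | mul e f => e.Safe σ ∧ f.Safe σ
  | div e f => e.Safe σ ∧ f.Safe σ ∧ f.eval σ ≠ 0
  | sqrt e => e.Safe σ ∧ 0 ≤ e.eval σ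

def BExpr.fits : BExpr → Bool
  | ieq e f => e.fits && f.fits
  | ilt e f => e.fits && f.fits
  | rle e f => e.fits && f.fits
  | not c => c.fits
  | and c c' => c.fits && c'.fits

def BExpr.Safe (σ : Store) : BExpr → Prop
  | ieq e f => e.Safe σ ∧ f.Safe σ
  | ilt e f => e.Safe σ ∧ f.Safe σ
  | rle e f => e.Safe σ ∧ f.Safe σ
  | not c => c.Safe σ
  | and c c' => c.Safe σ ∧ c'.Safe σ

def Cmd.fits : Cmd → Bool
  | skip => true
  | iset _ e => e.fits
  | iput _ i e => i.fits && e.fits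
  | rset _ e => e.fits
  | rput _ i e => i.fits && e.fits
  | seq c c' => c.fits && c'.fits
  | ite q c c' => q.fits && c.fits && c'.fits
  | .while q c => q.fits && c.fits

/-- An upper bound for the running time of a loop-free program. -/
def Cmd.tcost : Cmd → ℕ
  | skip => 1
  | iset _ e => e.cost + 1
  | iput _ i e => i.cost + e.cost + 1
  | rset _ e => e.cost + 1
  | rput _ i e => i.cost + e.cost + 1
  | seq c c' => c.tcost + c'.tcost
  | ite q c c' => q.cost + max c.tcost c'.tcost
  | .while _ _ => 0

/-- The program may write to integer register `x`. -/
def Cmd.wi : Cmd → ℕ → Bool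
  | iset y _, x => Nat.beq x y
  | seq c c', x => c.wi x || c'.wi x
  | ite _ c c', x => c.wi x || c'.wi x
  | .while _ c, x => c.wi x
  | _, _ => false

/-- The program may write to integer array `a`. -/
def Cmd.wia : Cmd → ℕ → Bool
  | iput y _ _, x => Nat.beq x y
  | seq c c', x => c.wia x || c'.wia x
  | ite _ c c', x => c.wia x || c'.wia x
  | .while _ c, x => c.wia x
  | _, _ => false

/-- The program may write to real array `a`. -/
def Cmd.wra : Cmd → ℕ → Bool
  | rput y _ _, x => Nat.beq x y
  | seq c c', x => c.wra x || c'.wra x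
  | ite _ c c', x => c.wra x || c'.wra x
  | .while _ c, x => c.wra x
  | _, _ => false

/-- The stores agree wherever the program does not write. -/
structure Frame (c : Cmd) (σ τ : Store) : Prop where
  ireg : ∀ x, c.wi x = false → τ.ireg x = σ.ireg x
  iarr : ∀ a, c.wia a = false → τ.iarr a = σ.iarr a
  rarr : ∀ a, c.wra a = false → τ.rarr a = σ.rarr a

theorem Frame.refl (c : Cmd) (σ : Store) : Frame c σ σ := ⟨fun _ _ => rfl, fun _ _ => rfl, fun _ _ => rfl⟩

theorem Frame.trans {c : Cmd} {σ τ υ : Store} (h : Frame c σ τ) (h' : Frame c τ υ) :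
    Frame c σ υ :=
  ⟨fun x hx => (h'.ireg x hx).trans (h.ireg x hx), fun x hx => (h'.iarr x hx).trans (h.iarr x hx),
    fun x hx => (h'.rarr x hx).trans (h.rarr x hx)⟩

theorem Frame.mono {c c' : Cmd} {σ τ : Store} (h : Frame c σ τ)
    (hi : ∀ x, c'.wi x = false → c.wi x = false) (ha : ∀ x, c'.wia x = false → c.wia x = false)
    (hr : ∀ x, c'.wra x = false → c.wra x = false) : Frame c' σ τ :=
  ⟨fun x hx => h.ireg x (hi x hx), fun x hx => h.iarr x (ha x hx), fun x hx => h.rarr x (hr x hx)⟩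

/-! ### Reading memory after an assignment. -/

section simps
variable (σ : Store) (x y v a i j a' : ℕ) (r : ℝ)

@[simp] theorem setIreg_ireg : (σ.setIreg x v).ireg y = if y = x then v else σ.ireg y := by
  simp [Store.setIreg, Function.update_apply]
@[simp] theorem setIreg_iarr : (σ.setIreg x v).iarr = σ.iarr := rfl
@[simp] theorem setIreg_rarr : (σ.setIreg x v).rarr = σ.rarr := rfl
@[simp] theorem setIarr_ireg : (σ.setIarr a i v).ireg = σ.ireg := rfl
@[simp] theorem setIarr_rarr : (σ.setIarr a i v).rarr = σ.rarr := rfl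
@[simp] theorem setIarr_iarr : (σ.setIarr a i v).iarr a' j =
    if a' = a then (if j = i then v else σ.iarr a j) else σ.iarr a' j := by
  simp only [Store.setIarr, Function.update_apply]
  split_ifs <;> simp_all
@[simp] theorem setRarr_ireg : (σ.setRarr a i r).ireg = σ.ireg := rfl
@[simp] theorem setRarr_iarr : (σ.setRarr a i r).iarr = σ.iarr := rfl
@[simp] theorem setRarr_rarr : (σ.setRarr a i r).rarr a' j =
    if a' = a then (if j = i then r else σ.rarr a j) else σ.rarr a' j := by
  simp only [Store.setRarr, Function.update_apply]
  split_ifs <;> simp_all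

end simps

/-- A cell can change only if the text of the program names its register or array as a target. This
reduces most preservation claims below to Boolean computations closed by `rfl`. -/
theorem Exec.frame {W : ℕ} {c : Cmd} {σ τ : Store} {t : ℕ} (h : Exec W c σ t τ) :
    Frame c σ τ := by
  induction h with
  | skip σ => exact Frame.refl _ _
  | iset σ x e he =>
    refine ⟨fun y hy => ?_, fun _ _ => rfl, fun _ _ => rfl⟩
    have : y ≠ x := by rintro rfl; simp [Cmd.wi] at hy
    simp [this]
  | iput σ a i e hi he =>
    refine ⟨fun _ _ => rfl, fun y hy => ?_, fun _ _ => rfl⟩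
    have : y ≠ a := by rintro rfl; simp [Cmd.wia] at hy
    ext; simp [this]
  | rset σ x e he => exact ⟨fun _ _ => rfl, fun _ _ => rfl, fun _ _ => rfl⟩
  | rput σ a i e hi he =>
    refine ⟨fun _ _ => rfl, fun _ _ => rfl, fun y hy => ?_⟩
    have : y ≠ a := by rintro rfl; simp [Cmd.wra] at hy
    ext; simp [this]
  | seq σ σ' σ'' c c' t t' h h' ih ih' =>
    refine Frame.trans (ih.mono ?_ ?_ ?_) (ih'.mono ?_ ?_ ?_) <;> intro x hx <;>
      simp_all [Cmd.wi, Cmd.wia, Cmd.wra]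
  | iteTrue σ σ' q c c' t hq hh h ih =>
    refine ih.mono ?_ ?_ ?_ <;> intro x hx <;> simp_all [Cmd.wi, Cmd.wia, Cmd.wra]
  | iteFalse σ σ' q c c' t hq hh h ih =>
    refine ih.mono ?_ ?_ ?_ <;> intro x hx <;> simp_all [Cmd.wi, Cmd.wia, Cmd.wra]
  | whileTrue σ σ' σ'' q c t t' hq hh h h' ih ih' =>
    refine Frame.trans (ih.mono ?_ ?_ ?_) ih' <;> intro x hx <;>
      simp_all [Cmd.wi, Cmd.wia, Cmd.wra]
  | whileFalse σ q c hq hh => exact Frame.refl _ _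

/-! ### Expressions fit into machine words. -/

/-- Words are large enough for expressions of degree `8` in numbers below `V`. -/
structure Machine (W V : ℕ) : Prop where
  two_le : 2 ≤ V
  pow_le : V ^ 8 ≤ W

variable {W V : ℕ} {σ : Store}

/-- Since `V ≥ 2`, a literal satisfies `k < V ^ k`, and a sum of two numbers below `V ^ k` is below
`2 * V ^ k ≤ V ^ (k + 1)`. The other operations only multiply bounds or decrease values. -/
theorem IExpr.eval_lt (hM : Machine W V) (hb : Bdd V σ) (e : IExpr) : e.eval σ < V ^ e.deg := by
  have h2 := hM.two_le
  have h1 : 1 ≤ V := by omega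
  induction e with
  | lit k => exact Nat.lt_pow_self h2
  | reg x => simpa [eval, deg] using hb.ireg x
  | get a i ih => simpa [eval, deg] using hb.iarr a _
  | add e f ihe ihf =>
    simp only [eval, deg]
    have h3 := Nat.pow_le_pow_right h1 (le_max_left e.deg f.deg)
    have h4 := Nat.pow_le_pow_right h1 (le_max_right e.deg f.deg)
    rw [pow_succ]
    nlinarith
  | sub e f ihe ihf => simp only [eval, deg]; omega
  | mul e f ihe ihf => simp only [eval, deg, pow_add]; exact Nat.mul_lt_mul'' ihe ihf
  | div e f ihe ihf => simp only [eval, deg]; exact (Nat.div_le_self _ _).trans_lt ihe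
  | mod e f ihe ihf => simp only [eval, deg]; exact (Nat.mod_le _ _).trans_lt ihe

theorem Machine.lt_of_deg (hM : Machine W V) {n k : ℕ} (hn : n < V ^ k) (hk : k ≤ 8) : n < W :=
  (hn.trans_le (Nat.pow_le_pow_right (by have := hM.two_le; omega) hk)).trans_le hM.pow_le

theorem IExpr.ok (hM : Machine W V) (hb : Bdd V σ) {e : IExpr} (hf : e.fits = true)
    (hs : e.Safe σ) : e.Ok W σ := by
  induction e with
  | lit k =>
    exact hM.lt_of_deg (eval_lt hM hb (.lit k)) (by simpa [fits, deg] using hf)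
  | reg x => exact hM.lt_of_deg (eval_lt hM hb (.reg x)) (by simp [deg])
  | get a i ih => exact ⟨ih hf hs, hM.lt_of_deg (eval_lt hM hb (.get a i)) (by simp [deg])⟩
  | add e f ihe ihf =>
    simp only [fits, Bool.and_eq_true, Nat.ble_eq] at hf
    exact ⟨ihe hf.1.1 hs.1, ihf hf.1.2 hs.2, hM.lt_of_deg (eval_lt hM hb (.add e f)) hf.2⟩
  | sub e f ihe ihf =>
    simp only [fits, Bool.and_eq_true] at hf
    exact ⟨ihe hf.1 hs.1, ihf hf.2 hs.2⟩
  | mul e f ihe ihf =>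
    simp only [fits, Bool.and_eq_true, Nat.ble_eq] at hf
    exact ⟨ihe hf.1.1 hs.1, ihf hf.1.2 hs.2, hM.lt_of_deg (eval_lt hM hb (.mul e f)) hf.2⟩
  | div e f ihe ihf =>
    simp only [fits, Bool.and_eq_true] at hf
    exact ⟨ihe hf.1 hs.1, ihf hf.2 hs.2.1, hs.2.2⟩
  | mod e f ihe ihf =>
    simp only [fits, Bool.and_eq_true] at hf
    exact ⟨ihe hf.1 hs.1, ihf hf.2 hs.2.1, hs.2.2⟩

theorem RExpr.ok (hM : Machine W V) (hb : Bdd V σ) {e : RExpr} (hf : e.fits = true)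
    (hs : e.Safe σ) : e.Ok W σ := by
  induction e with
  | ofInt e => exact IExpr.ok hM hb hf hs
  | reg x => trivial
  | get a i => exact IExpr.ok hM hb hf hs
  | add e f ihe ihf | sub e f ihe ihf | mul e f ihe ihf =>
    simp only [fits, Bool.and_eq_true] at hf
    exact ⟨ihe hf.1 hs.1, ihf hf.2 hs.2⟩
  | div e f ihe ihf =>
    simp only [fits, Bool.and_eq_true] at hf
    exact ⟨ihe hf.1 hs.1, ihf hf.2 hs.2.1, hs.2.2⟩
  | sqrt e ih => exact ⟨ih hf hs.1, hs.2⟩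

theorem BExpr.ok (hM : Machine W V) (hb : Bdd V σ) {q : BExpr} (hf : q.fits = true)
    (hs : q.Safe σ) : q.Ok W σ := by
  induction q with
  | ieq e f | ilt e f =>
    simp only [fits, Bool.and_eq_true] at hf
    exact ⟨IExpr.ok hM hb hf.1 hs.1, IExpr.ok hM hb hf.2 hs.2⟩
  | rle e f =>
    simp only [fits, Bool.and_eq_true] at hf
    exact ⟨RExpr.ok hM hb hf.1 hs.1, RExpr.ok hM hb hf.2 hs.2⟩
  | not c ih => exact ih hf hs
  | and c c' ih ih' =>
    simp only [fits, Bool.and_eq_true] at hf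
    exact ⟨ih hf.1 hs.1, ih' hf.2 hs.2⟩

/-! ### Correctness with time bounds. -/

/-- The program `c`, started in `σ`, halts within `T` steps in a bounded store that satisfies `Q`
and agrees with `σ` wherever `c` does not write. -/
def Run (W V : ℕ) (c : Cmd) (σ : Store) (T : ℕ) (Q : Store → Prop) : Prop :=
  ∃ t τ, Exec W c σ t τ ∧ t ≤ T ∧ Bdd V τ ∧ Frame c σ τ ∧ Q τ

theorem Run.mono {c : Cmd} {T T' : ℕ} {Q Q' : Store → Prop} (h : Run W V c σ T Q) (hT : T ≤ T')
    (hQ : ∀ τ, Bdd V τ → Frame c σ τ → Q τ → Q' τ) : Run W V c σ T' Q' := by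
  obtain ⟨t, τ, h1, h2, h3, h4, h5⟩ := h
  exact ⟨t, τ, h1, h2.trans hT, h3, h4, hQ τ h3 h4 h5⟩

theorem Run.seq {c c' : Cmd} {T T' : ℕ} {Q Q' : Store → Prop} (h : Run W V c σ T Q)
    (h' : ∀ τ, Bdd V τ → Frame c σ τ → Q τ → Run W V c' τ T' Q') :
    Run W V (.seq c c') σ (T + T') Q' := by
  obtain ⟨t, τ, h1, h2, h3, h4, h5⟩ := h
  obtain ⟨t', τ', h1', h2', h3', h4', h5'⟩ := h' τ h3 h4 h5
  have := Exec.seq _ _ _ _ _ _ _ h1 h1'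
  exact ⟨_, _, this, by omega, h3', this.frame, h5'⟩

theorem Run.ite {q : BExpr} {c c' : Cmd} {T : ℕ} {Q : Store → Prop} (hM : Machine W V)
    (hb : Bdd V σ) (hf : q.fits = true) (hs : q.Safe σ)
    (h : q.Holds σ → Run W V c σ T Q) (h' : ¬ q.Holds σ → Run W V c' σ T Q) :
    Run W V (.ite q c c') σ (q.cost + T) Q := by
  have hq := BExpr.ok hM hb hf hs
  by_cases hh : q.Holds σ
  · obtain ⟨t, τ, h1, h2, h3, h4, h5⟩ := h hh
    have := Exec.iteTrue _ _ q c c' _ hq hh h1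
    exact ⟨_, _, this, by omega, h3, this.frame, h5⟩
  · obtain ⟨t, τ, h1, h2, h3, h4, h5⟩ := h' hh
    have := Exec.iteFalse _ _ q c c' _ hq hh h1
    exact ⟨_, _, this, by omega, h3, this.frame, h5⟩

/-- Weakest precondition of a loop-free program. -/
def WP (V : ℕ) : Cmd → (Store → Prop) → Store → Prop
  | .skip, Q, σ => Q σ
  -- Only stored values must be below `V`; intermediate results may be as large as `V ^ 8`.
  | .iset x e, Q, σ => e.Safe σ ∧ e.eval σ < V ∧ Q (σ.setIreg x (e.eval σ))
  | .iput a i e, Q, σ =>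
      i.Safe σ ∧ e.Safe σ ∧ e.eval σ < V ∧ Q (σ.setIarr a (i.eval σ) (e.eval σ))
  | .rset x e, Q, σ => e.Safe σ ∧ Q (σ.setRreg x (e.eval σ))
  | .rput a i e, Q, σ => i.Safe σ ∧ e.Safe σ ∧ Q (σ.setRarr a (i.eval σ) (e.eval σ))
  | .seq c c', Q, σ => WP V c (WP V c' Q) σ
  | .ite q c c', Q, σ => q.Safe σ ∧ (q.Holds σ → WP V c Q σ) ∧ (¬ q.Holds σ → WP V c' Q σ)
  | .while _ _, _, _ => False

/-- Separates the concerns: word size follows from the text of the program through `fits`, time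
through `tcost`, and only the meaning remains as a statement about stores. -/
theorem Run.of_wp {c : Cmd} {T : ℕ} {Q : Store → Prop} (hM : Machine W V)
    (hb : Bdd V σ) (hf : c.fits = true) (hT : c.tcost ≤ T) (h : WP V c Q σ) :
    Run W V c σ T Q := by
  refine Run.mono (T := c.tcost) ?_ hT fun _ _ _ h => h
  clear hT
  induction c generalizing σ Q with
  | skip => exact ⟨_, _, .skip _, le_rfl, hb, Frame.refl _ _, h⟩
  | iset x e =>
    have := Exec.iset σ x e (IExpr.ok hM hb hf h.1)
    refine ⟨_, _, this, le_rfl, ⟨fun y => ?_, hb.iarr⟩, this.frame, h.2.2⟩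
    have := hb.ireg y; have := h.2.1
    simp only [setIreg_ireg]; split_ifs <;> assumption
  | iput a i e =>
    simp only [Cmd.fits, Bool.and_eq_true] at hf
    have := Exec.iput σ a i e (IExpr.ok hM hb hf.1 h.1) (IExpr.ok hM hb hf.2 h.2.1)
    refine ⟨_, _, this, le_rfl, ⟨hb.ireg, fun y z => ?_⟩, this.frame, h.2.2.2⟩
    have := hb.iarr y z; have := hb.iarr a z; have := h.2.2.1
    simp only [setIarr_iarr]; split_ifs <;> assumption
  | rset x e =>
    have := Exec.rset σ x e (RExpr.ok hM hb hf h.1)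
    exact ⟨_, _, this, le_rfl, ⟨hb.ireg, hb.iarr⟩, this.frame, h.2⟩
  | rput a i e =>
    simp only [Cmd.fits, Bool.and_eq_true] at hf
    have := Exec.rput σ a i e (IExpr.ok hM hb hf.1 h.1) (RExpr.ok hM hb hf.2 h.2.1)
    exact ⟨_, _, this, le_rfl, ⟨hb.ireg, hb.iarr⟩, this.frame, h.2.2⟩
  | seq c c' ih ih' =>
    simp only [Cmd.fits, Bool.and_eq_true] at hf
    exact Run.seq (ih hb hf.1 h) fun τ hτ _ hQ => ih' hτ hf.2 hQ
  | ite q c c' ih ih' =>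
    simp only [Cmd.fits, Bool.and_eq_true] at hf
    exact Run.ite hM hb hf.1.1 h.1
      (fun hh => (ih hb hf.1.2 (h.2.1 hh)).mono (le_max_left _ _) fun _ _ _ h => h)
      (fun hh => (ih' hb hf.2 (h.2.2 hh)).mono (le_max_right _ _) fun _ _ _ h => h)
  | _ => exact h.elim

/-- `for x = 0, …, n - 1 do c`, where `n` is the content of register `r`. -/
def Cmd.for (x r : ℕ) (c : Cmd) : Cmd :=
  .seq (.iset x (.lit 0))
    (.while (.ilt (.reg x) (.reg r)) (.seq c (.iset x (.add (.reg x) (.lit 1)))))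

/-- The counter is incremented outside the body, so the invariant has to survive any assignment to
it (`hI`). In the time bound, `7` is the test (`3`) plus the increment (`4`) of a round, and `5` is
the initialization (`2`) plus the final failing test (`3`). -/
theorem Run.for {x r : ℕ} {c : Cmd} {T : ℕ} (I : ℕ → Store → Prop) (hM : Machine W V)
    (hb : Bdd V σ) (hx : c.wi x = false) (hr : c.wi r = false) (hxr : Nat.beq r x = false)
    (hI : ∀ i τ v, I i τ → I i (τ.setIreg x v)) (h0 : I 0 σ)
    (hstep : ∀ i < σ.ireg r, ∀ τ, Bdd V τ → Frame (.for x r c) σ τ → τ.ireg x = i → I i τ →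
      Run W V c τ T (I (i + 1))) :
    Run W V (.for x r c) σ (σ.ireg r * (T + 7) + 5) (I (σ.ireg r)) := by
  have h1V : 2 ≤ V := hM.two_le
  have h8 : 8 ≤ 8 := le_rfl
  have hxr' : r ≠ x := by rintro rfl; simp at hxr
  have h0W : 0 < W := hM.lt_of_deg (n := 0) (k := 0) (by simp) (by simp)
  have h1W : 1 < W := hM.lt_of_deg (n := 1) (k := 1) (by rw [pow_one]; exact h1V) (by simp)
  have hrV := hb.ireg r
  -- Induction on the number `k` of rounds that are still to come.
  have key : ∀ k i, i + k = σ.ireg r → ∀ τ, Bdd V τ → Frame (.for x r c) σ τ → τ.ireg x = i →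
      I i τ → ∃ t υ, Exec W (.while (.ilt (.reg x) (.reg r))
        (.seq c (.iset x (.add (.reg x) (.lit 1))))) τ t υ ∧ t ≤ k * (T + 7) + 3 ∧ Bdd V υ ∧
        I (σ.ireg r) υ := by
    intro k
    induction k with
    | zero =>
      intro i hi τ hτ hF hxi hIi
      have hr' : τ.ireg r = σ.ireg r := hF.ireg r (by simp [Cmd.for, Cmd.wi, hr, hxr])
      refine ⟨_, τ, .whileFalse _ _ _ (BExpr.ok hM hτ rfl (by simp [BExpr.Safe, IExpr.Safe])) ?_,
        by simp [BExpr.cost, IExpr.cost], hτ, ?_⟩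
      · simp only [BExpr.Holds, IExpr.eval]; omega
      · have : i = σ.ireg r := by omega
        rwa [this] at hIi
    | succ k ih =>
      intro i hi τ hτ hF hxi hIi
      have hr' : τ.ireg r = σ.ireg r := hF.ireg r (by simp [Cmd.for, Cmd.wi, hr, hxr])
      obtain ⟨t, υ, e1, e2, e3, e4, e5⟩ := hstep i (by omega) τ hτ hF hxi hIi
      have hυx : υ.ireg x = i := by rw [e4.ireg x hx, hxi]
      have e6 := Exec.iset (W := W) υ x (.add (.reg x) (.lit 1))
        (IExpr.ok hM e3 rfl (by simp [IExpr.Safe]))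
      have e7 := Exec.seq _ _ _ _ _ _ _ e1 e6
      have hval : (IExpr.add (.reg x) (.lit 1)).eval υ = i + 1 := by simp [IExpr.eval, hυx]
      rw [hval] at e7
      have hbd : Bdd V (υ.setIreg x (i + 1)) := by
        refine ⟨fun y => ?_, e3.iarr⟩
        have := e3.ireg y
        simp only [setIreg_ireg]; split_ifs <;> omega
      have hF' : Frame (.for x r c) σ (υ.setIreg x (i + 1)) := by
        refine hF.trans (e7.frame.mono ?_ ?_ ?_) <;> intro y hy <;>
          simp_all [Cmd.for, Cmd.wi, Cmd.wia, Cmd.wra]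
      obtain ⟨t', υ', f1, f2, f3, f4⟩ := ih (i + 1) (by omega) _ hbd hF' (by simp) (hI _ _ _ e5)
      refine ⟨_, υ', .whileTrue _ _ _ _ _ _ _
        (BExpr.ok hM hτ rfl (by simp [BExpr.Safe, IExpr.Safe])) ?_ e7 f1, ?_, f3, f4⟩
      · simp only [BExpr.Holds, IExpr.eval]; omega
      · simp only [BExpr.cost, IExpr.cost]
        ring_nf at f2 ⊢
        omega
  have e1 := Exec.iset (W := W) σ x (.lit 0) h0W
  have hbd : Bdd V (σ.setIreg x 0) := by
    refine ⟨fun y => ?_, hb.iarr⟩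
    have := hb.ireg y
    simp only [setIreg_ireg]; split_ifs <;> omega
  obtain ⟨t, υ, f1, f2, f3, f4⟩ := key (σ.ireg r) 0 (by simp) (σ.setIreg x 0) hbd
    (e1.frame.mono (by intro y hy; simp_all [Cmd.for, Cmd.wi])
      (by intro y hy; simp_all [Cmd.for, Cmd.wia]) (by intro y hy; simp_all [Cmd.for, Cmd.wra]))
    (by simp) (hI _ _ _ h0)
  have := Exec.seq _ _ _ _ _ _ _ e1 f1
  exact ⟨_, υ, this, by simp only [IExpr.cost]; omega, f3, this.frame, f4⟩

end RealRAM

/-! ## Encoding of polynomials by integers -/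

namespace PolyLattice

open Polynomial

section digits
variable {b : ℕ} [hb : Fact b.Prime]

omit hb in
@[simp] theorem digitPoly_zero : digitPoly b 0 = 0 := by
  simp [digitPoly, Nat.ofDigits]

theorem digitPoly_add_mul {w : ℕ} (hw : w < b) (z : ℕ) :
    digitPoly b (w + b * z) = C (w : ZMod b) + X * digitPoly b z := by
  by_cases h : w = 0 ∧ z = 0
  · simp [h.1, h.2]
  · rw [digitPoly, Nat.digits_add b hb.out.one_lt w z hw (by tauto)]
    simp [digitPoly, Nat.ofDigits]

theorem digitPoly_eq (n : ℕ) :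
    digitPoly b n = C (n : ZMod b) + X * digitPoly b (n / b) := by
  have h := digitPoly_add_mul (b := b) (Nat.mod_lt n hb.out.pos) (n / b)
  rw [Nat.mod_add_div] at h
  rw [h]; simp

theorem digitPoly_of_lt {w : ℕ} (hw : w < b) : digitPoly b w = C (w : ZMod b) := by
  simpa using digitPoly_add_mul hw 0

@[simp] theorem digitPoly_one : digitPoly b 1 = 1 := by
  simpa using digitPoly_of_lt (b := b) hb.out.one_lt

/-- Concatenating digit blocks produces no carry, so it is addition of a shifted polynomial. This is
what allows arithmetic on codes to be done block by block. -/
theorem digitPoly_add_pow_mul (k : ℕ) : ∀ {lo : ℕ}, lo < b ^ k → ∀ hi,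
    digitPoly b (lo + b ^ k * hi) = digitPoly b lo + X ^ k * digitPoly b hi := by
  induction k with
  | zero => intro lo hlo hi; have : lo = 0 := by simpa using hlo
            simp [this]
  | succ k ih =>
    intro lo hlo hi
    have h1 : lo / b < b ^ k := by
      rw [Nat.div_lt_iff_lt_mul hb.out.pos]; rwa [pow_succ] at hlo
    have h2 : lo + b ^ (k + 1) * hi = lo % b + b * (lo / b + b ^ k * hi) := by
      conv_lhs => rw [← Nat.mod_add_div lo b]
      ring
    rw [h2, digitPoly_add_mul (Nat.mod_lt _ hb.out.pos), ih h1, digitPoly_eq lo]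
    simp only [ZMod.natCast_mod]
    ring

theorem digitPoly_mod_add (k n : ℕ) :
    digitPoly b n = digitPoly b (n % b ^ k) + X ^ k * digitPoly b (n / b ^ k) := by
  rw [← digitPoly_add_pow_mul k (Nat.mod_lt _ (pow_pos hb.out.pos k)), Nat.mod_add_div]

/-- The constant coefficient determines `n % b` and the quotient by `X` determines `n / b`; then
induct. The code `0` is treated apart because `n / b` is not smaller there. -/
theorem digitPoly_injective : Function.Injective (digitPoly b) := by
  intro n
  induction n using Nat.strong_induction_on with
  | _ n ih =>
    intro n' h
    have h0 : ((n : ℕ) : ZMod b) = n' := by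
      have := congrArg (fun f => f.coeff 0) h
      simpa [digitPoly_eq n, digitPoly_eq n'] using this
    have h1 : digitPoly b (n / b) = digitPoly b (n' / b) := by
      rw [digitPoly_eq n, digitPoly_eq n', h0] at h
      exact mul_left_cancel₀ X_ne_zero (add_left_cancel h)
    have hm : n % b = n' % b := (ZMod.natCast_eq_natCast_iff' n n' b).1 h0
    rcases Nat.eq_zero_or_pos n with rfl | hn
    · by_contra hne
      have hp : 0 < n' := by omega
      have : ∀ k, 0 < k → digitPoly b k ≠ 0 := by
        intro k
        induction k using Nat.strong_induction_on with
        | _ k ihk =>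
          intro hk h0
          have hk0 : ((k : ℕ) : ZMod b) = 0 := by
            have := congrArg (fun f => f.coeff 0) h0
            simpa [digitPoly_eq k] using this
          have hk1 : digitPoly b (k / b) = 0 := by
            rw [digitPoly_eq k, hk0] at h0
            simpa using h0
          have hd : b ∣ k := (ZMod.natCast_eq_zero_iff _ _).1 hk0
          exact ihk _ (Nat.div_lt_self hk hb.out.one_lt)
            (Nat.div_pos (Nat.le_of_dvd hk hd) hb.out.pos) hk1
      exact this n' hp (by simpa using h.symm)
    · have := ih _ (Nat.div_lt_self hn hb.out.one_lt) h1
      rw [← Nat.mod_add_div n b, ← Nat.mod_add_div n' b, hm, this]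

theorem digitPoly_eq_zero_iff {n : ℕ} : digitPoly b n = 0 ↔ n = 0 := by
  rw [← digitPoly_zero (b := b)]; exact digitPoly_injective.eq_iff

theorem digitPoly_surjective : Function.Surjective (digitPoly b) := by
  intro f
  induction hn : f.natDegree using Nat.strong_induction_on generalizing f with
  | _ n ih =>
    have key : ∀ g : (ZMod b)[X], (∃ z, digitPoly b z = g.divX) → ∃ z, digitPoly b z = g := by
      rintro g ⟨z, hz⟩
      refine ⟨(g.coeff 0).val + b * z, ?_⟩
      rw [digitPoly_add_mul (ZMod.val_lt _), hz, ZMod.natCast_zmod_val, add_comm, X_mul_divX_add]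
    apply key
    rcases Nat.eq_zero_or_pos n with rfl | hpos
    · refine ⟨0, ?_⟩
      rw [natDegree_eq_zero] at hn
      obtain ⟨c, rfl⟩ := hn
      simp
    · exact ih _ (by rw [natDegree_divX_eq_natDegree_tsub_one]; omega) _ rfl

theorem degree_digitPoly_lt {k n : ℕ} : (digitPoly b n).degree < k ↔ n < b ^ k := by
  induction k generalizing n with
  | zero => simp [digitPoly_eq_zero_iff, Nat.WithBot.lt_zero_iff]
  | succ k ih =>
    rw [pow_succ, ← Nat.div_lt_iff_lt_mul hb.out.pos, ← ih, degree_lt_iff_coeff_zero,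
      degree_lt_iff_coeff_zero]
    constructor
    · intro h j hj
      have := h (j + 1) (by omega)
      rw [digitPoly_eq n] at this
      simpa [coeff_C] using this
    · intro h j hj
      obtain ⟨j, rfl⟩ : ∃ i, j = i + 1 := ⟨j - 1, by omega⟩
      rw [digitPoly_eq n]
      simpa [coeff_C] using h j (by omega)

theorem natDegree_digitPoly {n : ℕ} (hn : n ≠ 0) : (digitPoly b n).natDegree = Nat.log b n := by
  have h0 : digitPoly b n ≠ 0 := digitPoly_eq_zero_iff.not.2 hn
  have h1 : (digitPoly b n).natDegree < Nat.log b n + 1 := by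
    rw [natDegree_lt_iff_degree_lt h0, degree_digitPoly_lt]
    exact Nat.lt_pow_succ_log_self hb.out.one_lt n
  have h2 : ¬ (digitPoly b n).natDegree < Nat.log b n := by
    rw [natDegree_lt_iff_degree_lt h0, degree_digitPoly_lt, not_lt]
    exact Nat.pow_log_le_self b hn
  omega

theorem lt_pow_of_natDegree {n m : ℕ} (h : (digitPoly b n).natDegree = m) : n < b ^ (m + 1) := by
  rw [← degree_digitPoly_lt]
  exact (degree_le_natDegree.trans_lt (by rw [h]; exact_mod_cast Nat.lt_succ_self m))

/-- `1 ≤ m` excludes the zero polynomial, whose `natDegree` is `0`. -/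
theorem pow_le_of_natDegree {n m : ℕ} (hm : 1 ≤ m) (h : (digitPoly b n).natDegree = m) :
    b ^ m ≤ n := by
  by_contra hlt
  rw [not_le, ← degree_digitPoly_lt] at hlt
  have hn : digitPoly b n ≠ 0 := by rintro h0; rw [h0] at h; simp at h; omega
  rw [← natDegree_lt_iff_degree_lt hn] at hlt
  omega

end digits

end PolyLattice

namespace RealRAM

open Polynomial PolyLattice

theorem ne_of_beq {i j : ℕ} (h : Nat.beq i j = false) : i ≠ j := by
  rintro rfl; simp at h

/-! ### Minimum search -/

/-- Sets register `o` to the smallest `t ∈ {1, …, n}` (`n` in register `r`) for which the test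
holds with `t` in register `c`, if there is one. -/
def searchMin (x r c o : ℕ) (q : BExpr) : Cmd :=
  -- The candidate `n - x` runs downwards, so the last hit is the smallest one and no early exit is
  -- needed.
  .for x r (.seq (.iset c (.sub (.reg r) (.reg x))) (.ite q (.iset o (.reg c)) .skip))

theorem searchMin_spec {W V : ℕ} {σ : Store} (hM : Machine W V) (hb : Bdd V σ)
    {x r c o : ℕ} {q : BExpr} (P : ℕ → Prop)
    (hne : (Nat.beq r x || Nat.beq r c || Nat.beq r o || Nat.beq c x || Nat.beq x c || Nat.beq x o
      || Nat.beq o x || Nat.beq o c) = false)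
    (hf : q.fits = true)
    (hq : ∀ τ, Frame (searchMin x r c o q) σ τ → 1 ≤ τ.ireg c → τ.ireg c ≤ σ.ireg r →
      q.Safe τ ∧ (q.Holds τ ↔ P (τ.ireg c)))
    (hex : ∃ t, 1 ≤ t ∧ t ≤ σ.ireg r ∧ P t) :
    Run W V (searchMin x r c o q) σ (σ.ireg r * (q.cost + 20) + 5) (fun τ =>
      1 ≤ τ.ireg o ∧ τ.ireg o ≤ σ.ireg r ∧ P (τ.ireg o) ∧ ∀ t, 1 ≤ t → P t → τ.ireg o ≤ t) := by
  simp only [Bool.or_eq_false_iff] at hne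
  obtain ⟨⟨⟨⟨⟨⟨⟨hrx, hrc⟩, hro⟩, hcx⟩, hxc⟩, hxo⟩, hox⟩, hoc⟩ := hne
  have h := Run.for (W := W) (σ := σ) (x := x) (r := r)
    (c := .seq (.iset c (.sub (.reg r) (.reg x))) (.ite q (.iset o (.reg c)) .skip))
    (T := q.cost + 13)
    -- After `i` rounds exactly the candidates in `(n - i, n]` have been examined.
    (fun i τ => ∀ t, σ.ireg r - i < t → t ≤ σ.ireg r → P t →
      σ.ireg r - i < τ.ireg o ∧ τ.ireg o ≤ t ∧ P (τ.ireg o)) hM hb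
    (by simp only [Cmd.wi, hxc, hxo, Bool.or_false])
    (by simp only [Cmd.wi, hrc, hro, Bool.or_false]) hrx
    (by intro i τ v h; simpa [ne_of_beq hox] using h) (by intro t h1 h2; omega)
    (by
      intro i hi τ hτ hF hx hIi
      have hr : τ.ireg r = σ.ireg r := hF.ireg r (by
        simp only [Cmd.for, Cmd.wi, hrx, hrc, hro, Bool.or_false])
      refine Run.of_wp hM hτ (by simp [Cmd.fits, IExpr.fits, hf])
        (by simp [Cmd.tcost, IExpr.cost]; omega) ?_
      have hfr : Frame (searchMin x r c o q) σ (τ.setIreg c (σ.ireg r - i)) := by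
        refine hF.trans ⟨fun y hy => ?_, fun _ _ => rfl, fun _ _ => rfl⟩
        have : y ≠ c := by
          rintro rfl; simp [Cmd.for, Cmd.wi] at hy
        simp [this]
      have hrV := hb.ireg r
      obtain ⟨hs, hh⟩ := hq _ hfr (by simp; omega) (by simp)
      simp only [setIreg_ireg, if_true] at hh
      simp only [WP, IExpr.Safe, IExpr.eval, hr, hx, setIreg_ireg, if_true, true_and, hh]
      refine ⟨by omega, hs, fun hP => ⟨by omega, ?_⟩, fun hP => ?_⟩
      · intro t h1 h2 h3
        exact ⟨by omega, by omega, hP⟩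
      · simp only [ne_of_beq hoc, if_false]
        intro t h1 h2 h3
        by_cases ht : t = σ.ireg r - i
        · rw [ht] at h3; exact (hP h3).elim
        · have := hIi t (by omega) h2 h3
          exact ⟨by omega, this.2⟩)
  refine h.mono ?_ ?_
  · exact le_rfl
  intro τ hτ hF hI
  obtain ⟨t, h1, h2, h3⟩ := hex
  obtain ⟨a1, a2, a3⟩ := hI t (by omega) h2 h3
  refine ⟨by omega, by omega, a3, fun t' h1' h3' => ?_⟩
  by_cases hle : t' ≤ σ.ireg r
  · exact (hI t' (by omega) hle h3').2.1
  · omega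

end RealRAM

/-! ## Set-up: constants and the addition table -/

namespace RealRAM

open Polynomial PolyLattice

/-- The size parameters, and a bound for the integers that occur. -/
structure Dims (b m d V : ℕ) : Prop where
  one_le_m : 1 ≤ m
  one_le_d : 1 ≤ d
  le_V : 32 * (d * (b ^ m) ^ 2) ≤ V

section
variable {b m d V : ℕ} [hb : Fact b.Prime]

omit hb in
theorem Dims.b_le (h : Dims b m d V) : b ≤ b ^ m := Nat.le_self_pow (by have := h.1; omega) b

theorem Dims.two_le (h : Dims b m d V) : 2 ≤ b ^ m := hb.out.two_le.trans h.b_le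

omit hb in
theorem Dims.sq_le (h : Dims b m d V) : 32 * (b ^ m * b ^ m) ≤ V := by
  have h1 := h.le_V
  have h2 := h.one_le_d
  nlinarith [Nat.zero_le (b ^ m * b ^ m)]

theorem Dims.d_le (h : Dims b m d V) : 32 * d ≤ V := by
  have h1 := h.le_V
  have h2 := h.two_le
  have h3 : 1 ≤ (b ^ m) ^ 2 := Nat.one_le_pow _ _ (by omega)
  nlinarith

theorem Dims.N_le (h : Dims b m d V) : 64 * b ^ m ≤ V := by
  have h1 := h.sq_le
  have h2 := h.two_le
  nlinarith

theorem Dims.m_lt (_ : Dims b m d V) : m < b ^ m := Nat.lt_pow_self hb.out.one_lt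

omit hb in
theorem Dims.pow_pred (h : Dims b m d V) : b ^ m = b * b ^ (m - 1) := by
  rw [← pow_succ', Nat.sub_add_cancel h.1]

/-- The table of block sums has at most `N` entries. -/
theorem half_sq_le : b ^ (m / 2) * b ^ (m / 2) ≤ b ^ m := by
  rw [← pow_add]; exact Nat.pow_le_pow_right hb.out.pos (by omega)

/-- Two blocks of `m / 2` digits cover all but possibly one of the `m` digits. This is why `addE`
treats the constant coefficient separately. -/
theorem pow_pred_le : b ^ (m - 1) ≤ b ^ (m / 2) * b ^ (m / 2) := by
  rw [← pow_add]; exact Nat.pow_le_pow_right hb.out.pos (by omega)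

end

/-- The registers and tables that are computed first: `N = b ^ m`, `B = b ^ (m / 2)`, the length
`2 ^ K` of the Fourier transforms, the table of the sums of polynomials of degree less than `m / 2`
and the powers of `2`. -/
structure Base (b m d K : ℕ) (σ : Store) : Prop where
  r0 : σ.ireg 0 = b
  r1 : σ.ireg 1 = m
  r2 : σ.ireg 2 = d
  r4 : σ.ireg 4 = b ^ m
  r5 : σ.ireg 5 = b ^ m - 1
  r6 : σ.ireg 6 = b ^ (m - 1)
  r7 : σ.ireg 7 = b ^ (m / 2)
  r9 : σ.ireg 9 = K
  r10 : σ.ireg 10 = 2 ^ K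
  r11 : σ.ireg 11 = K * 2 ^ K
  le_L : 2 * b ^ m ≤ 2 ^ K
  L_le : 2 ^ K ≤ 4 * b ^ m
  tab : ∀ x < b ^ (m / 2), ∀ y < b ^ (m / 2),
    digitPoly b (σ.iarr 1 (x * b ^ (m / 2) + y)) = digitPoly b x + digitPoly b y
  pow : ∀ k ≤ K, σ.iarr 5 k = 2 ^ k

/-- The program does not change the data of `Base`. -/
def Cmd.keepsBase (c : Cmd) : Bool :=
  !(c.wi 0 || c.wi 1 || c.wi 2 || c.wi 4 || c.wi 5 || c.wi 6 || c.wi 7 || c.wi 9 || c.wi 10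
    || c.wi 11 || c.wia 1 || c.wia 5)

theorem Base.frame {b m d K : ℕ} {σ τ : Store} {c : Cmd} (h : Base b m d K σ) (hF : Frame c σ τ)
    (hc : c.keepsBase = true) : Base b m d K τ := by
  simp only [Cmd.keepsBase, Bool.not_eq_true', Bool.or_eq_false_iff] at hc
  obtain ⟨⟨⟨⟨⟨⟨⟨⟨⟨⟨⟨h0, h1⟩, h2⟩, h4⟩, h5⟩, h6⟩, h7⟩, h9⟩, h10⟩, h11⟩, a1⟩, a5⟩ := hc
  refine ⟨?_, ?_, ?_, ?_, ?_, ?_, ?_, ?_, ?_, ?_, h.le_L, h.L_le, ?_, ?_⟩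
  · rw [hF.ireg _ h0, h.r0]
  · rw [hF.ireg _ h1, h.r1]
  · rw [hF.ireg _ h2, h.r2]
  · rw [hF.ireg _ h4, h.r4]
  · rw [hF.ireg _ h5, h.r5]
  · rw [hF.ireg _ h6, h.r6]
  · rw [hF.ireg _ h7, h.r7]
  · rw [hF.ireg _ h9, h.r9]
  · rw [hF.ireg _ h10, h.r10]
  · rw [hF.ireg _ h11, h.r11]
  · rw [hF.iarr _ a1]; exact h.tab
  · rw [hF.iarr _ a5]; exact h.pow

/-- Register `o` is set to the power of `b` with the exponent in register `r`. -/
def powCmd (o r : ℕ) : Cmd :=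
  .seq (.iset o (.lit 1)) (.for 13 r (.iset o (.mul (.reg o) (.reg 0))))

theorem powCmd_spec {W V : ℕ} {σ : Store} (hM : Machine W V) (hσ : Bdd V σ) {o r : ℕ}
    (ho : Nat.beq 0 o = false) (ho' : Nat.beq 13 o = false) (hr : Nat.beq r 13 = false)
    (hor : Nat.beq r o = false) (hpos : 0 < σ.ireg 0) (hlt : σ.ireg 0 ^ σ.ireg r < V) :
    Run W V (powCmd o r) σ (σ.ireg r * 11 + 7) (fun τ => τ.ireg o = σ.ireg 0 ^ σ.ireg r) := by
  have h0o : 0 ≠ o := ne_of_beq ho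
  have h2 := hM.two_le
  refine Run.mono (T := 2 + (σ.ireg r * (4 + 7) + 5)) ?_ (by omega) fun _ _ _ h => h
  refine Run.seq (Q := fun τ => τ = σ.setIreg o 1)
    (Run.of_wp hM hσ rfl le_rfl (by simp [WP, IExpr.Safe, IExpr.eval]; omega)) ?_
  rintro τ hτ hF rfl
  have hrr : (σ.setIreg o 1).ireg r = σ.ireg r := by simp [ne_of_beq hor]
  rw [← hrr]
  refine Run.for (fun i υ => υ.ireg o = σ.ireg 0 ^ i) hM hτ ho'
    hor hr ?_ (by simp) ?_
  · intro i υ v h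
    simpa [(ne_of_beq ho').symm] using h
  · intro i hi υ hυ hF hx hI
    have h0 : υ.ireg 0 = σ.ireg 0 := by
      rw [hF.ireg 0 (by simp only [Cmd.for, Cmd.wi, ho]; rfl)]; simp [h0o]
    refine Run.of_wp hM hυ rfl (by simp [Cmd.tcost, IExpr.cost]) ?_
    simp only [WP, IExpr.Safe, IExpr.eval, h0, hI, and_self, true_and, setIreg_ireg, if_true,
      pow_succ, and_true]
    rw [← pow_succ]
    exact (Nat.pow_le_pow_right hpos (by rw [hrr] at hi; omega)).trans_lt hlt

/-- The table of the sums of polynomials of degree less than `m / 2`. -/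
def addTable : Cmd :=
  .for 13 8 (.iput 1 (.reg 13) (.add
    (.mul (.reg 0) (.get 1 (.add (.mul (.div (.div (.reg 13) (.reg 7)) (.reg 0)) (.reg 7))
      (.div (.mod (.reg 13) (.reg 7)) (.reg 0)))))
    (.mod (.add (.div (.reg 13) (.reg 7)) (.mod (.reg 13) (.reg 7))) (.reg 0))))

/-- The sum of `p` and `q` has constant coefficient `(p + q) % b`, and its quotient by `X` is the
sum for `(p / b, q / b)`, which stands at a smaller index of the same table. -/
theorem addTable_spec {W V b k : ℕ} [hb : Fact b.Prime] {σ : Store} (hM : Machine W V)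
    (hσ : Bdd V σ) (h0 : σ.ireg 0 = b) (h7 : σ.ireg 7 = b ^ k) (h8 : σ.ireg 8 = b ^ k * b ^ k)
    (h1 : σ.iarr 1 0 = 0) (hV : b ^ k ≤ V) :
    Run W V addTable σ (b ^ k * b ^ k * 100) (fun τ => ∀ x < b ^ k, ∀ y < b ^ k,
      digitPoly b (τ.iarr 1 (x * b ^ k + y)) = digitPoly b x + digitPoly b y) := by
  have hB : 0 < b ^ k := pow_pos hb.out.pos k
  have hbp := hb.out.pos
  -- Cell `0` belongs to the invariant from the start, since the round `i = 0` reads the cell that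
  -- it is about to write.
  have h := Run.for (W := W) (V := V) (x := 13) (r := 8) (T := 50) (fun i τ => τ.iarr 1 0 = 0 ∧ 
    ∀ j < i, τ.iarr 1 j < b ^ k ∧ digitPoly b (τ.iarr 1 j) =
      digitPoly b (j / b ^ k) + digitPoly b (j % b ^ k)) hM hσ (c := .iput 1 (.reg 13) (.add
    (.mul (.reg 0) (.get 1 (.add (.mul (.div (.div (.reg 13) (.reg 7)) (.reg 0)) (.reg 7))
      (.div (.mod (.reg 13) (.reg 7)) (.reg 0)))))
    (.mod (.add (.div (.reg 13) (.reg 7)) (.mod (.reg 13) (.reg 7))) (.reg 0)))) rfl rfl rfl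
    (fun _ _ _ h => h) ⟨h1, by simp⟩ (by
      rw [h8]
      rintro i hi τ hτ hF hx ⟨hz, hI⟩
      have e0 : τ.ireg 0 = b := (hF.ireg 0 rfl).trans h0
      have e7 : τ.ireg 7 = b ^ k := (hF.ireg 7 rfl).trans h7
      refine Run.of_wp hM hτ rfl (by decide) ?_
      simp only [WP, IExpr.Safe, IExpr.eval, e0, e7, hx]
      have hp : i / b ^ k < b ^ k := by rwa [Nat.div_lt_iff_lt_mul hB]
      have hq : i % b ^ k < b ^ k := Nat.mod_lt _ hB
      set p := i / b ^ k with hpdef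
      set q := i % b ^ k with hqdef
      have hipq : i = p * b ^ k + q := by rw [mul_comm]; exact (Nat.div_add_mod i (b ^ k)).symm
      have hqb : q / b < b ^ k := (Nat.div_le_self _ _).trans_lt hq
      -- A code is small as soon as its polynomial is correct, because addition does not raise the
      -- degree.
      have key : ∀ v, digitPoly b v = digitPoly b p + digitPoly b q → v < b ^ k := by
        intro v hv
        rw [← degree_digitPoly_lt, hv]
        exact (degree_add_le _ _).trans_lt (max_lt (degree_digitPoly_lt.2 hp)
          (degree_digitPoly_lt.2 hq))
      have hval : digitPoly b (b * τ.iarr 1 (p / b * b ^ k + q / b) + (p + q) % b) =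
          digitPoly b p + digitPoly b q := by
        rw [add_comm, digitPoly_add_mul (Nat.mod_lt _ hbp), digitPoly_eq p, digitPoly_eq q]
        have hsub : digitPoly b (τ.iarr 1 (p / b * b ^ k + q / b)) =
            digitPoly b (p / b) + digitPoly b (q / b) := by
          rcases Nat.eq_zero_or_pos i with hi0 | hi0
          · have : p = 0 := by rw [hpdef, hi0]; simp
            have hq0 : q = 0 := by rw [hqdef, hi0]; simp
            simp [this, hq0, hz]
          · have hlt : p / b * b ^ k + q / b < i := by
              rcases Nat.eq_zero_or_pos p with hp0 | hp0
              · have := Nat.div_lt_self (n := q) (by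
                  rw [hp0] at hipq; omega) hb.out.one_lt
                rw [hipq, hp0]; simpa using this
              · have h3 := Nat.div_lt_self hp0 hb.out.one_lt
                have : (p / b + 1) * b ^ k ≤ p * b ^ k := Nat.mul_le_mul_right _ h3
                rw [add_mul] at this
                have := Nat.div_le_self q b
                omega
            have := (hI _ hlt).2
            rwa [show (p / b * b ^ k + q / b) / b ^ k = p / b by
                rw [mul_comm, Nat.mul_add_div hB, Nat.div_eq_of_lt hqb, add_zero],
              show (p / b * b ^ k + q / b) % b ^ k = q / b by
                rw [mul_comm, Nat.mul_add_mod, Nat.mod_eq_of_lt hqb]] at this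
        rw [hsub]
        simp only [ZMod.natCast_mod, Nat.cast_add, map_add]
        ring
      have hlt := key _ hval
      refine ⟨trivial, ?_, by omega, ?_, ?_⟩
      · simp [hbp.ne']
      · simp only [setIarr_iarr, if_true, hz]
        split_ifs with h
        · subst h
          have : p = 0 := by rw [hpdef]; simp
          have hq0 : q = 0 := by rw [hqdef]; simp
          simp [this, hq0, hz]
        · rfl
      · intro j hj
        simp only [setIarr_iarr, if_true]
        split_ifs with h
        · subst h; exact ⟨hlt, hval⟩
        · exact hI j (by omega))
  rw [h8] at h
  refine h.mono ?_ ?_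
  · have : 0 < b ^ k * b ^ k := Nat.mul_pos hB hB
    omega
  rintro τ - - ⟨-, hI⟩ x hx y hy
  have := (hI (x * b ^ k + y) (by nlinarith)).2
  rwa [show (x * b ^ k + y) / b ^ k = x by
      rw [mul_comm, Nat.mul_add_div hB, Nat.div_eq_of_lt hy, add_zero],
    show (x * b ^ k + y) % b ^ k = y by
      rw [mul_comm, Nat.mul_add_mod, Nat.mod_eq_of_lt hy]] at this

/-- The smallest power `2 ^ K ≥ 2 * N`, and a table of the powers of `2` up to it. -/
def powersOfTwo : Cmd :=
  .seq (.seq (.iset 9 (.lit 0)) (.seq (.iset 10 (.lit 1)) (.iput 5 (.lit 0) (.lit 1))))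
    (.for 13 4 (.ite (.ilt (.reg 10) (.mul (.lit 2) (.reg 4)))
      (.seq (.iset 10 (.mul (.lit 2) (.reg 10))) (.seq (.iset 9 (.add (.reg 9) (.lit 1)))
        (.iput 5 (.reg 9) (.reg 10)))) .skip))

/-- Doubling only happens below `2 N`, which gives the upper bound `4 N`. After `N` rounds either
the goal was reached or every round doubled, and `2 ^ N ≥ 2 N`. -/
theorem powersOfTwo_spec {W V N : ℕ} {σ : Store} (hM : Machine W V) (hσ : Bdd V σ)
    (h4 : σ.ireg 4 = N) (hN : 1 ≤ N) (hV : 4 * N < V) :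
    Run W V powersOfTwo σ (N * 40) (fun τ => ∃ K, τ.ireg 9 = K ∧ τ.ireg 10 = 2 ^ K ∧
      2 * N ≤ 2 ^ K ∧ 2 ^ K ≤ 4 * N ∧ ∀ k ≤ K, τ.iarr 5 k = 2 ^ k) := by
  refine Run.mono (T := 7 + (N * (21 + 7) + 5)) ?_ (by omega) fun _ _ _ h => h
  refine Run.seq (Q := fun τ => τ.ireg 4 = N ∧ τ.ireg 9 = 0 ∧ τ.ireg 10 = 1 ∧ τ.iarr 5 0 = 1)
    (Run.of_wp hM hσ rfl (by decide) (by simp [WP, IExpr.Safe, IExpr.eval, h4]; omega)) ?_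
  rintro τ hτ - ⟨e4, e9, e10, e5⟩
  have h := Run.for (W := W) (V := V) (σ := τ) (x := 13) (r := 4) (T := 21) (fun i τ => ∃ K, τ.ireg 9 = K ∧ τ.ireg 10 = 2 ^ K ∧
      (2 * N ≤ 2 ^ K ∨ i ≤ K) ∧ 2 ^ K ≤ 4 * N ∧ ∀ k ≤ K, τ.iarr 5 k = 2 ^ k) hM hτ
      (c := .ite (.ilt (.reg 10) (.mul (.lit 2) (.reg 4)))
      (.seq (.iset 10 (.mul (.lit 2) (.reg 10))) (.seq (.iset 9 (.add (.reg 9) (.lit 1)))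
        (.iput 5 (.reg 9) (.reg 10)))) .skip) rfl rfl rfl
      (fun _ _ _ h => h) ⟨0, e9, e10, by simp, by simp; omega, by simpa using e5⟩ (by
        rintro i hi υ hυ hF hx ⟨K, k9, k10, k1, k2, k3⟩
        have e4 : υ.ireg 4 = N := (hF.ireg 4 rfl).trans e4
        have hK : K < 2 ^ K := Nat.lt_two_pow_self
        refine Run.of_wp hM hυ rfl (by decide) ?_
        simp only [WP, BExpr.Safe, BExpr.Holds, IExpr.Safe, IExpr.eval, e4, k10, k9, true_and,
          setIreg_ireg]
        refine ⟨fun hlt => ⟨by omega, by simp; omega, by simp; omega, K + 1, by simp,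
          by simp [pow_succ, mul_comm], ?_, by rw [pow_succ]; omega, ?_⟩, fun hle => ⟨K, k9 ▸ rfl, k10 ▸ rfl, by omega, k2, k3⟩⟩
        · rcases k1 with k1 | k1
          · omega
          · right; omega
        · intro k hk
          simp
          split_ifs with h
          · rw [h, pow_succ, mul_comm]
          · exact k3 k (by omega))
  rw [e4] at h
  refine h.mono le_rfl ?_
  rintro υ - - ⟨K, k9, k10, k1, k2, k3⟩
  refine ⟨K, k9, k10, ?_, k2, k3⟩
  rcases k1 with k1 | k1
  · exact k1
  · have h1 : 2 ^ N ≤ 2 ^ K := Nat.pow_le_pow_right (by norm_num) k1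
    have h2 : N - 1 < 2 ^ (N - 1) := Nat.lt_two_pow_self
    have h3 : 2 ^ N = 2 * 2 ^ (N - 1) := by rw [← pow_succ', Nat.sub_add_cancel hN]
    omega

def setup : Cmd :=
  .seq (powCmd 4 1) (.seq (.iset 12 (.div (.reg 1) (.lit 2))) (.seq (powCmd 7 12)
    (.seq (.seq (.iset 5 (.sub (.reg 4) (.lit 1))) (.seq (.iset 6 (.div (.reg 4) (.reg 0)))
      (.iset 8 (.mul (.reg 7) (.reg 7))))) (.seq addTable (.seq powersOfTwo
        (.iset 11 (.mul (.reg 9) (.reg 10))))))))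

theorem setup_spec {W V b m d : ℕ} [hb : Fact b.Prime] {σ : Store} (hM : Machine W V)
    (hD : Dims b m d V) (hσ : Bdd V σ) (h0 : σ.ireg 0 = b) (h1 : σ.ireg 1 = m) (h2 : σ.ireg 2 = d)
    (ha : σ.iarr 1 0 = 0) :
    Run W V setup σ (b ^ m * 300) (fun τ => ∃ K, Base b m d K τ) := by
  have hN := hD.N_le
  have hm := hD.m_lt
  have hbp := hb.out.pos
  have hB := half_sq_le (b := b) (m := m)
  have hB0 : 0 < b ^ (m / 2) := pow_pos hbp _
  have hBle : b ^ (m / 2) ≤ b ^ m := Nat.pow_le_pow_right hbp (by omega)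
  have h2N := hD.two_le
  have hsq := hD.sq_le
  refine Run.mono (T := (m * 11 + 7) + (4 + ((m / 2 * 11 + 7) + (12 +
    ((b ^ (m / 2) * b ^ (m / 2) * 100) + ((b ^ m * 40) + 4)))))) ?_ (by omega) fun _ _ _ h => h
  refine Run.seq (Run.mono (powCmd_spec hM hσ rfl rfl rfl rfl (by rw [h0]; exact hbp)
    (by rw [h0, h1]; omega)) (by rw [h1]) (fun _ _ _ h => h)) ?_
  intro σ1 hσ1 hF1 q4
  rw [h0, h1] at q4
  have p0 : σ1.ireg 0 = b := (hF1.ireg 0 rfl).trans h0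
  have p1 : σ1.ireg 1 = m := (hF1.ireg 1 rfl).trans h1
  have p2 : σ1.ireg 2 = d := (hF1.ireg 2 rfl).trans h2
  have pa : σ1.iarr 1 0 = 0 := by rw [hF1.iarr 1 rfl]; exact ha
  refine Run.seq (Q := fun τ => τ = σ1.setIreg 12 (m / 2))
    (Run.of_wp hM hσ1 rfl (by decide) (by simp [WP, IExpr.Safe, IExpr.eval, p1]; omega)) ?_
  rintro σ2 hσ2 - rfl
  refine Run.seq (Run.mono (powCmd_spec hM hσ2 rfl rfl rfl rfl (by simpa [p0] using hbp)
    (by simp [p0]; omega)) (by simp) (fun _ _ _ h => h)) ?_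
  intro σ3 hσ3 hF3 q7
  simp only [setIreg_ireg, if_true, p0] at q7
  norm_num [p0] at q7
  have r0 : σ3.ireg 0 = b := (hF3.ireg 0 rfl).trans (by simp [p0])
  have r1 : σ3.ireg 1 = m := (hF3.ireg 1 rfl).trans (by simp [p1])
  have r2 : σ3.ireg 2 = d := (hF3.ireg 2 rfl).trans (by simp [p2])
  have r4 : σ3.ireg 4 = b ^ m := (hF3.ireg 4 rfl).trans (by simp [q4])
  have ra : σ3.iarr 1 0 = 0 := by rw [hF3.iarr 1 rfl]; exact pa
  have hdiv : b ^ m / b = b ^ (m - 1) := by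
    rw [hD.pow_pred, Nat.mul_div_cancel_left _ hbp]
  have hdle : b ^ (m - 1) ≤ b ^ m := Nat.pow_le_pow_right hbp (by omega)
  refine Run.seq (Q := fun τ => τ =
      ((σ3.setIreg 5 (b ^ m - 1)).setIreg 6 (b ^ (m - 1))).setIreg 8 (b ^ (m / 2) * b ^ (m / 2)))
    (Run.of_wp hM hσ3 rfl (by decide) ?_) ?_
  · simp [WP, IExpr.Safe, IExpr.eval, r0, r4, q7, hdiv]
    omega
  rintro σ4 hσ4 - rfl
  refine Run.seq (addTable_spec (b := b) (k := m / 2) hM hσ4 (by simp [r0]) (by simp [q7])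
    (by simp) (by simp [ra]) (by omega)) ?_
  intro σ5 hσ5 hF5 htab
  refine Run.seq (powersOfTwo_spec hM hσ5 (hF5.ireg 4 rfl |>.trans (by simp [r4])) (by omega)
    (by omega)) ?_
  rintro σ6 hσ6 hF6 ⟨K, k9, k10, kl, ku, kp⟩
  have hK : K < 2 ^ K := Nat.lt_two_pow_self
  -- `K * 2 ^ K < (2 ^ K) ^ 2 ≤ 16 N ^ 2`, half of what the factor `32` in `Dims` provides.
  have hKV : K * 2 ^ K < V := by nlinarith
  refine Run.of_wp hM hσ6 rfl (by decide) ?_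
  simp only [WP, IExpr.Safe, IExpr.eval, k9, k10, hKV, true_and, and_self]
  refine ⟨K, ?_, ?_, ?_, ?_, ?_, ?_, ?_, ?_, ?_, ?_, kl, ku, ?_, ?_⟩
  · simp [hF6.ireg 0 rfl, hF5.ireg 0 rfl, r0]
  · simp [hF6.ireg 1 rfl, hF5.ireg 1 rfl, r1]
  · simp [hF6.ireg 2 rfl, hF5.ireg 2 rfl, r2]
  · simp [hF6.ireg 4 rfl, hF5.ireg 4 rfl, r4]
  · simp [hF6.ireg 5 rfl, hF5.ireg 5 rfl]
  · simp [hF6.ireg 6 rfl, hF5.ireg 6 rfl]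
  · simp [hF6.ireg 7 rfl, hF5.ireg 7 rfl, q7]
  · simp [k9]
  · simp [k10]
  · simp
  · simpa [hF6.iarr 1 rfl] using htab
  · simpa using kp

end RealRAM

/-! ## Arithmetic in residue rings of `𝔽_b[x]` -/

namespace RealRAM

open Polynomial PolyLattice

theorem Base.setIreg {b m d K : ℕ} {σ : Store} (h : Base b m d K σ) {x : ℕ} (v : ℕ)
    (hx : (Cmd.iset x (.lit 0)).keepsBase = true) : Base b m d K (σ.setIreg x v) :=
  h.frame (c := .iset x (.lit 0)) ⟨fun y hy => by
    have : y ≠ x := by rintro rfl; simp [Cmd.wi] at hy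
    simp [this], fun _ _ => rfl, fun _ _ => rfl⟩ hx

/-- The sum of the polynomials in registers `x` and `y`. -/
def addE (x y : ℕ) : IExpr :=
  .add (.mod (.add (.reg x) (.reg y)) (.reg 0)) (.mul (.reg 0) (.add
    (.get 1 (.add (.mul (.mod (.div (.reg x) (.reg 0)) (.reg 7)) (.reg 7))
      (.mod (.div (.reg y) (.reg 0)) (.reg 7))))
    (.mul (.reg 7) (.get 1 (.add (.mul (.div (.div (.reg x) (.reg 0)) (.reg 7)) (.reg 7))
      (.div (.div (.reg y) (.reg 0)) (.reg 7)))))))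

section
variable {W V b m d K : ℕ} [hb : Fact b.Prime] {σ : Store}

theorem addE_safe (h : Base b m d K σ) (x y : ℕ) : (addE x y).Safe σ := by
  have := hb.out.pos.ne'
  simp [addE, IExpr.Safe, IExpr.eval, h.r0, h.r7, this]

/-- Write `f = c + X * (lo + X ^ (m / 2) * hi)`. The constants are added modulo `b` and the two
blocks by table lookup, so the cost depends neither on `b` nor on `m`. -/
theorem addE_eval (hD : Dims b m d V) (h : Base b m d K σ) {x y : ℕ} (hx : σ.ireg x < b ^ m)
    (hy : σ.ireg y < b ^ m) : (addE x y).eval σ < b ^ m ∧ digitPoly b ((addE x y).eval σ) =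
      digitPoly b (σ.ireg x) + digitPoly b (σ.ireg y) := by
  have hbp := hb.out.pos
  simp only [addE, IExpr.eval, h.r0, h.r7]
  set u := σ.ireg x
  set v := σ.ireg y
  have hB : 0 < b ^ (m / 2) := pow_pos hbp _
  have hlt : ∀ {w}, w < b ^ m → w / b / b ^ (m / 2) < b ^ (m / 2) := by
    intro w hw
    rw [Nat.div_lt_iff_lt_mul hB, Nat.div_lt_iff_lt_mul hbp]
    refine hw.trans_le ?_
    rw [hD.pow_pred, mul_comm]
    exact Nat.mul_le_mul_right _ pow_pred_le
  have h1 := h.tab (u / b % b ^ (m / 2)) (Nat.mod_lt _ hB) (v / b % b ^ (m / 2)) (Nat.mod_lt _ hB)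
  have h2 := h.tab _ (hlt hx) _ (hlt hy)
  have h1lt : σ.iarr 1 (u / b % b ^ (m / 2) * b ^ (m / 2) + v / b % b ^ (m / 2)) < b ^ (m / 2) := by
    rw [← degree_digitPoly_lt, h1]
    exact (degree_add_le _ _).trans_lt (max_lt (degree_digitPoly_lt.2 (Nat.mod_lt _ hB))
      (degree_digitPoly_lt.2 (Nat.mod_lt _ hB)))
  have key : ∀ w, digitPoly b w = C (w : ZMod b) + X * (digitPoly b (w / b % b ^ (m / 2)) +
      X ^ (m / 2) * digitPoly b (w / b / b ^ (m / 2))) := by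
    intro w; rw [← digitPoly_mod_add, ← digitPoly_eq]
  have hval : digitPoly b ((u + v) % b + b *
      (σ.iarr 1 (u / b % b ^ (m / 2) * b ^ (m / 2) + v / b % b ^ (m / 2)) + b ^ (m / 2) *
        σ.iarr 1 (u / b / b ^ (m / 2) * b ^ (m / 2) + v / b / b ^ (m / 2)))) =
      digitPoly b u + digitPoly b v := by
    rw [digitPoly_add_mul (Nat.mod_lt _ hbp), digitPoly_add_pow_mul _ h1lt, h1, h2, key u, key v]
    simp only [ZMod.natCast_mod, Nat.cast_add, map_add]
    ring
  refine ⟨?_, hval⟩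
  rw [← degree_digitPoly_lt, hval]
  exact (degree_add_le _ _).trans_lt (max_lt (degree_digitPoly_lt.2 hx) (degree_digitPoly_lt.2 hy))

theorem wp_addE (hD : Dims b m d V) (h : Base b m d K σ) {x y z : ℕ} {Q : Store → Prop}
    (hx : σ.ireg x < b ^ m) (hy : σ.ireg y < b ^ m)
    (hQ : ∀ v < b ^ m, digitPoly b v = digitPoly b (σ.ireg x) + digitPoly b (σ.ireg y) →
      Q (σ.setIreg z v)) : WP V (.iset z (addE x y)) Q σ := by
  obtain ⟨h1, h2⟩ := addE_eval hD h hx hy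
  have := hD.N_le
  exact ⟨addE_safe h x y, by omega, hQ _ h1 h2⟩

/-- The step from `j u` to `(j + 1) u` by one addition of codes. -/
def scalBody (a u : ℕ) : Cmd :=
  .seq (.iset 23 (.get a (.reg 22))) (.seq (.iset 23 (addE 23 u))
    (.iput a (.add (.reg 22) (.lit 1)) (.reg 23)))

/-- Stores the multiples `0, u, 2 u, …, b u` of the polynomial in register `u` in array `a`. -/
def scalTable (a u : ℕ) : Cmd :=
  .seq (.iput a (.lit 0) (.lit 0)) (.for 22 0 (scalBody a u))

theorem scalTable_spec (hM : Machine W V) (hD : Dims b m d V) (hσ : Bdd V σ) (h : Base b m d K σ)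
    {a u : ℕ} (hk : (scalTable a u).keepsBase = true) (hu : (scalTable a u).wi u = false)
    (hlt : σ.ireg u < b ^ m) :
    Run W V (scalTable a u) σ (b * 100) (fun τ => ∀ j ≤ b, τ.iarr a j < b ^ m ∧
      digitPoly b (τ.iarr a j) = C (j : ZMod b) * digitPoly b (σ.ireg u)) := by
  have hN := hD.N_le
  have h2 := hD.two_le
  have hbN := hD.b_le
  have hu' : Nat.beq u 22 = false ∧ Nat.beq u 23 = false := by
    simp [scalTable, scalBody, Cmd.for, Cmd.wi] at hu; exact ⟨hu.1, hu.2.1⟩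
  refine Run.mono (T := 3 + (b * (60 + 7) + 5)) ?_ (by have := hb.out.two_le; omega)
    fun _ _ _ h => h
  refine Run.seq (Q := fun τ => τ = σ.setIarr a 0 0)
    (Run.of_wp hM hσ rfl le_rfl (by simp [WP, IExpr.Safe, IExpr.eval]; omega)) ?_
  rintro σ1 hσ1 hF1 rfl
  have h1 : Base b m d K (σ.setIarr a 0 0) :=
    h.frame (hF1.mono (c' := scalTable a u) (by simp [scalTable, Cmd.wi])
      (by simp +contextual [scalTable, Cmd.wia]) (by simp [scalTable, Cmd.wra])) hk
  have hloop := Run.for (W := W) (V := V) (x := 22) (r := 0) (c := scalBody a u) (T := 60)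
    (fun i τ => ∀ j ≤ i, τ.iarr a j < b ^ m ∧
      digitPoly b (τ.iarr a j) = C (j : ZMod b) * digitPoly b (σ.ireg u)) hM hσ1 rfl rfl rfl
    (fun _ _ _ h => h) (by intro j hj; simp [Nat.le_zero.1 hj]; omega) (by
      intro i hi τ hτ hF hx hI
      have hB : Base b m d K τ := h1.frame (hF.mono (c' := scalTable a u) (by simp [scalTable, Cmd.wi])
        (by simp +contextual [scalTable, Cmd.wia]) (by simp [scalTable, Cmd.wra])) hk
      have hub : τ.ireg u = σ.ireg u := (hF.ireg u (by
        simp only [Cmd.for, scalBody, Cmd.wi, hu'.1, hu'.2]; rfl)).trans rfl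
      refine Run.of_wp hM hτ rfl (by simp [scalBody, addE, Cmd.tcost, IExpr.cost]) ?_
      obtain ⟨hI1, hI2⟩ := hI i le_rfl
      rw [scalBody, WP, WP]
      refine ⟨trivial, by simp only [IExpr.eval, hx]; omega, ?_⟩
      rw [WP]
      refine wp_addE hD (hB.setIreg _ rfl) (by simpa [IExpr.eval, hx] using hI1)
        (by simpa [ne_of_beq hu'.2, hub] using hlt) ?_
      intro v hv hv'
      simp only [WP, IExpr.Safe, IExpr.eval, setIreg_ireg, if_true, and_self, true_and, setIreg_iarr, hx,
        setIarr_iarr] at hv' ⊢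
      refine ⟨by omega, ?_⟩
      norm_num [hx]
      intro j hj
      split_ifs with hji
      · refine ⟨hv, ?_⟩
        rw [hv', hI2, if_neg (ne_of_beq hu'.2), hub, hji]
        simp only [map_natCast, Nat.cast_add, Nat.cast_one]
        ring
      · exact hI j (by omega))
  simpa [h.r0] using hloop

def mulBodyTail : Cmd :=
  .seq (.iset 23 (addE 23 24)) (.seq (.iset 24 (.get 2 (.mod (.reg 22) (.reg 0))))
      (.seq (.iset 23 (addE 23 24)) (.iput 4 (.reg 22) (.reg 23))))

/-- A Horner step: `c y = X * (c * (y / b)) + y₀ c`. If `z` encodes `c * (y / b)`, its top digit `z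
/ b ^ (m - 1)` overflows under multiplication by `X` and is replaced through the reduction table in
array `3`. The multiples `y₀ c` are in array `2`. -/
def mulBody : Cmd :=
  .seq (.seq (.iset 23 (.get 4 (.div (.reg 22) (.reg 0))))
    (.seq (.iset 24 (.get 3 (.div (.reg 23) (.reg 6))))
      (.iset 23 (.mul (.mod (.reg 23) (.reg 6)) (.reg 0)))))
    mulBodyTail

/-- Stores the products of the polynomial in register `20` with the polynomials that are encoded
by the integers below the content of register `21` in array `4`. -/
def mulTable : Cmd :=
  .seq (scalTable 2 20) (.seq (.iput 4 (.lit 0) (.lit 0)) (.for 22 21 mulBody))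

/-- Array `3` contains the residues of `t x ^ m` for `t < b`. -/
def RedTab {R : Type*} [CommRing R] (f : (ZMod b)[X] →+* R) (m : ℕ) (σ : Store) : Prop :=
  ∀ t < b, σ.iarr 3 t < b ^ m ∧ f (digitPoly b (σ.iarr 3 t)) = f (C (t : ZMod b) * X ^ m)

/-- Array `4` contains the products of `c` with the polynomials encoded by integers below `l`. -/
def MulTab {R : Type*} [CommRing R] (f : (ZMod b)[X] →+* R) (m : ℕ) (c : R) (l : ℕ)
    (σ : Store) : Prop :=
  ∀ y < l, σ.iarr 4 y < b ^ m ∧ f (digitPoly b (σ.iarr 4 y)) = c * f (digitPoly b y)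

/-- The ring homomorphism is arbitrary because the same program is used modulo `X ^ m` in the sieve
and modulo `p` in the residue field; only the reduction table differs. The time is proportional to
`b` plus the requested length, not to `N`, and the sieve depends on this. -/
theorem mulTable_spec {R : Type*} [CommRing R] (f : (ZMod b)[X] →+* R) (hM : Machine W V)
    (hD : Dims b m d V) (hσ : Bdd V σ) (h : Base b m d K σ) (hr : RedTab f m σ)
    (hu : σ.ireg 20 < b ^ m) :
    Run W V mulTable σ (b * 100 + σ.ireg 21 * 150 + 10)
      (MulTab f m (f (digitPoly b (σ.ireg 20))) (σ.ireg 21)) := by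
  have hN := hD.N_le
  have h2 := hD.two_le
  have hbN := hD.b_le
  have hbp := hb.out.pos
  have hP : 0 < b ^ (m - 1) := pow_pos hbp _
  have hpp := hD.pow_pred
  refine Run.mono (T := b * 100 + (3 + (σ.ireg 21 * (120 + 7) + 5))) ?_ (by omega)
    fun _ _ _ h => h
  refine Run.seq (scalTable_spec hM hD hσ h rfl rfl hu) ?_
  intro σ1 hσ1 hF1 hS
  have e21 : σ1.ireg 21 = σ.ireg 21 := hF1.ireg 21 rfl
  have hB1 := h.frame hF1 rfl
  have hr1 : RedTab f m σ1 := by unfold RedTab; rw [hF1.iarr 3 rfl]; exact hr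
  refine Run.seq (Q := fun τ => τ = σ1.setIarr 4 0 0)
    (Run.of_wp hM hσ1 rfl le_rfl (by simp [WP, IExpr.Safe, IExpr.eval]; omega)) ?_
  rintro σ2 hσ2 hF2 rfl
  have hB2 := hB1.frame hF2 rfl
  set c := f (digitPoly b (σ.ireg 20)) with hc
  -- The alternative `y = 0` is kept throughout, since the round `i = 0` already reads cell `0`.
  have hloop := Run.for (W := W) (V := V) (σ := σ1.setIarr 4 0 0) (x := 22) (r := 21)
    (c := mulBody) (T := 120) (fun i τ => ∀ y, (y = 0 ∨ y < i) → τ.iarr 4 y < b ^ m ∧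
      f (digitPoly b (τ.iarr 4 y)) = c * f (digitPoly b y)) hM hσ2 rfl rfl rfl
    (fun _ _ _ h => h) (by intro j hj; simp [show j = 0 by omega]; omega) (by
      intro i hi τ hτ hF hx hI
      have hB := hB2.frame hF rfl
      have hr2 : RedTab f m τ := by
        unfold RedTab; rw [hF.iarr 3 rfl, hF2.iarr 3 rfl]; exact hr1
      have hS2 : ∀ j ≤ b, τ.iarr 2 j < b ^ m ∧
          digitPoly b (τ.iarr 2 j) = C (j : ZMod b) * digitPoly b (σ.ireg 20) := by
        rw [hF.iarr 2 rfl, hF2.iarr 2 rfl]; exact hS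
      refine Run.of_wp hM hτ rfl (by decide) ?_
      obtain ⟨hz, hz'⟩ := hI (i / b) (by
        rcases Nat.eq_zero_or_pos i with h0 | h0
        · left; simp [h0]
        · right; exact Nat.div_lt_self h0 hb.out.one_lt)
      set z := τ.iarr 4 (i / b) with hzdef
      have ht : z / b ^ (m - 1) < b := by
        rw [Nat.div_lt_iff_lt_mul hP, ← hpp]; exact hz
      obtain ⟨hr3, hr4⟩ := hr2 _ ht
      have hz1 : z % b ^ (m - 1) * b < b ^ m := by
        rw [hpp, mul_comm]; exact Nat.mul_lt_mul_of_pos_left (Nat.mod_lt _ hP) hbp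
      rw [mulBody, WP]
      simp only [WP, IExpr.Safe, IExpr.eval, hB.r0, hB.r6, hx, setIreg_ireg, setIreg_iarr, ← hzdef,
        ite_true, Nat.reduceEqDiff, ite_false, true_and]
      refine ⟨by simpa using hbp.ne', by omega, by simpa [hB.r6] using hP.ne', ?_, ?_, ?_, ?_⟩
      · omega
      · simpa [hB.r6] using hP.ne'
      · omega
      obtain ⟨hs3, hs4⟩ := hS2 (i % b) (Nat.mod_lt _ hbp).le
      rw [mulBodyTail, WP]
      refine wp_addE hD (((hB.setIreg _ rfl).setIreg _ rfl).setIreg _ rfl) (by simpa using hz1)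
        (by simpa using hr3) ?_
      intro v1 hv1 hv1'
      simp only [setIreg_ireg, if_true, Nat.reduceEqDiff, if_false] at hv1'
      rw [WP, WP]
      refine ⟨by simpa [IExpr.Safe, IExpr.eval, hB.r0] using hbp.ne',
        by simp [IExpr.eval, hB.r0, hx]; omega, ?_⟩
      rw [WP]
      refine wp_addE hD ((((hB.setIreg _ rfl).setIreg _ rfl).setIreg _ rfl).setIreg _ rfl
        |>.setIreg _ rfl) (by simpa using hv1) (by simpa [IExpr.eval, hB.r0, hx] using hs3) ?_
      intro v2 hv2 hv2'
      simp [hx, hB.r0, IExpr.eval] at hv2'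
      simp only [WP, IExpr.Safe, IExpr.eval, setIreg_ireg, if_true, true_and, Nat.reduceEqDiff,
        if_false, hx, setIarr_iarr, setIreg_iarr]
      refine ⟨by omega, ?_⟩
      have hfin : f (digitPoly b v2) = c * f (digitPoly b i) := by
        have e1 : digitPoly b (z % b ^ (m - 1) * b) = X * digitPoly b (z % b ^ (m - 1)) := by
          have := digitPoly_add_mul hbp (z % b ^ (m - 1))
          simpa [mul_comm b] using this
        have e2 : digitPoly b z = digitPoly b (z % b ^ (m - 1)) + X ^ (m - 1) * 
            C ((z / b ^ (m - 1) : ℕ) : ZMod b) := by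
          conv_lhs => rw [digitPoly_mod_add (m - 1) z]
          rw [digitPoly_of_lt ht]
        have e3 : (X : (ZMod b)[X]) ^ m = X * X ^ (m - 1) := by
          rw [← pow_succ', Nat.sub_add_cancel hD.1]
        have e4 : f (digitPoly b v1) = f X * f (digitPoly b z) := by
          rw [hv1', map_add, hr4, e1, e2, e3]
          simp only [map_mul, map_add, map_pow]
          ring
        rw [hv2', map_add, e4, hz', hs4, digitPoly_eq i]
        simp only [map_mul, map_add, ZMod.natCast_mod]
        ring
      intro y hy
      split_ifs with hyi
      · exact ⟨hv2, by rw [hfin, hyi]⟩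
      · exact hI y (by omega))
  simp only [setIarr_ireg, e21] at hloop
  refine hloop.mono le_rfl ?_
  intro τ _ _ hI y hy
  exact hI y (Or.inr hy)

/-- Stores the powers of an element in array `a`, using its multiplication table. -/
def powTable (a : ℕ) : Cmd :=
  .seq (.iput a (.lit 0) (.lit 1)) (.for 22 4 (.iput a (.add (.reg 22) (.lit 1))
    (.get 4 (.get a (.reg 22)))))

/-- Array `a` contains the powers of `c` with exponents up to `N`. -/
def PowTab {R : Type*} [CommRing R] (f : (ZMod b)[X] →+* R) (m : ℕ) (c : R) (a : ℕ)
    (σ : Store) : Prop :=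
  ∀ i ≤ b ^ m, σ.iarr a i < b ^ m ∧ f (digitPoly b (σ.iarr a i)) = c ^ i

theorem powTable_spec {R : Type*} [CommRing R] (f : (ZMod b)[X] →+* R) (hM : Machine W V)
    (hD : Dims b m d V) (hσ : Bdd V σ) (h : Base b m d K σ) {c : R} (ht : MulTab f m c (b ^ m) σ)
    {a : ℕ} (ha : Nat.beq 4 a = false) :
    Run W V (powTable a) σ (b ^ m * 25) (PowTab f m c a) := by
  have hN := hD.N_le
  have h2 := hD.two_le
  refine Run.mono (T := 3 + (b ^ m * (7 + 7) + 5)) ?_ (by omega) fun _ _ _ h => h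
  refine Run.seq (Q := fun τ => τ = σ.setIarr a 0 1)
    (Run.of_wp hM hσ rfl le_rfl (by simp [WP, IExpr.Safe, IExpr.eval]; omega)) ?_
  rintro σ1 hσ1 hF1 rfl
  have hloop := Run.for (W := W) (V := V) (σ := σ.setIarr a 0 1) (x := 22) (r := 4)
    (c := .iput a (.add (.reg 22) (.lit 1)) (.get 4 (.get a (.reg 22)))) (T := 7)
    (fun i τ => ∀ j ≤ i, τ.iarr a j < b ^ m ∧ f (digitPoly b (τ.iarr a j)) = c ^ j) hM hσ1
    rfl rfl rfl (fun _ _ _ h => h) (by intro j hj; simp [Nat.le_zero.1 hj]; omega) (by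
      intro i hi τ hτ hF hx hI
      have h4 : τ.iarr 4 = σ.iarr 4 := by
        rw [hF.iarr 4 (by simp only [Cmd.for, Cmd.wia, ha]; rfl)]
        ext j; simp [ne_of_beq ha]
      refine Run.of_wp hM hτ rfl (by simp [Cmd.tcost, IExpr.cost]) ?_
      obtain ⟨hI1, hI2⟩ := hI i le_rfl
      obtain ⟨ht1, ht2⟩ := ht _ hI1
      simp only [WP, IExpr.Safe, IExpr.eval, hx, h4, true_and, and_self, setIarr_iarr, if_true]
      refine ⟨by omega, ?_⟩
      intro j hj
      split_ifs with hji
      · exact ⟨ht1, by rw [ht2, hI2, hji, pow_succ, mul_comm]⟩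
      · exact hI j (by omega))
  simp only [setIarr_ireg, h.r4] at hloop
  exact hloop

end

end RealRAM

/-! ## A sieve for irreducible polynomials -/

namespace PolyLattice

open Polynomial

section
variable {b : ℕ} [hb : Fact b.Prime]

theorem digitPoly_pow_add {k q : ℕ} (hq : q < b ^ k) :
    digitPoly b (b ^ k + q) = X ^ k + digitPoly b q := by
  have := digitPoly_add_pow_mul k hq 1
  rw [mul_one] at this
  rw [add_comm (b ^ k), this]
  simp [add_comm]

theorem monic_digitPoly {k q : ℕ} (hq : q < b ^ k) : (digitPoly b (b ^ k + q)).Monic := by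
  rw [digitPoly_pow_add hq]
  exact monic_X_pow_add (degree_digitPoly_lt.2 hq)

theorem natDegree_digitPoly_pow_add {k q : ℕ} (hq : q < b ^ k) :
    (digitPoly b (b ^ k + q)).natDegree = k := by
  rw [digitPoly_pow_add hq]
  exact natDegree_eq_of_degree_eq_some (by
    rw [degree_add_eq_left_of_degree_lt] <;> rw [degree_X_pow]; exact degree_digitPoly_lt.2 hq)

theorem exists_code_of_monic {f : (ZMod b)[X]} (hf : f.Monic) :
    ∃ q < b ^ f.natDegree, digitPoly b (b ^ f.natDegree + q) = f := by
  obtain ⟨q, hq⟩ := digitPoly_surjective (f - X ^ f.natDegree)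
  have hlt : q < b ^ f.natDegree := by
    rw [← degree_digitPoly_lt, hq, ← degree_eq_natDegree hf.ne_zero]
    exact degree_sub_lt_left (by rw [degree_X_pow, degree_eq_natDegree hf.ne_zero]) hf.ne_zero
      (by rw [hf.leadingCoeff, (monic_X_pow _).leadingCoeff])
  refine ⟨q, hlt, ?_⟩
  rw [digitPoly_pow_add hlt, hq]; ring

/-- The minimal polynomial of a primitive element of the field with `b ^ m` elements is monic and
irreducible of degree `m`. -/
theorem exists_irreducible_code {m : ℕ} (hm : 1 ≤ m) :
    ∃ r < b ^ m, Irreducible (digitPoly b (b ^ m + r)) := by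
  obtain ⟨α, hα⟩ := Field.exists_primitive_element (ZMod b) (GaloisField b m)
  have hdeg := (Field.primitive_element_iff_minpoly_natDegree_eq (ZMod b) α).1 hα
  rw [GaloisField.finrank b (by omega)] at hdeg
  have hint : IsIntegral (ZMod b) α := Algebra.IsIntegral.isIntegral α
  obtain ⟨q, hq, h⟩ := exists_code_of_monic (minpoly.monic hint)
  rw [hdeg] at hq h
  exact ⟨q, hq, h ▸ minpoly.irreducible hint⟩

theorem not_irreducible_of_mul {k k' q h r m : ℕ} (hk : 1 ≤ k) (hk' : 1 ≤ k') (hq : q < b ^ k)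
    (hh : h < b ^ k') (hr : digitPoly b (b ^ m + r) =
      digitPoly b (b ^ k + q) * digitPoly b (b ^ k' + h)) :
    ¬ Irreducible (digitPoly b (b ^ m + r)) := by
  intro hirr
  have h1 := natDegree_digitPoly_pow_add hq
  have h2 := natDegree_digitPoly_pow_add hh
  rcases hirr.isUnit_or_isUnit hr with h | h
  · rw [natDegree_eq_zero_of_isUnit h] at h1; omega
  · rw [natDegree_eq_zero_of_isUnit h] at h2; omega

/-- For a monic polynomial it suffices to exclude monic factors, whose degrees `k` and `m - k` then
both lie between `1` and `m - 1`. -/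
theorem irreducible_of_forall_mul_ne {m r : ℕ} (hm : 1 ≤ m) (hr : r < b ^ m)
    (h : ∀ k q l, 1 ≤ k → k ≤ m - 1 → q < b ^ k → l < b ^ (m - k) →
      digitPoly b (b ^ m + r) ≠ digitPoly b (b ^ k + q) * digitPoly b (b ^ (m - k) + l)) :
    Irreducible (digitPoly b (b ^ m + r)) := by
  have hmon := monic_digitPoly hr
  have hdeg := natDegree_digitPoly_pow_add hr
  rw [hmon.irreducible_iff_natDegree]
  refine ⟨fun h1 => by rw [h1] at hdeg; simp at hdeg; omega, fun f g hf hg hfg => ?_⟩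
  by_contra hcon
  rw [not_or] at hcon
  have hsum : f.natDegree + g.natDegree = m := by rw [← hf.natDegree_mul hg, hfg, hdeg]
  obtain ⟨q, hq, hq'⟩ := exists_code_of_monic hf
  obtain ⟨l, hl, hl'⟩ := exists_code_of_monic hg
  have hg' : g.natDegree = m - f.natDegree := by omega
  rw [hg'] at hl hl'
  exact h f.natDegree q l (by omega) (by omega) hq hl (by rw [hq', hl', hfg])

/-- Working modulo `X ^ m` loses only the leading term of the product, and this is known to be `X ^
m` because both factors are monic of complementary degrees. Codes below `N` thus suffice for
polynomials of degree `m`. -/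
theorem code_eq_of_mk_eq {k q h r m : ℕ} (hk : k ≤ m) (hq : q < b ^ k) (hh : h < b ^ (m - k))
    (hr : r < b ^ m) (he : AdjoinRoot.mk (X ^ m) (digitPoly b r) =
      AdjoinRoot.mk (X ^ m) (digitPoly b (b ^ k + q)) *
        AdjoinRoot.mk (X ^ m) (digitPoly b (b ^ (m - k) + h))) :
    digitPoly b (b ^ m + r) = digitPoly b (b ^ k + q) * digitPoly b (b ^ (m - k) + h) := by
  rw [← map_mul, AdjoinRoot.mk_eq_mk] at he
  set P := digitPoly b (b ^ k + q) * digitPoly b (b ^ (m - k) + h) with hP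
  have hPm : P.Monic := (monic_digitPoly hq).mul (monic_digitPoly hh)
  have hPd : P.natDegree = m := by
    rw [hP, (monic_digitPoly hq).natDegree_mul (monic_digitPoly hh),
      natDegree_digitPoly_pow_add hq, natDegree_digitPoly_pow_add hh]
    omega
  obtain ⟨l, hl, hl'⟩ := exists_code_of_monic hPm
  rw [hPd] at hl hl'
  rw [digitPoly_pow_add hr]
  rw [digitPoly_pow_add hl] at hl'
  have h2 : (X : (ZMod b)[X]) ^ m ∣ digitPoly b r - digitPoly b l := by
    have : digitPoly b r - digitPoly b l = (digitPoly b r - P) + X ^ m := by rw [← hl']; ring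
    rw [this]; exact dvd_add he dvd_rfl
  have h3 : digitPoly b r - digitPoly b l = 0 := by
    by_contra hne
    have h4 := Polynomial.degree_le_of_dvd h2 hne
    have h5 : (digitPoly b r - digitPoly b l).degree < m :=
      (degree_sub_le _ _).trans_lt (max_lt (degree_digitPoly_lt.2 hr) (degree_digitPoly_lt.2 hl))
    rw [degree_X_pow] at h4
    exact absurd h5 (not_lt.2 h4)
  rw [← hl', sub_eq_zero.1 h3]

end

end PolyLattice

/-! ### The sieve as a program. -/

namespace RealRAM

open Polynomial PolyLattice

/-- The marks in array `9` only concern reducible polynomials `x ^ m + r`, and all products of the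
monic polynomials with lower coefficients `q` and `l` of degrees `k` and `m - k` with `S k q l` are
marked. -/
def Sieved (b m : ℕ) (S : ℕ → ℕ → ℕ → Prop) (σ : Store) : Prop :=
  (∀ r < b ^ m, σ.iarr 9 r ≠ 0 → ¬ Irreducible (digitPoly b (b ^ m + r))) ∧
  ∀ k q l, S k q l → ∀ r < b ^ m,
    digitPoly b (b ^ m + r) = digitPoly b (b ^ k + q) * digitPoly b (b ^ (m - k) + l) →
    σ.iarr 9 r ≠ 0

theorem Sieved.mono {b m : ℕ} {S S' : ℕ → ℕ → ℕ → Prop} {σ : Store} (h : Sieved b m S σ)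
    (hS : ∀ k q l, S' k q l → S k q l) : Sieved b m S' σ :=
  ⟨h.1, fun k q l hs => h.2 k q l (hS k q l hs)⟩

/-- Register `17` holds `b ^ (m - k)`. The monic cofactors of degree `m - k` have the codes from `b
^ (m - k)` up to `2 * b ^ (m - k)`, so a multiplication table of this short length is enough. -/
def sieveRow : Cmd := .for 19 17 (.iput 9 (.get 4 (.add (.reg 17) (.reg 19))) (.lit 1))

def sieveFactor : Cmd :=
  .seq (.seq (.iset 20 (.add (.reg 16) (.reg 18))) (.iset 21 (.mul (.lit 2) (.reg 17))))
    (.seq mulTable sieveRow)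

def sieveDegree : Cmd :=
  .seq (.seq (.iset 16 (.mul (.reg 16) (.reg 0))) (.iset 17 (.div (.reg 17) (.reg 0))))
    (.for 18 16 sieveFactor)

/-- Marks the reducible monic polynomials of degree `m`. -/
def sieve : Cmd :=
  .seq (.seq (.iset 15 (.sub (.reg 1) (.lit 1))) (.seq (.iset 16 (.lit 1)) (.iset 17 (.reg 4))))
    (.for 14 15 sieveDegree)

/-- Sets register `3` to an irreducible monic polynomial of degree `m`. -/
def findModulus : Cmd :=
  .seq sieve (.seq (searchMin 13 4 28 29 (.ieq (.get 9 (.sub (.reg 28) (.lit 1))) (.lit 0)))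
    (.iset 3 (.sub (.add (.reg 4) (.reg 29)) (.lit 1))))

section
variable {W V b m d K : ℕ} [hb : Fact b.Prime] {σ : Store}

theorem sieveRow_spec (hM : Machine W V) (hD : Dims b m d V) (hσ : Bdd V σ)
    {S : ℕ → ℕ → ℕ → Prop} {k q : ℕ} (hk : 1 ≤ k) (hkm : k ≤ m - 1) (hq : q < b ^ k)
    (h17 : σ.ireg 17 = b ^ (m - k)) (hS : Sieved b m S σ)
    (ht : MulTab (AdjoinRoot.mk (X ^ m)) m (AdjoinRoot.mk (X ^ m) (digitPoly b (b ^ k + q)))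
      (2 * b ^ (m - k)) σ) :
    Run W V sieveRow σ (b ^ (m - k) * 13 + 5)
      (Sieved b m fun k' q' l' => S k' q' l' ∨ (k' = k ∧ q' = q ∧ l' < b ^ (m - k))) := by
  have hN := hD.N_le
  have hloop := Run.for (W := W) (V := V) (σ := σ) (x := 19) (r := 17)
    (c := .iput 9 (.get 4 (.add (.reg 17) (.reg 19))) (.lit 1)) (T := 6)
    (fun i => Sieved b m fun k' q' l' => S k' q' l' ∨ (k' = k ∧ q' = q ∧ l' < i)) hM hσ
    rfl rfl rfl (fun _ _ _ h => h) (hS.mono (by intro k q l; simp)) (by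
      rw [h17]
      intro i hi τ hτ hF hx hI
      have e17 : τ.ireg 17 = b ^ (m - k) := (hF.ireg 17 rfl).trans h17
      have e4 : τ.iarr 4 = σ.iarr 4 := hF.iarr 4 rfl
      refine Run.of_wp hM hτ rfl (by simp [Cmd.tcost, IExpr.cost]) ?_
      obtain ⟨ht1, ht2⟩ := ht (b ^ (m - k) + i) (by omega)
      set r := σ.iarr 4 (b ^ (m - k) + i) with hr
      have hprod := code_eq_of_mk_eq (by omega) hq hi ht1 ht2
      have hred := not_irreducible_of_mul hk (by omega) hq hi hprod
      simp only [WP, IExpr.Safe, IExpr.eval, hx, e4, e17, ← hr, true_and, and_self]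
      refine ⟨hM.two_le, ?_, ?_⟩
      · intro r' hr'
        simp only [setIarr_iarr, if_true]
        split_ifs with h
        · rw [h]; exact fun _ => hred
        · exact hI.1 r' hr'
      · intro k' q' l' h' r' hr' he
        simp only [setIarr_iarr, if_true]
        split_ifs with h
        · exact one_ne_zero
        · refine hI.2 k' q' l' ?_ r' hr' he
          rcases h' with h' | ⟨rfl, rfl, h'⟩
          · exact Or.inl h'
          · refine Or.inr ⟨rfl, rfl, ?_⟩
            -- A product with the cofactor of this round has the code just marked, by injectivity of
            -- the encoding.
            by_contra hl
            have : l' = i := by omega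
            subst this
            have := digitPoly_injective (he.trans hprod.symm)
            omega)
  simp only [h17] at hloop
  exact hloop

/-- Modulo `X ^ m` every multiple of `X ^ m` reduces to `0`, so untouched memory already is the
right reduction table. -/
theorem redTab_zero (h3 : ∀ t < b, σ.iarr 3 t = 0) (hpos : 0 < b ^ m) :
    RedTab (AdjoinRoot.mk (X ^ m : (ZMod b)[X])) m σ := by
  intro t ht
  rw [h3 t ht]
  refine ⟨hpos, ?_⟩
  rw [map_mul, AdjoinRoot.mk_self]
  simp

theorem sieveFactor_spec (hM : Machine W V) (hD : Dims b m d V) (hσ : Bdd V σ)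
    (hB : Base b m d K σ) {S : ℕ → ℕ → ℕ → Prop} {k q : ℕ} (hk : 1 ≤ k) (hkm : k ≤ m - 1)
    (hq : q < b ^ k) (h16 : σ.ireg 16 = b ^ k) (h17 : σ.ireg 17 = b ^ (m - k))
    (h18 : σ.ireg 18 = q) (h3 : ∀ t < b, σ.iarr 3 t = 0) (hS : Sieved b m S σ) :
    Run W V sieveFactor σ (b * 100 + b ^ (m - k) * 320 + 30)
      (Sieved b m fun k' q' l' => S k' q' l' ∨ (k' = k ∧ q' = q ∧ l' < b ^ (m - k))) := by
  have hN := hD.N_le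
  have hbp := hb.out.pos
  have h2 := hb.out.two_le
  have hpos : 0 < b ^ m := pow_pos hbp m
  have hsplit : b ^ m = b ^ k * b ^ (m - k) := by rw [← pow_add]; congr 1; omega
  have hkk : b ^ k * b ≤ b ^ m := by
    rw [← pow_succ]; exact Nat.pow_le_pow_right hbp (by omega)
  have hk2 : 2 * b ^ k ≤ b ^ m := by nlinarith
  have hmk : 2 * b ^ (m - k) ≤ b ^ m := by
    have : 2 ≤ b ^ k := h2.trans (Nat.le_self_pow (by omega) b)
    rw [hsplit]; exact Nat.mul_le_mul_right _ this
  refine Run.mono (T := 10 + ((b * 100 + 2 * b ^ (m - k) * 150 + 10) + (b ^ (m - k) * 13 + 5)))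
    ?_ (by omega) fun _ _ _ h => h
  refine Run.seq (Q := fun τ => τ = (σ.setIreg 20 (b ^ k + q)).setIreg 21 (2 * b ^ (m - k)))
    (Run.of_wp hM hσ rfl (by decide) ?_) ?_
  · simp [WP, IExpr.Safe, IExpr.eval, h16, h17, h18]
    omega
  rintro σ1 hσ1 - rfl
  have hmul := mulTable_spec (AdjoinRoot.mk (X ^ m : (ZMod b)[X])) hM hD hσ1
    ((hB.setIreg _ rfl).setIreg _ rfl) (redTab_zero (m := m) h3 hpos) (by simp; omega)
  refine Run.seq (Run.mono hmul (by simp) fun _ _ _ h => h) ?_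
  intro σ2 hσ2 hF2 ht
  refine sieveRow_spec hM hD hσ2 hk hkm hq ((hF2.ireg 17 rfl).trans (by simp [h17])) ?_
    (by simpa using ht)
  unfold Sieved
  rw [hF2.iarr 9 rfl]
  exact hS

/-- The `b ^ k` monic polynomials of degree `k` cost `O(b + b ^ (m - k))` each. The total is `O(N)`
because `k ≤ m - 1` gives `b ^ k * b ≤ N`. -/
theorem sieveDegree_spec (hM : Machine W V) (hD : Dims b m d V) (hσ : Bdd V σ)
    (hB : Base b m d K σ) {S : ℕ → ℕ → ℕ → Prop} {k : ℕ} (hk : k < m - 1)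
    (h16 : σ.ireg 16 = b ^ k) (h17 : σ.ireg 17 = b ^ (m - k))
    (h3 : ∀ t < b, σ.iarr 3 t = 0) (hS : Sieved b m S σ) :
    Run W V sieveDegree σ (b ^ m * 480) (fun τ => τ.ireg 16 = b ^ (k + 1) ∧
      τ.ireg 17 = b ^ (m - (k + 1)) ∧
      Sieved b m (fun k' q' l' => S k' q' l' ∨
        (k' = k + 1 ∧ q' < b ^ k' ∧ l' < b ^ (m - k'))) τ) := by
  have hN := hD.N_le
  have hbp := hb.out.pos
  have h2 := hb.out.two_le
  have hsplit : b ^ m = b ^ (k + 1) * b ^ (m - (k + 1)) := by rw [← pow_add]; congr 1; omega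
  have hkk : b ^ (k + 1) * b ≤ b ^ m := by
    rw [← pow_succ]; exact Nat.pow_le_pow_right hbp (by omega)
  have hk2 : 2 * b ^ (k + 1) ≤ b ^ m :=
    le_trans (by rw [mul_comm]; exact Nat.mul_le_mul_left _ h2) hkk
  have hk0 : 0 < b ^ (k + 1) := pow_pos hbp _
  have hdiv : b ^ (m - k) / b = b ^ (m - (k + 1)) := by
    rw [show m - k = m - (k + 1) + 1 by omega, pow_succ, Nat.mul_div_cancel _ hbp]
  have hle : b ^ (m - (k + 1)) ≤ b ^ m := Nat.pow_le_pow_right hbp (by omega)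
  refine Run.mono (T := 12 + (b ^ (k + 1) *
    ((b * 100 + b ^ (m - (k + 1)) * 320 + 30) + 7) + 5)) ?_ ?_ fun _ _ _ h => h
  swap
  · have : b ^ (k + 1) * ((b * 100 + b ^ (m - (k + 1)) * 320 + 30) + 7) =
      b ^ (k + 1) * b * 100 + b ^ (k + 1) * b ^ (m - (k + 1)) * 320 + b ^ (k + 1) * 37 := by ring
    omega
  refine Run.seq (Q := fun τ =>
      τ = (σ.setIreg 16 (b ^ (k + 1))).setIreg 17 (b ^ (m - (k + 1))))
    (Run.of_wp hM hσ rfl (by decide) ?_) ?_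
  · simp [WP, IExpr.Safe, IExpr.eval, h16, h17, hB.r0, hdiv, ← pow_succ]
    omega
  rintro σ1 hσ1 - rfl
  have hB1 : Base b m d K ((σ.setIreg 16 (b ^ (k + 1))).setIreg 17 (b ^ (m - (k + 1)))) :=
    (hB.setIreg _ rfl).setIreg _ rfl
  have hloop := Run.for (W := W) (V := V) (x := 18) (r := 16)
    (σ := (σ.setIreg 16 (b ^ (k + 1))).setIreg 17 (b ^ (m - (k + 1))))
    (c := sieveFactor) (T := b * 100 + b ^ (m - (k + 1)) * 320 + 30)
    (fun i => Sieved b m fun k' q' l' => S k' q' l' ∨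
      (k' = k + 1 ∧ q' < i ∧ l' < b ^ (m - k'))) hM hσ1
    rfl rfl rfl (fun _ _ _ h => h) (hS.mono (by intro k q l; simp)) (by
      intro i hi τ hτ hF hx hI
      have e16 : τ.ireg 16 = b ^ (k + 1) := (hF.ireg 16 rfl).trans (by simp)
      have e17 : τ.ireg 17 = b ^ (m - (k + 1)) := (hF.ireg 17 rfl).trans (by simp)
      refine Run.mono (sieveFactor_spec hM hD hτ (hB1.frame hF rfl) (k := k + 1) (q := i) (by omega) (by omega)
        (by simpa using hi) e16 e17 hx (by rw [hF.iarr 3 rfl]; exact h3) hI) le_rfl ?_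
      intro υ _ _ hυ
      refine hυ.mono ?_
      rintro k' q' l' (h | ⟨rfl, h, h'⟩)
      · exact Or.inl (Or.inl h)
      · rcases Nat.lt_succ_iff_lt_or_eq.1 h with h | h
        · exact Or.inl (Or.inr ⟨rfl, h, h'⟩)
        · exact Or.inr ⟨rfl, h, h'⟩)
  refine Run.mono hloop (by simp) ?_
  intro υ _ hF hυ
  refine ⟨(hF.ireg 16 rfl).trans (by simp), (hF.ireg 17 rfl).trans (by simp), hυ.mono ?_⟩
  rintro k' q' l' (h | ⟨rfl, h, h'⟩)
  · exact Or.inl h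
  · exact Or.inr ⟨rfl, by simpa using h, h'⟩

theorem sieve_spec (hM : Machine W V) (hD : Dims b m d V) (hσ : Bdd V σ) (hB : Base b m d K σ)
    (h3 : ∀ t < b, σ.iarr 3 t = 0) (h9 : ∀ r, σ.iarr 9 r = 0) :
    Run W V sieve σ (m * (b ^ m * 500)) (Sieved b m (fun k q l => 1 ≤ k ∧ k ≤ m - 1 ∧
      q < b ^ k ∧ l < b ^ (m - k))) := by
  have hN := hD.N_le
  have hm := hD.m_lt
  have h2 := hD.two_le
  have hm1 := hD.1
  refine Run.mono (T := 8 + ((m - 1) * (b ^ m * 480 + 7) + 5)) ?_ ?_ fun _ _ _ h => h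
  swap
  · have : (m - 1) * (b ^ m * 480 + 7) ≤ m * (b ^ m * 480 + 7) :=
      Nat.mul_le_mul_right _ (by omega)
    nlinarith
  refine Run.seq (Q := fun τ =>
      τ = ((σ.setIreg 15 (m - 1)).setIreg 16 1).setIreg 17 (b ^ m))
    (Run.of_wp hM hσ rfl (by decide) ?_) ?_
  · simp [WP, IExpr.Safe, IExpr.eval, hB.r1, hB.r4]
    omega
  rintro σ1 hσ1 - rfl
  have hB1 : Base b m d K (((σ.setIreg 15 (m - 1)).setIreg 16 1).setIreg 17 (b ^ m)) :=
    ((hB.setIreg _ rfl).setIreg _ rfl).setIreg _ rfl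
  have hloop := Run.for (W := W) (V := V) (x := 14) (r := 15)
    (σ := ((σ.setIreg 15 (m - 1)).setIreg 16 1).setIreg 17 (b ^ m))
    (c := sieveDegree) (T := b ^ m * 480)
    (fun i τ => τ.ireg 16 = b ^ i ∧ τ.ireg 17 = b ^ (m - i) ∧
      Sieved b m (fun k q l => 1 ≤ k ∧ k ≤ i ∧ q < b ^ k ∧ l < b ^ (m - k)) τ) hM hσ1
    rfl rfl rfl (fun _ _ _ h => h)
    ⟨by simp, by simp, by intro r _; simp [h9], by intro k q l h; omega⟩ (by
      rintro i hi τ hτ hF hx ⟨e16, e17, hI⟩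
      refine Run.mono (sieveDegree_spec hM hD hτ (hB1.frame hF rfl) (by simpa using hi) e16 e17
        (by rw [hF.iarr 3 rfl]; exact h3) hI) le_rfl ?_
      rintro υ _ _ ⟨hυ1, hυ2, hυ⟩
      refine ⟨hυ1, hυ2, hυ.mono ?_⟩
      rintro k' q' l' ⟨h, h', h''⟩
      by_cases hk : k' = i + 1
      · exact Or.inr ⟨hk, h''⟩
      · exact Or.inl ⟨h, by omega, h''⟩)
  refine Run.mono hloop (by simp) ?_
  rintro υ _ hF ⟨-, -, hυ⟩
  simpa using hυ

theorem findModulus_spec (hM : Machine W V) (hD : Dims b m d V) (hσ : Bdd V σ)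
    (hB : Base b m d K σ) (h3 : ∀ t < b, σ.iarr 3 t = 0) (h9 : ∀ r, σ.iarr 9 r = 0) :
    Run W V findModulus σ (m * (b ^ m * 600)) (fun τ => Irreducible (digitPoly b (τ.ireg 3)) ∧
      (digitPoly b (τ.ireg 3)).natDegree = m) := by
  have hN := hD.N_le
  have h2 := hD.two_le
  have hm1 := hD.1
  refine Run.mono (T := m * (b ^ m * 500) + ((b ^ m * 26 + 5) + 6)) ?_ (by nlinarith)
    fun _ _ _ h => h
  refine Run.seq (sieve_spec hM hD hσ hB h3 h9) ?_
  intro σ1 hσ1 hF1 hS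
  have hB1 := hB.frame hF1 rfl
  refine Run.seq (Run.mono (searchMin_spec hM hσ1 (fun t => σ1.iarr 9 (t - 1) = 0) rfl rfl ?_ ?_)
    (by rw [hB1.r4]; exact le_rfl) fun _ _ _ h => h) ?_
  · intro τ hF _ _
    simp [BExpr.Safe, BExpr.Holds, IExpr.Safe, IExpr.eval, hF.iarr 9 rfl]
  · obtain ⟨r, hr, hirr⟩ := exists_irreducible_code (b := b) hm1
    -- `searchMin` starts at `1`, so cell `r` is represented by the candidate `r + 1`.
    refine ⟨r + 1, by omega, by rw [hB1.r4]; omega, ?_⟩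
    by_contra h
    exact hS.1 r hr h hirr
  rintro σ2 hσ2 hF2 ⟨g1, g2, g3, -⟩
  have hB2 := hB1.frame hF2 rfl
  rw [hB1.r4] at g2
  refine Run.of_wp hM hσ2 rfl (by decide) ?_
  have hr : σ2.ireg 29 - 1 < b ^ m := by omega
  have heq : b ^ m + σ2.ireg 29 - 1 = b ^ m + (σ2.ireg 29 - 1) := by omega
  simp only [WP, IExpr.Safe, IExpr.eval, hB2.r4, setIreg_ireg, if_true, true_and, and_self, heq]
  refine ⟨by omega, ?_, natDegree_digitPoly_pow_add hr⟩
  refine irreducible_of_forall_mul_ne hm1 hr ?_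
  intro k q l a1 a2 a3 a4 he
  exact hS.2 k q l ⟨a1, a2, a3, a4⟩ _ hr he g3

end

end RealRAM

/-! ## The residue field: reduction table and a generator of the multiplicative group -/

namespace PolyLattice

open Polynomial

section
variable {b : ℕ} [hb : Fact b.Prime] {p : (ZMod b)[X]} {m : ℕ}

theorem mk_digitPoly_injOn (hp : p.natDegree = m) {x y : ℕ} (hx : x < b ^ m)
    (hy : y < b ^ m) (h : AdjoinRoot.mk p (digitPoly b x) = AdjoinRoot.mk p (digitPoly b y)) :
    x = y := by
  rw [AdjoinRoot.mk_eq_mk] at h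
  by_contra hne
  have hne' : digitPoly b x - digitPoly b y ≠ 0 :=
    sub_ne_zero.2 fun he => hne (digitPoly_injective he)
  have h1 := Polynomial.natDegree_le_of_dvd h hne'
  have h5 : (digitPoly b x - digitPoly b y).degree < m :=
    (degree_sub_le _ _).trans_lt (max_lt (degree_digitPoly_lt.2 hx) (degree_digitPoly_lt.2 hy))
  rw [← natDegree_lt_iff_degree_lt hne'] at h5
  omega

theorem exists_code_mk (hm : 1 ≤ m) (hp : p.natDegree = m) (κ : AdjoinRoot p) :
    ∃ x < b ^ m, AdjoinRoot.mk p (digitPoly b x) = κ := by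
  obtain ⟨g, rfl⟩ := AdjoinRoot.mk_surjective κ
  have hp0 : p ≠ 0 := by rintro rfl; simp at hp; omega
  obtain ⟨x, hx⟩ := digitPoly_surjective (g % p)
  refine ⟨x, ?_, ?_⟩
  · rw [← degree_digitPoly_lt, hx, ← hp, ← degree_eq_natDegree hp0]
    exact EuclideanDomain.mod_lt g hp0
  · rw [hx, AdjoinRoot.mk_eq_mk]
    have := EuclideanDomain.mod_add_div g p
    exact ⟨-(g / p), by rw [mul_neg, eq_neg_iff_add_eq_zero]; linear_combination this⟩

theorem mk_digitPoly_eq_zero (hp : p.natDegree = m) (hpos : 0 < b ^ m) {x : ℕ} (hx : x < b ^ m) :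
    AdjoinRoot.mk p (digitPoly b x) = 0 ↔ x = 0 := by
  constructor
  · intro h
    exact mk_digitPoly_injOn hp hx hpos (by simpa using h)
  · rintro rfl; simp

theorem card_adjoinRoot (hm : 1 ≤ m) (hp : p.natDegree = m) : Nat.card (AdjoinRoot p) = b ^ m := by
  have : Function.Bijective (fun x : Fin (b ^ m) => AdjoinRoot.mk p (digitPoly b x)) := by
    refine ⟨fun x y h => Fin.ext (mk_digitPoly_injOn hp x.2 y.2 h), fun κ => ?_⟩
    obtain ⟨x, hx, h⟩ := exists_code_mk hm hp κ
    exact ⟨⟨x, hx⟩, h⟩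
  rw [← Nat.card_eq_of_bijective _ this, Nat.card_fin]

theorem pow_card_sub_one (hm : 1 ≤ m) (hp : p.natDegree = m) [Fact (Irreducible p)]
    {κ : AdjoinRoot p} (hκ : κ ≠ 0) : κ ^ (b ^ m - 1) = 1 := by
  have hc := card_adjoinRoot hm hp
  have : Finite (AdjoinRoot p) := Nat.finite_of_card_ne_zero (by
    rw [hc]; exact (pow_pos hb.out.pos m).ne')
  have := Fintype.ofFinite (AdjoinRoot p)
  rw [← hc, Nat.card_eq_fintype_card]
  exact FiniteField.pow_card_sub_one_eq_one κ hκ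

end

/-- A minimal divisor of `n'` that does not divide `n` is coprime to `n / gcd n c`. -/
theorem coprime_of_minimal_dvd {n n' c : ℕ} (hn : n ≠ 0) (hc : c ∣ n') (hcn : ¬ c ∣ n)
    (hmin : ∀ t, 1 ≤ t → t ∣ n' → ¬ t ∣ n → c ≤ t) : Nat.Coprime (n / Nat.gcd n c) c := by
  rw [Nat.coprime_iff_gcd_eq_one]
  by_contra hne
  -- Let the prime `l` divide both numbers and put `c = l c'`. Minimality gives `c' ∣ n`, so `gcd n
  -- c` is `c'` or `l c'`. In the first case `l ∣ n / c'`, in the second `c` divides `n` directly;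
  -- both contradict `¬ c ∣ n`.
  obtain ⟨l, hl, hdvd⟩ := Nat.exists_prime_and_dvd hne
  obtain ⟨h1, h2⟩ := Nat.dvd_gcd_iff.1 hdvd
  obtain ⟨c', rfl⟩ := h2
  have hc0 : c' ≠ 0 := by rintro rfl; exact hcn (by
    have := hmin; rcases Nat.eq_zero_or_pos n' with h | h
    · subst h
      have := hmin (n + 1) (by omega) (dvd_zero _)
        (fun hd => by have := Nat.le_of_dvd (by omega) hd; omega)
      have h3 := Nat.gcd_zero_right n
      rw [mul_zero, h3, Nat.div_self (by omega)] at h1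
      exact absurd (Nat.dvd_one.1 h1) hl.ne_one
    · rw [mul_zero, zero_dvd_iff] at hc; omega)
  have hlt : c' < l * c' := by have := hl.two_le; nlinarith [Nat.pos_of_ne_zero hc0]
  have hc'n : c' ∣ n := by
    by_contra hcon
    have := hmin c' (by omega) ((Dvd.intro_left l rfl).trans hc) hcon
    omega
  have hg : c' ∣ Nat.gcd n (l * c') := Nat.dvd_gcd hc'n (Dvd.intro_left l rfl)
  obtain ⟨u, hu⟩ := hg
  have hul : u ∣ l := by
    have := Nat.gcd_dvd_right n (l * c')
    rw [hu, mul_comm l] at this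
    exact Nat.dvd_of_mul_dvd_mul_left (Nat.pos_of_ne_zero hc0) this
  rcases (Nat.dvd_prime hl).1 hul with rfl | rfl
  · rw [hu, mul_one] at h1
    apply hcn
    rw [mul_comm]
    exact (Nat.dvd_div_iff_mul_dvd hc'n).1 h1
  · apply hcn
    rw [mul_comm u, ← hu]
    exact Nat.gcd_dvd_left _ _

/-- The two factors have the orders `n / gcd n c` and `c`. These are coprime by the minimality of
`c`, so the orders multiply to `lcm n c`. No factorization of integers is needed to build this
element. -/
theorem orderOf_mul_pow {F : Type*} [CommMonoid F] {ζ g : F} {n n' c : ℕ} (hζ : orderOf ζ = n)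
    (hg : orderOf g = n') (hn : n ≠ 0) (hn' : n' ≠ 0) (hc : c ∣ n') (hcn : ¬ c ∣ n)
    (hmin : ∀ t, 1 ≤ t → t ∣ n' → ¬ t ∣ n → c ≤ t) :
    orderOf (ζ ^ Nat.gcd n c * g ^ (n' / c)) = Nat.lcm n c := by
  have hc0 : c ≠ 0 := by rintro rfl; exact hn' (zero_dvd_iff.1 hc)
  have hgc : Nat.gcd n c ≠ 0 := Nat.gcd_ne_zero_left hn
  have h1 : orderOf (ζ ^ Nat.gcd n c) = n / Nat.gcd n c := by
    rw [orderOf_pow_of_dvd hgc (by rw [hζ]; exact Nat.gcd_dvd_left _ _), hζ]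
  have h2 : orderOf (g ^ (n' / c)) = c := by
    rw [orderOf_pow_of_dvd (by
      rw [Nat.div_ne_zero_iff]; exact ⟨hc0, Nat.le_of_dvd (by omega) hc⟩)
      (by rw [hg]; exact Nat.div_dvd_of_dvd hc), hg, Nat.div_div_self hc hn']
  rw [(Commute.all _ _).orderOf_mul_eq_mul_orderOf_of_coprime (by
    rw [h1, h2]; exact coprime_of_minimal_dvd hn hc hcn hmin), h1, h2, Nat.lcm,
    Nat.div_mul_right_comm (Nat.gcd_dvd_left _ _)]

end PolyLattice

/-! ### Reduction and the search for a generator as programs. -/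

namespace RealRAM

open Polynomial PolyLattice

/-- Prepares the reduction modulo the polynomial in register `3`. -/
def initRed : Cmd :=
  .seq (.iset 30 (.div (.reg 3) (.reg 4)))
    (.seq (searchMin 13 0 28 29 (.ieq (.mod (.mul (.reg 28) (.reg 30)) (.reg 0))
      (.sub (.reg 0) (.lit 1))))
    (.seq (.iset 20 (.mod (.reg 3) (.reg 4)))
    (.seq (scalTable 2 20) (.seq (.iset 20 (.get 2 (.reg 29))) (scalTable 3 20)))))

/-- The powers of `ζ` are stamped with its order. Orders increase from round to round, so old stamps
are smaller and never have to be erased. -/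
def growStamp : Cmd := .for 13 31 (.iput 8 (.get 6 (.reg 13)) (.reg 31))

/-- The first code without a current stamp is a new element; its order is the first exponent at
which its table of powers shows the code `1`. -/
def growOrder : Cmd :=
  .seq (searchMin 13 5 28 20 (.not (.ieq (.get 8 (.reg 28)) (.reg 31))))
    (.seq (.iset 21 (.reg 4)) (.seq mulTable (.seq (powTable 7)
      (searchMin 13 5 28 32 (.ieq (.get 7 (.reg 28)) (.lit 1))))))

/-- A linear search stays within `O(N)` and spares a Euclidean algorithm; `growElement` recovers
`gcd n c` as `n * c / lcm n c`. -/
def growExponents : Cmd :=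
  .seq (searchMin 13 5 28 33 (.and (.ieq (.mod (.reg 32) (.reg 28)) (.lit 0))
      (.not (.ieq (.mod (.reg 31) (.reg 28)) (.lit 0)))))
    (searchMin 13 5 28 34 (.and (.ieq (.mod (.reg 28) (.reg 31)) (.lit 0))
      (.ieq (.mod (.reg 28) (.reg 33)) (.lit 0))))

def growElement : Cmd :=
  .seq (.seq (.iset 20 (.get 6 (.div (.mul (.reg 31) (.reg 33)) (.reg 34)))) (.iset 21 (.reg 4)))
    (.seq mulTable (.seq (.iset 20 (.get 4 (.get 7 (.div (.reg 32) (.reg 33)))))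
      (.seq mulTable (.seq (powTable 6) (.iset 31 (.reg 34))))))

/-- One step of the search for a generator: the element of order `n` (in register `31`) whose
powers are in array `6` is replaced by an element of larger order. -/
def grow : Cmd := .seq growStamp (.seq growOrder (.seq growExponents growElement))

/-- Computes the powers of a generator of the multiplicative group. -/
def findGenerator : Cmd :=
  .seq (.seq (.iset 20 (.lit 1)) (.iset 21 (.reg 4))) (.seq mulTable (.seq (powTable 6)
    (.seq (.iset 31 (.lit 1)) (.for 14 9 (.ite (.ilt (.reg 31) (.reg 5)) grow .skip)))))

section
variable {W V b m d K : ℕ} [hb : Fact b.Prime] {σ : Store}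

/-- The modulus need not be monic: `p = low + u X ^ m` with a digit `u ≠ 0`. If `c u = -1` in `𝔽_b`,
then `c p = c low - X ^ m`, so `X ^ m` reduces to `c low`. -/
theorem initRed_spec (hM : Machine W V) (hD : Dims b m d V) (hσ : Bdd V σ) (hB : Base b m d K σ)
    (hdeg : (digitPoly b (σ.ireg 3)).natDegree = m) :
    Run W V initRed σ (b ^ m * 300) (RedTab (AdjoinRoot.mk (digitPoly b (σ.ireg 3))) m) := by
  have hN := hD.N_le
  have hbN := hD.b_le
  have hbp := hb.out.pos
  have hb2 := hb.out.two_le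
  have hlt := lt_pow_of_natDegree hdeg
  have hge := pow_le_of_natDegree hD.1 hdeg
  set e := σ.ireg 3 with he
  have hNpos : 0 < b ^ m := pow_pos hbp m
  have hlead : e / b ^ m < b := by
    rw [Nat.div_lt_iff_lt_mul hNpos, ← pow_succ']; exact hlt
  have hlead1 : 1 ≤ e / b ^ m := by rw [Nat.one_le_div_iff hNpos]; exact hge
  refine Run.mono (T := 4 + ((b * (9 + 20) + 5) + (4 + ((b * 100) + (3 + (b * 100)))))) ?_ (by omega)
    fun _ _ _ h => h
  refine Run.seq (Q := fun τ => τ = σ.setIreg 30 (e / b ^ m))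
    (Run.of_wp hM hσ rfl (by decide) ?_) ?_
  · simp [WP, IExpr.Safe, IExpr.eval, hB.r4, ← he, hbp.ne']
    omega
  rintro σ1 hσ1 - rfl
  have hB1 : Base b m d K (σ.setIreg 30 (e / b ^ m)) := hB.setIreg _ rfl
  refine Run.seq (Run.mono (searchMin_spec hM hσ1 (fun t => t * (e / b ^ m) % b = b - 1)
    rfl rfl ?_ ?_) (by rw [hB1.r0]; exact le_rfl) fun _ _ _ h => h) ?_
  · intro τ hF _ _
    simp [BExpr.Safe, BExpr.Holds, IExpr.Safe, IExpr.eval, hF.ireg 0 rfl, hB.r0,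
      hF.ireg 30 rfl, hbp.ne']
  · have hu : ((e / b ^ m : ℕ) : ZMod b) ≠ 0 := by
      intro h0
      rw [ZMod.natCast_eq_zero_iff] at h0
      have := Nat.le_of_dvd (by omega) h0
      omega
    have hval : (((-(((e / b ^ m : ℕ) : ZMod b))⁻¹ : ZMod b).val : ℕ) : ZMod b) *
        ((e / b ^ m : ℕ) : ZMod b) = ((b - 1 : ℕ) : ZMod b) := by
      rw [ZMod.natCast_zmod_val, Nat.cast_sub hbp]
      simp [inv_mul_cancel₀ hu]
    refine ⟨(-((e / b ^ m : ℕ) : ZMod b)⁻¹).val, ?_, ?_, ?_⟩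
    · rw [Nat.one_le_iff_ne_zero, ne_eq, ZMod.val_eq_zero]
      simpa using hu
    · rw [hB1.r0]; exact (ZMod.val_lt _).le
    · rw [← Nat.cast_mul, ZMod.natCast_eq_natCast_iff'] at hval
      rw [hval, Nat.mod_eq_of_lt (by omega)]
  rintro σ2 hσ2 hF2 ⟨g1, g2, g3, -⟩
  rw [hB1.r0] at g2
  have hB2 := hB1.frame hF2 rfl
  have e3 : σ2.ireg 3 = e := (hF2.ireg 3 rfl).trans rfl
  have hml : e % b ^ m < b ^ m := Nat.mod_lt _ hNpos
  refine Run.seq (Q := fun τ => τ = σ2.setIreg 20 (e % b ^ m))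
    (Run.of_wp hM hσ2 rfl (by decide) ?_) ?_
  · simp [WP, IExpr.Safe, IExpr.eval, hB2.r4, e3, hbp.ne']
    omega
  rintro σ3 hσ3 - rfl
  have hB3 : Base b m d K (σ2.setIreg 20 (e % b ^ m)) := hB2.setIreg _ rfl
  refine Run.seq (scalTable_spec hM hD hσ3 hB3 rfl rfl (by simpa using hml)) ?_
  intro σ4 hσ4 hF4 hS
  have hB4 := hB3.frame hF4 rfl
  obtain ⟨s1, s2⟩ := hS _ g2
  have e29 : σ4.ireg 29 = σ2.ireg 29 := (hF4.ireg 29 rfl).trans rfl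
  set c := σ2.ireg 29
  refine Run.seq (Q := fun τ => τ = σ4.setIreg 20 (σ4.iarr 2 c))
    (Run.of_wp hM hσ4 rfl (by decide) ?_) ?_
  · simp [WP, IExpr.Safe, IExpr.eval, e29]
    omega
  rintro σ5 hσ5 - rfl
  refine Run.mono (scalTable_spec (u := 20) hM hD hσ5 (hB4.setIreg _ rfl) rfl rfl (by simpa using s1)) le_rfl ?_
  intro τ _ _ hR t ht
  obtain ⟨r1, r2⟩ := hR t ht.le
  refine ⟨r1, ?_⟩
  simp only [setIreg_ireg, if_true] at r2 s2
  rw [r2, s2, map_mul, map_mul _ (C (t : ZMod b)) (X ^ m)]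
  congr 1
  rw [AdjoinRoot.mk_eq_mk]
  have hp : digitPoly b e = digitPoly b (e % b ^ m) + X ^ m * C ((e / b ^ m : ℕ) : ZMod b) := by
    rw [← digitPoly_of_lt hlead, ← digitPoly_mod_add]
  have hinv : (C ((c : ℕ) : ZMod b)) * C ((e / b ^ m : ℕ) : ZMod b) = -1 := by
    rw [← C_mul, ← Nat.cast_mul]
    have : ((c * (e / b ^ m) : ℕ) : ZMod b) = ((b - 1 : ℕ) : ZMod b) := by
      rw [ZMod.natCast_eq_natCast_iff', g3, Nat.mod_eq_of_lt (by omega)]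
    rw [this, Nat.cast_sub hbp]
    simp
  refine ⟨C ((c : ℕ) : ZMod b), ?_⟩
  rw [hp]
  linear_combination (-X ^ m) * hinv

end

end RealRAM

namespace RealRAM

open Polynomial PolyLattice

section
variable {W V b m d K : ℕ} [hb : Fact b.Prime] {σ : Store}

theorem searchMin_time {n N c : ℕ} (hn : n < N) (hc : c ≤ 30) : n * (c + 20) + 5 ≤ N * 50 := by
  have : n * (c + 20) ≤ n * 50 := Nat.mul_le_mul_left _ (by omega)
  omega

/-- Register `31` contains the order `n` of `ζ`, whose powers are in array `6`. -/
structure GenState {p : (ZMod b)[X]} (m : ℕ) (ζ : AdjoinRoot p) (n : ℕ) (σ : Store) : Prop where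
  r31 : σ.ireg 31 = n
  order : orderOf ζ = n
  pos : 1 ≤ n
  pow : PowTab (AdjoinRoot.mk p) m ζ 6 σ
  marks : ∀ y, σ.iarr 8 y < n

variable {p : (ZMod b)[X]} {ζ : AdjoinRoot p} {n : ℕ}

theorem GenState.lt [Fact (Irreducible p)] (hm : 1 ≤ m) (hp : p.natDegree = m)
    (h : GenState m ζ n σ) : n ∣ b ^ m - 1 ∧ n ≤ b ^ m - 1 := by
  have hζ : ζ ≠ 0 := by
    rintro rfl
    have h1 := pow_orderOf_eq_one (0 : AdjoinRoot p)
    rw [h.order, zero_pow (by have := h.pos; omega)] at h1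
    exact zero_ne_one h1
  have h1 : n ∣ b ^ m - 1 := h.order ▸ orderOf_dvd_of_pow_eq_one (pow_card_sub_one hm hp hζ)
  have h2 : 2 ≤ b ^ m := hb.out.two_le.trans (Nat.le_self_pow (by omega) b)
  exact ⟨h1, Nat.le_of_dvd (by omega) h1⟩

theorem growStamp_spec (hM : Machine W V) (hσ : Bdd V σ)
    (h : GenState m ζ n σ) :
    Run W V growStamp σ (n * 12 + 5) (fun τ => (∀ y, τ.iarr 8 y ≤ n) ∧
      ∀ y, τ.iarr 8 y = n ↔ ∃ i < n, σ.iarr 6 i = y) := by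
  have hloop := Run.for (W := W) (V := V) (σ := σ) (x := 13) (r := 31)
    (c := .iput 8 (.get 6 (.reg 13)) (.reg 31)) (T := 5)
    (fun i τ => (∀ y, τ.iarr 8 y ≤ n) ∧ ∀ y, τ.iarr 8 y = n ↔ ∃ j < i, σ.iarr 6 j = y) hM hσ
    rfl rfl rfl (fun _ _ _ h => h)
    ⟨fun y => (h.marks y).le, fun y => by simpa using (h.marks y).ne⟩ (by
      rintro i hi τ hτ hF hx ⟨hI1, hI2⟩
      have e31 : τ.ireg 31 = n := (hF.ireg 31 rfl).trans h.r31
      refine Run.of_wp hM hτ rfl (by decide) ?_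
      simp only [WP, IExpr.Safe, IExpr.eval, hx, e31, true_and, hF.iarr 6 rfl]
      refine ⟨by have := hσ.ireg 31; rw [h.r31] at this; exact this, ?_, ?_⟩
      · intro y
        have := hI1 y
        simp only [setIarr_iarr, if_true]; split_ifs <;> simp_all
      · intro y
        simp only [setIarr_iarr, if_true]
        split_ifs with hy
        · simp only [true_iff]; exact ⟨i, by omega, hy.symm⟩
        · rw [hI2]
          constructor
          · rintro ⟨j, hj, hj'⟩; exact ⟨j, by omega, hj'⟩
          · rintro ⟨j, hj, hj'⟩
            refine ⟨j, ?_, hj'⟩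
            by_contra hcon
            have : j = i := by omega
            subst this; exact hy hj'.symm)
  rw [h.r31] at hloop
  exact hloop

/-- After `growOrder`, register `32` contains the order of an element `g` that is not a power
of `ζ`, and array `7` contains the powers of `g`. -/
theorem growOrder_spec [Fact (Irreducible p)] (hM : Machine W V) (hD : Dims b m d V)
    (hσ : Bdd V σ) (hB : Base b m d K σ) (hp : p.natDegree = m)
    (hR : RedTab (AdjoinRoot.mk p) m σ) (h31 : σ.ireg 31 = n) (hord : orderOf ζ = n)
    (hn : 1 ≤ n) (hlt : n < b ^ m - 1) (hpow : PowTab (AdjoinRoot.mk p) m ζ 6 σ)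
    (hmark : ∀ y, σ.iarr 8 y = n ↔ ∃ i < n, σ.iarr 6 i = y) :
    Run W V growOrder σ (b ^ m * 400) (fun τ => ∃ g : AdjoinRoot p, orderOf g = τ.ireg 32 ∧
      1 ≤ τ.ireg 32 ∧ τ.ireg 32 ∣ b ^ m - 1 ∧ ¬ τ.ireg 32 ∣ n ∧ PowTab (AdjoinRoot.mk p) m g 7 τ) := by
  have hN := hD.N_le
  have hbN := hD.b_le
  have h2 := hD.two_le
  refine Run.mono (T := b ^ m * 50 + (2 + ((b * 100 + b ^ m * 150 + 10) + (b ^ m * 25 + b ^ m * 50))))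
    ?_ (by omega) fun _ _ _ h => h
  refine Run.seq (Run.mono (searchMin_spec hM hσ (fun t => σ.iarr 8 t ≠ n) rfl rfl ?_ ?_)
    (by rw [hB.r5]; exact searchMin_time (by omega) (by decide)) fun _ _ _ h => h) ?_
  · intro τ hF _ _
    simp [BExpr.Safe, BExpr.Holds, IExpr.Safe, IExpr.eval, hF.iarr 8 rfl, hF.ireg 31 rfl, h31]
  · by_contra hcon
    push Not at hcon
    -- Pigeonhole: the `n < N - 1` powers of `ζ` cannot exhaust the `N - 1` nonzero codes.
    have hsub : Finset.Icc 1 (b ^ m - 1) ⊆ (Finset.range n).image (σ.iarr 6) := by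
      intro y hy
      rw [Finset.mem_Icc] at hy
      obtain ⟨i, hi, hi'⟩ := (hmark y).1 (hcon y hy.1 (by rw [hB.r5]; exact hy.2))
      exact Finset.mem_image.2 ⟨i, Finset.mem_range.2 hi, hi'⟩
    have h1 := Finset.card_le_card hsub
    have h3 := Finset.card_image_le (s := Finset.range n) (f := σ.iarr 6)
    simp only [Nat.card_Icc, Finset.card_range] at h1 h3
    omega
  rintro σ1 hσ1 hF1 ⟨g1, g2, g3, -⟩
  have hB1 := hB.frame hF1 rfl
  rw [hB.r5] at g2
  set y := σ1.ireg 20 with hy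
  set g := AdjoinRoot.mk p (digitPoly b y) with hg
  have hg0 : g ≠ 0 := by
    rw [hg, ne_eq, mk_digitPoly_eq_zero hp (by omega) (by omega)]; omega
  have hgpow := pow_card_sub_one hD.1 hp hg0
  -- In a field all solutions of `x ^ n = 1` are powers of the element `ζ` of order `n`, whereas `g`
  -- carries no stamp.
  have hgn : ¬ orderOf g ∣ n := by
    intro hdvd
    have hprim : IsPrimitiveRoot ζ n := hord ▸ IsPrimitiveRoot.orderOf ζ
    have : NeZero n := ⟨by omega⟩
    obtain ⟨i, hi, hi'⟩ := hprim.eq_pow_of_pow_eq_one (orderOf_dvd_iff_pow_eq_one.1 hdvd)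
    obtain ⟨e1, e2⟩ := hpow i (by omega)
    rw [hi'] at e2
    exact g3 ((hmark y).2 ⟨i, hi, mk_digitPoly_injOn hp e1 (by omega) e2⟩)
  refine Run.seq (Q := fun τ => τ = σ1.setIreg 21 (b ^ m))
    (Run.of_wp hM hσ1 rfl le_rfl ?_) ?_
  · simp [WP, IExpr.Safe, IExpr.eval, hB1.r4]
    omega
  rintro σ2 hσ2 - rfl
  have hB2 : Base b m d K (σ1.setIreg 21 (b ^ m)) := hB1.setIreg _ rfl
  have hR2 : RedTab (AdjoinRoot.mk p) m (σ1.setIreg 21 (b ^ m)) := by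
    unfold RedTab; rw [setIreg_iarr, hF1.iarr 3 rfl]; exact hR
  refine Run.seq (Run.mono (mulTable_spec (AdjoinRoot.mk p) hM hD hσ2 hB2 hR2
    (by simp [← hy]; omega)) (by simp) fun _ _ _ h => h) ?_
  intro σ3 hσ3 hF3 hMT
  have hB3 := hB2.frame hF3 rfl
  simp [← hy, ← hg] at hMT
  refine Run.seq (powTable_spec _ hM hD hσ3 hB3 hMT rfl) ?_
  intro σ4 hσ4 hF4 hPT
  have hB4 := hB3.frame hF4 rfl
  have hiff : ∀ t, t ≤ b ^ m → (σ4.iarr 7 t = 1 ↔ g ^ t = 1) := by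
    intro t ht
    obtain ⟨e1, e2⟩ := hPT t ht
    rw [← e2]
    constructor
    · intro h; rw [h]; simp
    · intro h; exact mk_digitPoly_injOn hp e1 (by omega) (by rw [h]; simp)
  refine Run.mono (searchMin_spec hM hσ4 (fun t => σ4.iarr 7 t = 1) rfl rfl ?_ ?_)
    (by rw [hB4.r5]; exact searchMin_time (by omega) (by decide)) ?_
  · intro τ hF _ _
    simp [BExpr.Safe, BExpr.Holds, IExpr.Safe, IExpr.eval, hF.iarr 7 rfl]
  · exact ⟨b ^ m - 1, by omega, by rw [hB4.r5], (hiff _ (by omega)).2 hgpow⟩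
  rintro σ5 hσ5 hF5 ⟨k1, k2, k3, k4⟩
  rw [hB4.r5] at k2
  have hord' : orderOf g = σ5.ireg 32 := by
    apply le_antisymm
    · exact orderOf_le_of_pow_eq_one (by omega) ((hiff _ (by omega)).1 k3)
    · have hle := orderOf_le_of_pow_eq_one (by omega) hgpow
      exact k4 _ (orderOf_pos_iff.2 (isOfFinOrder_iff_pow_eq_one.2 ⟨_, by omega, hgpow⟩))
        ((hiff _ (by omega)).2 (pow_orderOf_eq_one g))
  refine ⟨g, hord', k1, ?_, ?_, ?_⟩
  · rw [← hord']; exact orderOf_dvd_of_pow_eq_one hgpow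
  · rw [← hord']; exact hgn
  · unfold PowTab; rw [hF5.iarr 7 rfl]; exact hPT

omit hb in
theorem growExponents_spec {n' : ℕ} (hM : Machine W V)
    (hσ : Bdd V σ) (hB : Base b m d K σ) (h2 : 2 ≤ b ^ m) (h31 : σ.ireg 31 = n)
    (h32 : σ.ireg 32 = n') (hn : 1 ≤ n) (hn' : 1 ≤ n') (hnd : n ∣ b ^ m - 1)
    (hnd' : n' ∣ b ^ m - 1) (hnn : ¬ n' ∣ n) :
    Run W V growExponents σ (b ^ m * 100) (fun τ => τ.ireg 33 ∣ n' ∧ ¬ τ.ireg 33 ∣ n ∧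
      (∀ t, 1 ≤ t → t ∣ n' → ¬ t ∣ n → τ.ireg 33 ≤ t) ∧ τ.ireg 34 = Nat.lcm n (τ.ireg 33)) := by
  have hN1 : 0 < b ^ m - 1 := by omega
  refine Run.mono (T := b ^ m * 50 + b ^ m * 50) ?_ (by omega) fun _ _ _ h => h
  refine Run.seq (Run.mono (searchMin_spec hM hσ (fun t => t ∣ n' ∧ ¬ t ∣ n) rfl rfl ?_ ?_)
    (by rw [hB.r5]; exact searchMin_time (by omega) (by decide)) fun _ _ _ h => h) ?_
  · intro τ hF h1 _
    simp only [BExpr.Safe, BExpr.Holds, IExpr.Safe, IExpr.eval, hF.ireg 31 rfl, hF.ireg 32 rfl,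
      h31, h32, Nat.dvd_iff_mod_eq_zero]
    refine ⟨?_, trivial⟩
    simp; omega
  · exact ⟨n', hn', by rw [hB.r5]; exact Nat.le_of_dvd hN1 hnd', dvd_rfl, hnn⟩
  rintro σ1 hσ1 hF1 ⟨g1, g2, ⟨g3, g4⟩, g5⟩
  have hB1 := hB.frame hF1 rfl
  set c := σ1.ireg 33 with hc
  have e31 : σ1.ireg 31 = n := (hF1.ireg 31 rfl).trans h31
  refine Run.mono (searchMin_spec hM hσ1 (fun t => n ∣ t ∧ c ∣ t) rfl rfl ?_ ?_)
    (by rw [hB1.r5]; exact searchMin_time (by omega) (by decide)) ?_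
  · intro τ hF h1 _
    simp only [BExpr.Safe, BExpr.Holds, IExpr.Safe, IExpr.eval, hF.ireg 31 rfl, hF.ireg 33 rfl,
      e31, ← hc, Nat.dvd_iff_mod_eq_zero]
    refine ⟨?_, trivial⟩
    simp; omega
  · exact ⟨b ^ m - 1, hN1, by rw [hB1.r5], hnd, g3.trans hnd'⟩
  rintro σ2 hσ2 hF2 ⟨k1, k2, ⟨k3, k4⟩, k5⟩
  have e33 : σ2.ireg 33 = c := hF2.ireg 33 rfl
  rw [e33]
  refine ⟨g3, g4, fun t h1 h2 h3 => g5 t h1 ⟨h2, h3⟩, le_antisymm ?_ ?_⟩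
  · exact k5 _ (Nat.lcm_pos (by omega) (by omega)) ⟨Nat.dvd_lcm_left _ _, Nat.dvd_lcm_right _ _⟩
  · exact Nat.le_of_dvd k1 (Nat.lcm_dvd k3 k4)

theorem growElement_spec (hM : Machine W V) (hD : Dims b m d V) (hσ : Bdd V σ)
    (hB : Base b m d K σ) (hR : RedTab (AdjoinRoot.mk p) m σ) {g : AdjoinRoot p} {n' c l : ℕ}
    (h31 : σ.ireg 31 = n) (h32 : σ.ireg 32 = n') (h33 : σ.ireg 33 = c) (h34 : σ.ireg 34 = l)
    (hl : l = Nat.lcm n c) (hlV : l ≤ b ^ m) (hn : 1 ≤ n) (hc : 1 ≤ c) (hnN : n ≤ b ^ m)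
    (hn'N : n' ≤ b ^ m)
    (hζ : PowTab (AdjoinRoot.mk p) m ζ 6 σ) (hg : PowTab (AdjoinRoot.mk p) m g 7 σ) :
    Run W V growElement σ (b ^ m * 600) (fun τ => τ.ireg 31 = l ∧
      PowTab (AdjoinRoot.mk p) m (ζ ^ Nat.gcd n c * g ^ (n' / c)) 6 τ) := by
  have hN := hD.N_le
  have hbN := hD.b_le
  have h2 := hD.two_le
  have hl0 : l ≠ 0 := by rw [hl]; exact (Nat.lcm_pos (by omega) (by omega)).ne'
  have hgcd : n * c / l = Nat.gcd n c := by
    rw [hl, Nat.div_eq_of_eq_mul_left (Nat.lcm_pos (by omega) (by omega)) (Nat.gcd_mul_lcm n c).symm]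
  refine Run.mono (T := 10 + ((b * 100 + b ^ m * 150 + 10) + (10 + ((b * 100 + b ^ m * 150 + 10) +
    (b ^ m * 25 + 2))))) ?_ (by omega) fun _ _ _ h => h
  obtain ⟨z1, z2⟩ := hζ (Nat.gcd n c) ((Nat.gcd_le_left _ hn).trans hnN)
  refine Run.seq (Q := fun τ => τ = (σ.setIreg 20 (σ.iarr 6 (Nat.gcd n c))).setIreg 21 (b ^ m))
    (Run.of_wp hM hσ rfl (by decide) ?_) ?_
  · simp [WP, IExpr.Safe, IExpr.eval, hB.r4, h31, h33, h34, hgcd, hl0]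
    omega
  rintro σ1 hσ1 hF1 rfl
  have hB1 := hB.frame hF1 rfl
  refine Run.seq (Run.mono (mulTable_spec (AdjoinRoot.mk p) hM hD hσ1 hB1 hR
    (by simpa using z1)) (by simp) fun _ _ _ h => h) ?_
  intro σ2 hσ2 hF2 hMT
  have hB2 := hB1.frame hF2 rfl
  simp [z2] at hMT
  have e7 : σ2.iarr 7 = σ.iarr 7 := (hF2.iarr 7 rfl).trans rfl
  obtain ⟨w1, w2⟩ := hg (n' / c) ((Nat.div_le_self _ _).trans hn'N)
  obtain ⟨y1, y2⟩ := hMT _ w1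
  rw [w2] at y2
  have e32 : σ2.ireg 32 = n' := (hF2.ireg 32 rfl).trans (by simp [h32])
  have e33 : σ2.ireg 33 = c := (hF2.ireg 33 rfl).trans (by simp [h33])
  have e34 : σ2.ireg 34 = l := (hF2.ireg 34 rfl).trans (by simp [h34])
  have e21 : σ2.ireg 21 = b ^ m := (hF2.ireg 21 rfl).trans (by simp)
  have hR2 : RedTab (AdjoinRoot.mk p) m σ2 := by
    unfold RedTab; rw [hF2.iarr 3 rfl]; exact hR
  refine Run.seq (Q := fun τ => τ = σ2.setIreg 20 (σ2.iarr 4 (σ.iarr 7 (n' / c))))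
    (Run.of_wp hM hσ2 rfl (by decide) ?_) ?_
  · simp [WP, IExpr.Safe, IExpr.eval, e32, e33, e7]
    omega
  rintro σ3 hσ3 hF3 rfl
  have hB3 := hB2.frame hF3 rfl
  refine Run.seq (Run.mono (mulTable_spec (AdjoinRoot.mk p) hM hD hσ3 hB3 hR2
    (by simpa using y1)) (by simp [e21]) fun _ _ _ h => h) ?_
  intro σ4 hσ4 hF4 hMT'
  have hB4 := hB3.frame hF4 rfl
  simp [y2, e21] at hMT'
  refine Run.seq (powTable_spec _ hM hD hσ4 hB4 hMT' rfl) ?_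
  intro σ5 hσ5 hF5 hPT
  have e34' : σ5.ireg 34 = l := by rw [hF5.ireg 34 rfl, hF4.ireg 34 rfl]; simp [e34]
  refine Run.of_wp hM hσ5 rfl le_rfl ?_
  simp only [WP, IExpr.Safe, IExpr.eval, e34', true_and]
  exact ⟨by omega, by simp, hPT⟩

theorem grow_spec [Fact (Irreducible p)] (hM : Machine W V) (hD : Dims b m d V)
    (hσ : Bdd V σ) (hB : Base b m d K σ) (hp : p.natDegree = m)
    (hR : RedTab (AdjoinRoot.mk p) m σ) (h : GenState m ζ n σ) (hlt : n < b ^ m - 1) :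
    Run W V grow σ (b ^ m * 1200) (fun τ => ∃ (ζ' : AdjoinRoot p) (n' : ℕ), GenState m ζ' n' τ ∧
      2 * n ≤ n') := by
  have hN := hD.N_le
  have h2 := hD.two_le
  have hnpos := h.pos
  obtain ⟨hnd, hnle⟩ := h.lt hD.1 hp
  refine Run.mono (T := (n * 12 + 5) + (b ^ m * 400 + (b ^ m * 100 + b ^ m * 600))) ?_ (by omega)
    fun _ _ _ h => h
  refine Run.seq (growStamp_spec hM hσ h) ?_
  rintro σ1 hσ1 hF1 ⟨hm1, hm2⟩
  have hB1 := hB.frame hF1 rfl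
  have hR1 : RedTab (AdjoinRoot.mk p) m σ1 := by
    unfold RedTab; rw [hF1.iarr 3 rfl]; exact hR
  have hP1 : PowTab (AdjoinRoot.mk p) m ζ 6 σ1 := by
    unfold PowTab; rw [hF1.iarr 6 rfl]; exact h.pow
  have e31 : σ1.ireg 31 = n := (hF1.ireg 31 rfl).trans h.r31
  refine Run.seq (growOrder_spec hM hD hσ1 hB1 hp hR1 e31 h.order hnpos hlt hP1
    (by rw [hF1.iarr 6 rfl]; exact hm2)) ?_
  rintro σ2 hσ2 hF2 ⟨g, g1, g2, g3, g4, g5⟩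
  have hB2 := hB1.frame hF2 rfl
  have hR2 : RedTab (AdjoinRoot.mk p) m σ2 := by
    unfold RedTab; rw [hF2.iarr 3 rfl]; exact hR1
  have hP2 : PowTab (AdjoinRoot.mk p) m ζ 6 σ2 := by
    unfold PowTab; rw [hF2.iarr 6 rfl]; exact hP1
  have e31' : σ2.ireg 31 = n := (hF2.ireg 31 rfl).trans e31
  set n' := σ2.ireg 32 with hn'
  refine Run.seq (growExponents_spec hM hσ2 hB2 h2 e31' hn'.symm hnpos g2 hnd g3 g4) ?_
  rintro σ3 hσ3 hF3 ⟨k1, k2, k3, k4⟩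
  have hB3 := hB2.frame hF3 rfl
  have hR3 : RedTab (AdjoinRoot.mk p) m σ3 := by
    unfold RedTab; rw [hF3.iarr 3 rfl]; exact hR2
  have hP3 : PowTab (AdjoinRoot.mk p) m ζ 6 σ3 := by
    unfold PowTab; rw [hF3.iarr 6 rfl]; exact hP2
  have hg3 : PowTab (AdjoinRoot.mk p) m g 7 σ3 := by
    unfold PowTab; rw [hF3.iarr 7 rfl]; exact g5
  have e31'' : σ3.ireg 31 = n := (hF3.ireg 31 rfl).trans e31'
  have e32 : σ3.ireg 32 = n' := hF3.ireg 32 rfl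
  set c := σ3.ireg 33 with hc
  have hc1 : 1 ≤ c := Nat.pos_of_dvd_of_pos k1 g2
  have hlcm : Nat.lcm n c ∣ b ^ m - 1 := Nat.lcm_dvd hnd (k1.trans g3)
  have hlle := Nat.le_of_dvd (by omega) hlcm
  have hn'le := Nat.le_of_dvd (by omega) g3
  refine Run.mono (growElement_spec (ζ := ζ) (g := g) hM hD hσ3 hB3 hR3 e31'' e32 hc.symm k4 rfl (by omega)
    hnpos hc1 (by omega) (by omega) hP3 hg3) le_rfl ?_
  rintro σ4 hσ4 hF4 ⟨f1, f2⟩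
  -- The lcm is a multiple of `n`, and it differs from `n` because `c` does not divide `n`.
  have h2n : 2 * n ≤ Nat.lcm n c := by
    obtain ⟨u, hu⟩ := Nat.dvd_lcm_left n c
    rcases u with _ | _ | u
    · have := Nat.lcm_pos hnpos hc1; rw [hu] at this; simp at this
    · exfalso; apply k2
      have := Nat.dvd_lcm_right n c
      rwa [hu, zero_add, mul_one] at this
    · rw [hu, mul_comm]; exact Nat.mul_le_mul_left _ (by omega)
  refine ⟨_, _, ⟨f1, ?_, by omega, f2, ?_⟩, h2n⟩
  · exact orderOf_mul_pow h.order g1 (by omega) (by omega) k1 k2 k3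
  · intro y
    rw [hF4.iarr 8 rfl, hF3.iarr 8 rfl, hF2.iarr 8 rfl]
    have := hm1 y
    omega

theorem findGenerator_spec [Fact (Irreducible p)] (hM : Machine W V) (hD : Dims b m d V)
    (hσ : Bdd V σ) (hB : Base b m d K σ) (hp : p.natDegree = m)
    (hR : RedTab (AdjoinRoot.mk p) m σ) (h8 : ∀ y, σ.iarr 8 y = 0) :
    Run W V findGenerator σ (K * (b ^ m * 1300) + b ^ m * 400) (fun τ => ∃ ζ : AdjoinRoot p,
      orderOf ζ = b ^ m - 1 ∧ PowTab (AdjoinRoot.mk p) m ζ 6 τ) := by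
  have hN := hD.N_le
  have hbN := hD.b_le
  have h2 := hD.two_le
  refine Run.mono (T := 4 + ((b * 100 + b ^ m * 150 + 10) + (b ^ m * 25 +
    (2 + (K * ((3 + b ^ m * 1200) + 7) + 5))))) ?_ ?_ fun _ _ _ h => h
  swap
  · have : K * ((3 + b ^ m * 1200) + 7) ≤ K * (b ^ m * 1300) := Nat.mul_le_mul_left _ (by omega)
    omega
  refine Run.seq (Q := fun τ => τ = (σ.setIreg 20 1).setIreg 21 (b ^ m))
    (Run.of_wp hM hσ rfl (by decide) ?_) ?_
  · simp [WP, IExpr.Safe, IExpr.eval, hB.r4]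
    omega
  rintro σ1 hσ1 hF1 rfl
  have hB1 := hB.frame hF1 rfl
  refine Run.seq (Run.mono (mulTable_spec (AdjoinRoot.mk p) hM hD hσ1 hB1 hR
    (by simp; omega)) (by simp) fun _ _ _ h => h) ?_
  intro σ2 hσ2 hF2 hMT
  have hB2 := hB1.frame hF2 rfl
  simp at hMT
  refine Run.seq (powTable_spec _ hM hD hσ2 hB2 hMT rfl) ?_
  intro σ3 hσ3 hF3 hPT
  have hB3 := hB2.frame hF3 rfl
  refine Run.seq (Q := fun τ => τ = σ3.setIreg 31 1) (Run.of_wp hM hσ3 rfl le_rfl ?_) ?_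
  · simp [WP, IExpr.Safe, IExpr.eval]
    omega
  rintro σ4 hσ4 hF4 rfl
  have hB4 := hB3.frame hF4 rfl
  have hR4 : RedTab (AdjoinRoot.mk p) m (σ3.setIreg 31 1) := by
    unfold RedTab; rw [setIreg_iarr, hF3.iarr 3 rfl, hF2.iarr 3 rfl]; exact hR
  have hloop := Run.for (W := W) (V := V) (x := 14) (r := 9) (σ := σ3.setIreg 31 1)
    (c := .ite (.ilt (.reg 31) (.reg 5)) grow .skip) (T := 3 + b ^ m * 1200)
    (fun i τ => ∃ (ζ : AdjoinRoot p) (n : ℕ), GenState m ζ n τ ∧ (n = b ^ m - 1 ∨ 2 ^ i ≤ n))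
    hM hσ4 rfl rfl rfl (by
      rintro i τ v ⟨ζ, n, h, h'⟩
      exact ⟨ζ, n, ⟨h.r31, h.order, h.pos, h.pow, h.marks⟩, h'⟩)
    ⟨1, 1, ⟨by simp, orderOf_one, le_rfl, hPT, fun y => by
      rw [setIreg_iarr, hF3.iarr 8 rfl, hF2.iarr 8 rfl]; simp [h8]⟩, by simp⟩ (by
      rintro i hi τ hτ hF hx ⟨ζ, n, h, h'⟩
      have hBτ := hB4.frame hF rfl
      have hRτ : RedTab (AdjoinRoot.mk p) m τ := by
        unfold RedTab; rw [hF.iarr 3 rfl]; exact hR4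
      refine Run.mono (Run.ite (T := b ^ m * 1200) hM hτ rfl ?_ ?_ ?_) le_rfl fun _ _ _ h => h
      · simp [BExpr.Safe, IExpr.Safe]
      · intro hlt
        simp only [BExpr.Holds, IExpr.eval, h.r31, hBτ.r5] at hlt
        refine Run.mono (grow_spec hM hD hτ hBτ hp hRτ h hlt) le_rfl ?_
        rintro υ - - ⟨ζ', n', hg, hg'⟩
        refine ⟨ζ', n', hg, Or.inr ?_⟩
        rw [pow_succ]; omega
      · intro hge
        simp only [BExpr.Holds, IExpr.eval, h.r31, hBτ.r5] at hge
        have := (h.lt hD.1 hp).2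
        exact Run.of_wp hM hτ rfl (by simp [Cmd.tcost]; omega)
          ⟨ζ, n, h, Or.inl (by omega)⟩)
  rw [hB4.r9] at hloop
  refine hloop.mono le_rfl ?_
  rintro υ - - ⟨ζ, n, h, h'⟩
  -- After `K` rounds of doubling the order would be at least `2 ^ K ≥ 2 N`, impossible for an order
  -- at most `N - 1`; so the search has ended at `N - 1`.
  have h1 := (h.lt hD.1 hp).2
  have h3 := hB4.le_L
  exact ⟨ζ, by rw [h.order]; omega, h.pow⟩

end

end RealRAM

/-! ## The fast Fourier transform -/

namespace PolyLattice

open Finset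

/-- The `j`-th entry of a binary tree of roots of unity: `w 1 = 1`, and the children `2 j` and
`2 j + 1` of the node `j` contain the two square roots of `w j`. -/
structure RootTree (L : ℕ) (w : ℕ → ℂ) : Prop where
  one : w 1 = 1
  sq : ∀ j, 1 ≤ j → j ≤ L → w (2 * j) ^ 2 = w j
  neg : ∀ j, 1 ≤ j → j ≤ L → w (2 * j + 1) = - w (2 * j)
  conj : ∀ j, 1 ≤ j → j < 2 * L → w j * starRingEnd ℂ (w j) = 1

/-- Row `k` contains the residues of the polynomial with coefficients `f` modulo the polynomials
`x ^ (2 ^ (K - k)) - w (2 ^ k + c)` for `c < 2 ^ k`. -/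
noncomputable def fwd (K : ℕ) (w f : ℕ → ℂ) : ℕ → ℕ → ℂ
  | 0, i => f i
  | k + 1, i => fwd K w f k (i / 2 ^ (K - (k + 1)) / 2 * (2 * 2 ^ (K - (k + 1))) +
        i % 2 ^ (K - (k + 1))) + w (2 ^ (k + 1) + i / 2 ^ (K - (k + 1))) *
      fwd K w f k (i / 2 ^ (K - (k + 1)) / 2 * (2 * 2 ^ (K - (k + 1))) +
        i % 2 ^ (K - (k + 1)) + 2 ^ (K - (k + 1)))

/-- The inverse transform: row `k` of `bwd` is row `K - k` of `fwd`. -/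
noncomputable def bwd (K : ℕ) (w s : ℕ → ℂ) : ℕ → ℕ → ℂ
  | 0, i => s i
  | k + 1, i => if i % (2 * 2 ^ k) < 2 ^ k then (bwd K w s k i + bwd K w s k (i + 2 ^ k)) / 2
      else (bwd K w s k (i - 2 ^ k) - bwd K w s k i) *
        starRingEnd ℂ (w (2 ^ (K - k) + 2 * (i / (2 * 2 ^ k)))) / 2

/-- Cyclic convolution. -/
def cconv (L : ℕ) (f g : ℕ → ℂ) (q : ℕ) : ℂ := ∑ u ∈ range L, f u * g ((q + L - u) % L)

theorem sum_range_two_mul (g : ℕ → ℂ) (a : ℕ) :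
    ∑ t ∈ range (2 * a), g t = ∑ t ∈ range a, (g (2 * t) + g (2 * t + 1)) := by
  induction a with
  | zero => simp
  | succ a ih => rw [mul_add, mul_one, sum_range_succ, sum_range_succ, ih, sum_range_succ]; ring

variable {K : ℕ} {w : ℕ → ℂ}

/-- Depth `k` of the tree occupies the indices `2 ^ k + c` with `c < 2 ^ k`, and the parent of
position `c` is position `c / 2` one level higher. -/
theorem RootTree.node_sq (h : RootTree (2 ^ K) w) {k c : ℕ} (hk : k + 1 ≤ K)
    (hc : c < 2 ^ (k + 1)) : w (2 ^ (k + 1) + c) ^ 2 = w (2 ^ k + c / 2) := by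
  have h1 : 1 ≤ 2 ^ k := Nat.one_le_two_pow
  have h2 : 2 ^ (k + 1) ≤ 2 ^ K := Nat.pow_le_pow_right (by norm_num) hk
  rw [pow_succ] at hc h2
  rcases Nat.even_or_odd' c with ⟨e, rfl | rfl⟩
  · rw [show 2 ^ (k + 1) + 2 * e = 2 * (2 ^ k + e) by ring, h.sq _ (by omega) (by omega)]
    congr 1; omega
  · rw [show 2 ^ (k + 1) + (2 * e + 1) = 2 * (2 ^ k + e) + 1 by ring,
      h.neg _ (by omega) (by omega), neg_sq, h.sq _ (by omega) (by omega)]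
    congr 1; omega

theorem RootTree.pow_eq_one (h : RootTree (2 ^ K) w) (k : ℕ) :
    ∀ {c : ℕ}, k ≤ K → c < 2 ^ k → w (2 ^ k + c) ^ (2 ^ k) = 1 := by
  induction k with
  | zero => intro c _ hc; have : c = 0 := by simpa using hc
            simp [this, h.one]
  | succ k ih =>
    intro c hk hc
    rw [show w (2 ^ (k + 1) + c) ^ 2 ^ (k + 1) = (w (2 ^ (k + 1) + c) ^ 2) ^ 2 ^ k by
      rw [← pow_mul, ← pow_succ'], h.node_sq hk hc]
    exact ih (by omega) (by rw [pow_succ] at hc; omega)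

/-- Modulo `x ^ n - w` the monomial `x ^ (r + t n)` becomes `w ^ t x ^ r`, with `n = 2 ^ (K - k)`.
Passing to the next row separates even and odd `t`, using that `w` is the square of the child's
root. -/
theorem fwd_eq_sum (h : RootTree (2 ^ K) w) (f : ℕ → ℂ) (k : ℕ) : ∀ {c r : ℕ}, k ≤ K →
    c < 2 ^ k → r < 2 ^ (K - k) → fwd K w f k (c * 2 ^ (K - k) + r) =
      ∑ t ∈ range (2 ^ k), f (r + t * 2 ^ (K - k)) * w (2 ^ k + c) ^ t := by
  induction k with
  | zero => intro c r _ hc _; have : c = 0 := by simpa using hc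
            simp [this, fwd]
  | succ k ih =>
    intro c r hk hc hr
    have hn : 2 ^ (K - k) = 2 * 2 ^ (K - (k + 1)) := by
      rw [← pow_succ']; congr 1; omega
    set n := 2 ^ (K - (k + 1)) with hndef
    have hn0 : 0 < n := Nat.two_pow_pos _
    have e1 : (c * n + r) / n = c := by
      rw [mul_comm, Nat.mul_add_div hn0, Nat.div_eq_of_lt hr, add_zero]
    have e2 : (c * n + r) % n = r := by
      rw [mul_comm, Nat.mul_add_mod, Nat.mod_eq_of_lt hr]
    have hc2 : c / 2 < 2 ^ k := by rw [pow_succ] at hc; omega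
    rw [hn] at ih
    rw [fwd, ← hndef, e1, e2, ih (by omega) hc2 (by omega), add_assoc,
      ih (by omega) hc2 (by omega), ← h.node_sq hk hc, show 2 ^ (k + 1) = 2 * 2 ^ k by ring,
      sum_range_two_mul, sum_add_distrib, mul_sum]
    congr 1
    · refine sum_congr rfl fun t _ => ?_
      rw [← pow_mul]; congr 2; ring
    · refine sum_congr rfl fun t _ => ?_
      rw [← pow_mul, pow_succ, show r + n + t * (2 * n) = r + (2 * t + 1) * n by ring]
      ring

theorem fwd_leaf (h : RootTree (2 ^ K) w) (f : ℕ → ℂ) {c : ℕ} (hc : c < 2 ^ K) :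
    fwd K w f K c = ∑ t ∈ range (2 ^ K), f t * w (2 ^ K + c) ^ t := by
  simpa using fwd_eq_sum h f K le_rfl hc (r := 0) (by simp)

/-- Since `z ^ L = 1`, exponents only matter modulo `L`; for fixed `u`, the map `v ↦ (u + v) % L`
permutes the indices. -/
theorem sum_mul_sum_eq_cconv {L : ℕ} {z : ℂ} (hz : z ^ L = 1) (f g : ℕ → ℂ) :
    (∑ t ∈ range L, f t * z ^ t) * (∑ t ∈ range L, g t * z ^ t) =
      ∑ q ∈ range L, cconv L f g q * z ^ q := by
  have key : ∀ u ∈ range L, ∑ v ∈ range L, g v * z ^ (u + v) =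
      ∑ q ∈ range L, g ((q + L - u) % L) * z ^ q := by
    intro u hu
    rw [mem_range] at hu
    have hL : 0 < L := by omega
    refine sum_nbij' (fun v => (u + v) % L) (fun q => (q + L - u) % L)
      (fun v _ => mem_range.2 (Nat.mod_lt _ hL)) (fun q _ => mem_range.2 (Nat.mod_lt _ hL))
      ?_ ?_ ?_
    · intro v hv
      rw [mem_range] at hv
      rcases lt_or_ge (u + v) L with h | h
      · rw [Nat.mod_eq_of_lt h, show u + v + L - u = v + L by omega, Nat.add_mod_right,
          Nat.mod_eq_of_lt hv]
      · rw [Nat.mod_eq_sub_mod h, Nat.mod_eq_of_lt (by omega : u + v - L < L),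
          show u + v - L + L - u = v by omega, Nat.mod_eq_of_lt hv]
    · intro q hq
      rw [mem_range] at hq
      rcases lt_or_ge q u with h | h
      · rw [Nat.mod_eq_of_lt (by omega : q + L - u < L), show u + (q + L - u) = q + L by omega,
          Nat.add_mod_right, Nat.mod_eq_of_lt hq]
      · rw [show q + L - u = (q - u) + L by omega, Nat.add_mod_right,
          Nat.mod_eq_of_lt (by omega : q - u < L), show u + (q - u) = q by omega,
          Nat.mod_eq_of_lt hq]
    · intro v hv
      rw [mem_range] at hv
      have : ((u + v) % L + L - u) % L = v := by
        rcases lt_or_ge (u + v) L with h | h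
        · rw [Nat.mod_eq_of_lt h, show u + v + L - u = v + L by omega, Nat.add_mod_right,
            Nat.mod_eq_of_lt hv]
        · rw [Nat.mod_eq_sub_mod h, Nat.mod_eq_of_lt (by omega : u + v - L < L),
            show u + v - L + L - u = v by omega, Nat.mod_eq_of_lt hv]
      rw [this]
      congr 1
      conv_lhs => rw [← Nat.mod_add_div (u + v) L, pow_add, pow_mul, hz, one_pow, mul_one]
  rw [sum_mul_sum]
  simp only [cconv, sum_mul]
  conv_rhs => rw [sum_comm]
  refine sum_congr rfl fun u hu => ?_
  have := congrArg (fun s => f u * s) (key u hu)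
  simp only [mul_sum] at this
  rw [sum_congr rfl fun v _ => show f u * z ^ u * (g v * z ^ v) = f u * (g v * z ^ (u + v)) by
    rw [pow_add]; ring, this]
  exact sum_congr rfl fun q _ => by ring

theorem fwd_child (f : ℕ → ℂ) {k c r : ℕ} (hr : r < 2 ^ (K - (k + 1))) :
    fwd K w f (k + 1) (c * 2 ^ (K - (k + 1)) + r) =
      fwd K w f k (c / 2 * (2 * 2 ^ (K - (k + 1))) + r) + w (2 ^ (k + 1) + c) *
        fwd K w f k (c / 2 * (2 * 2 ^ (K - (k + 1))) + r + 2 ^ (K - (k + 1))) := by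
  have hn0 : 0 < 2 ^ (K - (k + 1)) := Nat.two_pow_pos _
  rw [fwd, mul_comm c, Nat.mul_add_div hn0, Nat.div_eq_of_lt hr, add_zero, Nat.mul_add_mod,
    Nat.mod_eq_of_lt hr]

/-- Two sibling residues have the form `A + w B` and `A - w B`. Half their sum is `A`, and half
their difference times `w⁻¹`, the conjugate of `w` on the unit circle, is `B`. Each level is undone
in this way, so no uniqueness of interpolation and no distinctness of the roots is needed. -/
theorem bwd_eq_fwd (h : RootTree (2 ^ K) w) {f s : ℕ → ℂ}
    (hs : ∀ i < 2 ^ K, s i = fwd K w f K i) (k : ℕ) :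
    ∀ {i : ℕ}, k ≤ K → i < 2 ^ K → bwd K w s k i = fwd K w f (K - k) i := by
  induction k with
  | zero => intro i _ hi; simpa [bwd] using hs i hi
  | succ k ih =>
    intro i hk hi
    obtain ⟨l, hl⟩ : ∃ l, K = l + (k + 1) := ⟨K - (k + 1), by omega⟩
    have e0 : K - k = l + 1 := by omega
    have e1 : K - (l + 1) = k := by omega
    have e2 : K - (k + 1) = l := by omega
    set n := 2 ^ k with hn
    have hn0 : 0 < n := Nat.two_pow_pos _
    set c := i / (2 * n) with hc
    have hLn : 2 ^ K = 2 ^ l * (2 * n) := by rw [hl, pow_add, pow_succ]; ring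
    have hcl : c < 2 ^ l := by
      rw [hc, Nat.div_lt_iff_lt_mul (by omega), ← hLn]; exact hi
    have hir : i = c * (2 * n) + i % (2 * n) := by
      rw [mul_comm c]; exact (Nat.div_add_mod i (2 * n)).symm
    have hrlt : i % (2 * n) < 2 * n := Nat.mod_lt _ (by omega)
    have hbound : c * (2 * n) + 2 * n ≤ 2 ^ K := by
      rw [hLn]
      calc c * (2 * n) + 2 * n = (c + 1) * (2 * n) := by ring
        _ ≤ 2 ^ l * (2 * n) := Nat.mul_le_mul_right _ hcl
    have hl1 : 2 ^ (l + 1) ≤ 2 ^ K := Nat.pow_le_pow_right (by norm_num) (by omega)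
    have hch : ∀ r < n, fwd K w f (l + 1) (c * (2 * n) + r) =
        fwd K w f l (c * (2 * n) + r) + w (2 ^ (l + 1) + 2 * c) *
          fwd K w f l (c * (2 * n) + r + n) ∧
        fwd K w f (l + 1) (c * (2 * n) + r + n) =
        fwd K w f l (c * (2 * n) + r) - w (2 ^ (l + 1) + 2 * c) *
          fwd K w f l (c * (2 * n) + r + n) := by
      intro r hr
      have a1 := fwd_child (K := K) (w := w) f (k := l) (c := 2 * c) (r := r) (by rw [e1]; exact hr)
      have a2 := fwd_child (K := K) (w := w) f (k := l) (c := 2 * c + 1) (r := r)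
        (by rw [e1]; exact hr)
      rw [e1, ← hn] at a1 a2
      rw [show 2 * c / 2 = c by omega, show 2 * c * n + r = c * (2 * n) + r by ring] at a1
      rw [show (2 * c + 1) / 2 = c by omega, show (2 * c + 1) * n + r = c * (2 * n) + r + n by ring,
        show 2 ^ (l + 1) + (2 * c + 1) = 2 * (2 ^ l + c) + 1 by ring,
        h.neg _ (le_add_right Nat.one_le_two_pow) (by rw [pow_succ] at hl1; omega),
        show 2 * (2 ^ l + c) = 2 ^ (l + 1) + 2 * c by ring] at a2
      exact ⟨a1, by rw [a2]; ring⟩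
    rw [bwd, e2, ← hn, ← hc, e0]
    rw [e0] at ih
    split_ifs with hlt
    · obtain ⟨a1, a2⟩ := hch _ hlt
      rw [← hir] at a1 a2
      rw [ih (by omega) hi, ih (by omega) (by omega), a1, a2]
      ring
    · obtain ⟨a1, a2⟩ := hch (i % (2 * n) - n) (by omega)
      rw [show c * (2 * n) + (i % (2 * n) - n) + n = i by omega,
        show c * (2 * n) + (i % (2 * n) - n) = i - n by omega] at a1 a2
      rw [ih (by omega) hi, ih (by omega) (by omega), a1, a2]
      have hw := h.conj (2 ^ (l + 1) + 2 * c) (by have := Nat.two_pow_pos (l + 1); omega)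
        (by rw [pow_succ] at hl1 ⊢; omega)
      linear_combination (fwd K w f l i) * hw

/-- The inverse transform of the square of the transform is the cyclic convolution square. -/
theorem bwd_sq_fwd (h : RootTree (2 ^ K) w) (f : ℕ → ℂ) {i : ℕ} (hi : i < 2 ^ K) {s : ℕ → ℂ}
    (hs : ∀ i < 2 ^ K, s i = fwd K w f K i * fwd K w f K i) :
    bwd K w s K i = cconv (2 ^ K) f f i := by
  have h1 : ∀ j < 2 ^ K, s j = fwd K w (cconv (2 ^ K) f f) K j := by
    intro j hj
    rw [hs j hj, fwd_leaf h _ hj, fwd_leaf h _ hj,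
      sum_mul_sum_eq_cconv (h.pow_eq_one K le_rfl hj)]
  rw [bwd_eq_fwd h h1 K le_rfl hi, Nat.sub_self, fwd]

end PolyLattice

/-! ### The Fourier transform on the machine. -/

namespace RealRAM

open Polynomial PolyLattice

/-- The complex number whose real and imaginary part are in cell `i` of the real arrays `a`
and `a'`. -/
def Store.cx (σ : Store) (a a' i : ℕ) : ℂ := ⟨σ.rarr a i, σ.rarr a' i⟩

/-- Half-angle formulas: a square root of `x + i y` on the unit circle has the parts `√((1 + x) /
2)` and `± √((1 - x) / 2)`, the sign being that of `y`. The second child is the negative of the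
first. -/
def rootsBody : Cmd :=
  .seq (.iset 14 (.add (.reg 13) (.lit 1)))
    (.seq (.rput 5 (.mul (.lit 2) (.reg 14))
      (.sqrt (.div (.add (.ofInt (.lit 1)) (.get 5 (.reg 14))) (.ofInt (.lit 2)))))
    (.seq (.rput 6 (.mul (.lit 2) (.reg 14))
      (.sqrt (.div (.sub (.ofInt (.lit 1)) (.get 5 (.reg 14))) (.ofInt (.lit 2)))))
    (.seq (.ite (.rle (.ofInt (.lit 0)) (.get 6 (.reg 14))) .skip
      (.rput 6 (.mul (.lit 2) (.reg 14)) (.sub (.ofInt (.lit 0)) (.get 6 (.mul (.lit 2) (.reg 14))))))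
    (.seq (.rput 5 (.add (.mul (.lit 2) (.reg 14)) (.lit 1))
      (.sub (.ofInt (.lit 0)) (.get 5 (.mul (.lit 2) (.reg 14)))))
    (.rput 6 (.add (.mul (.lit 2) (.reg 14)) (.lit 1))
      (.sub (.ofInt (.lit 0)) (.get 6 (.mul (.lit 2) (.reg 14)))))))))

/-- Computes a tree of roots of unity. -/
def roots : Cmd :=
  .seq (.seq (.rput 5 (.lit 1) (.ofInt (.lit 1))) (.rput 6 (.lit 1) (.ofInt (.lit 0))))
    (.for 13 10 rootsBody)

section
variable {W V b m d K : ℕ} {σ : Store}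

/-- A square root of a point of the unit circle. -/
theorem sqrt_unit {x y : ℝ} (h : x ^ 2 + y ^ 2 = 1) :
    0 ≤ (1 + x) / 2 ∧ 0 ≤ (1 - x) / 2 ∧ √((1 + x) / 2) ^ 2 - √((1 - x) / 2) ^ 2 = x ∧
      √((1 + x) / 2) ^ 2 + √((1 - x) / 2) ^ 2 = 1 ∧
      2 * (√((1 + x) / 2) * √((1 - x) / 2)) = |y| := by
  have h1 : 0 ≤ (1 + x) / 2 := by nlinarith [sq_nonneg y]
  have h2 : 0 ≤ (1 - x) / 2 := by nlinarith [sq_nonneg y]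
  refine ⟨h1, h2, ?_, ?_, ?_⟩
  · rw [Real.sq_sqrt h1, Real.sq_sqrt h2]; ring
  · rw [Real.sq_sqrt h1, Real.sq_sqrt h2]; ring
  · rw [← Real.sqrt_mul h1, show (1 + x) / 2 * ((1 - x) / 2) = (y / 2) ^ 2 by nlinarith,
      Real.sqrt_sq_eq_abs, abs_div, abs_two]
    ring

/-- The first `i` roots have been bisected. -/
def PartialTree (i : ℕ) (τ : Store) : Prop :=
  τ.rarr 5 1 = 1 ∧ τ.rarr 6 1 = 0 ∧
    (∀ j, 1 ≤ j → j < 2 * i + 2 → τ.rarr 5 j ^ 2 + τ.rarr 6 j ^ 2 = 1) ∧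
    ∀ j, 1 ≤ j → j ≤ i → (τ.rarr 5 (2 * j) ^ 2 - τ.rarr 6 (2 * j) ^ 2 = τ.rarr 5 j ∧
      2 * (τ.rarr 5 (2 * j) * τ.rarr 6 (2 * j)) = τ.rarr 6 j) ∧
      τ.rarr 5 (2 * j + 1) = - τ.rarr 5 (2 * j) ∧ τ.rarr 6 (2 * j + 1) = - τ.rarr 6 (2 * j)

theorem roots_spec {L : ℕ} (hM : Machine W V) (hσ : Bdd V σ) (hL : σ.ireg 10 = L) (hLV : L + 1 < V) :
    Run W V roots σ (L * 100 + 20) (fun τ => RootTree L (τ.cx 5 6)) := by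
  refine Run.mono (T := 10 + (L * (90 + 7) + 5)) ?_ (by omega) fun _ _ _ h => h
  refine Run.seq (Q := fun τ => τ.ireg 10 = L ∧ τ.rarr 5 1 = 1 ∧ τ.rarr 6 1 = 0)
    (Run.of_wp hM hσ rfl (by decide)
      (by simp [WP, IExpr.Safe, RExpr.Safe, RExpr.eval, IExpr.eval, hL])) ?_
  rintro σ1 hσ1 - ⟨e10, e5, e6⟩
  have hloop := Run.for (W := W) (V := V) (x := 13) (r := 10) (σ := σ1) (c := rootsBody) (T := 90)
    PartialTree hM hσ1 rfl rfl rfl (fun _ _ _ h => h)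
    ⟨e5, e6, fun j h1 h2 => by
      have : j = 1 := by omega
      subst this; simp [e5, e6], fun j h1 h2 => by omega⟩ (by
      rw [e10]
      rintro i hi τ hτ hF hx ⟨t5, t6, hI1, hI2⟩
      refine Run.of_wp hM hτ rfl (by decide) ?_
      obtain ⟨s1, s2, s3, s4, s5⟩ := sqrt_unit (hI1 (i + 1) (by omega) (by omega))
      set x := τ.rarr 5 (i + 1) with hxdef
      set y := τ.rarr 6 (i + 1) with hydef
      -- Common to both signs of `y`: `z` is the imaginary part that was chosen.
      have fin : ∀ z : ℝ, z ^ 2 = √((1 - x) / 2) ^ 2 → 2 * (√((1 + x) / 2) * z) = y →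
          ∀ υ : Store, υ.rarr 5 (2 * (i + 1)) = √((1 + x) / 2) → υ.rarr 6 (2 * (i + 1)) = z →
          υ.rarr 5 (2 * (i + 1) + 1) = -√((1 + x) / 2) → υ.rarr 6 (2 * (i + 1) + 1) = -z →
          (∀ j, j < 2 * (i + 1) → υ.rarr 5 j = τ.rarr 5 j ∧ υ.rarr 6 j = τ.rarr 6 j) →
          PartialTree (i + 1) υ := by
        intro z hz hz' υ u1 u2 u3 u4 u5
        refine ⟨by rw [(u5 1 (by omega)).1, t5], by rw [(u5 1 (by omega)).2, t6], ?_, ?_⟩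
        · intro j h1 h2
          rcases lt_or_ge j (2 * (i + 1)) with h | h
          · rw [(u5 j h).1, (u5 j h).2]; exact hI1 j h1 (by omega)
          · obtain rfl | rfl : j = 2 * (i + 1) ∨ j = 2 * (i + 1) + 1 := by omega
            · rw [u1, u2, hz, s4]
            · rw [u3, u4, neg_sq, neg_sq, hz, s4]
        · intro j h1 h2
          rcases Nat.lt_or_ge j (i + 1) with h | h
          · rw [(u5 (2 * j) (by omega)).1, (u5 (2 * j) (by omega)).2, (u5 (2 * j + 1) (by omega)).1,
              (u5 (2 * j + 1) (by omega)).2, (u5 j (by omega)).1, (u5 j (by omega)).2]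
            exact hI2 j h1 (by omega)
          · obtain rfl : j = i + 1 := by omega
            rw [u1, u2, u3, u4, (u5 (i + 1) (by omega)).1, (u5 (i + 1) (by omega)).2, hz]
            exact ⟨⟨s3, hz'⟩, rfl, rfl⟩
      have hne : ∀ j, j < 2 * (i + 1) → j ≠ 2 * (i + 1) ∧ j ≠ 2 * (i + 1) + 1 := by omega
      have hne1 : i + 1 ≠ 2 * (i + 1) := by omega
      have hne2 : 2 * (i + 1) ≠ 2 * (i + 1) + 1 := by omega
      simp only [rootsBody, WP, BExpr.Safe, BExpr.Holds, IExpr.Safe, IExpr.eval, RExpr.Safe,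
        RExpr.eval, hx, setIreg_ireg, setIreg_rarr, setRarr_ireg, setRarr_rarr, if_true, true_and,
        and_true, Nat.cast_one, Nat.cast_ofNat, Nat.cast_zero, Nat.reduceEqDiff, if_false, ← hxdef,
        ← hydef, if_neg hne1, if_neg hne2]
      refine ⟨by omega, ⟨by norm_num, s1⟩, ⟨by norm_num, s2⟩, fun hy => ?_, fun hy => ?_⟩
      · refine fin _ rfl (by rw [s5, abs_of_nonneg hy]) _ ?_ ?_ ?_ ?_ ?_
        · simp
        · simp
        · simp
        · simp
        · intro j hj
          simp [(hne j hj).1, (hne j hj).2]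
      · refine fin (-√((1 - x) / 2)) (neg_sq _) (by
          rw [mul_neg, mul_neg, s5, abs_of_neg (not_le.1 hy), neg_neg]) _ ?_ ?_ ?_ ?_ ?_
        · simp
        · simp
        · simp
        · simp
        · intro j hj
          simp [(hne j hj).1, (hne j hj).2])
  rw [e10] at hloop
  refine hloop.mono le_rfl ?_
  rintro τ - - ⟨t5, t6, h1, h2⟩
  refine ⟨?_, ?_, ?_, ?_⟩
  · simp [Store.cx, t5, t6, Complex.ext_iff]
  · intro j hj hj'
    obtain ⟨⟨a1, a2⟩, -⟩ := h2 j hj hj'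
    rw [Complex.ext_iff, sq]
    simp only [Store.cx, Complex.mul_re, Complex.mul_im]
    exact ⟨by rw [← a1]; ring, by rw [← a2]; ring⟩
  · intro j hj hj'
    obtain ⟨-, a1, a2⟩ := h2 j hj hj'
    simp [Store.cx, Complex.ext_iff, a1, a2]
  · intro j hj hj'
    have := h1 j hj (by omega)
    rw [Complex.mul_conj, Complex.normSq_apply]
    simp only [Store.cx, ← sq, this, Complex.ofReal_one]

/-- Row `k` occupies the cells from `k * 2 ^ K` on, so a single loop over `K * 2 ^ K` cells runs
through all butterflies. Registers `14`, `15`, `17` and `18` hold the row, the position, the block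
length of the next row and the block number there. -/
def forwardBody : Cmd :=
  .seq (.seq (.seq (.iset 14 (.div (.reg 13) (.reg 10))) (.iset 15 (.mod (.reg 13) (.reg 10))))
    (.seq (.iset 16 (.get 5 (.add (.reg 14) (.lit 1))))
    (.seq (.iset 17 (.div (.reg 10) (.reg 16))) (.iset 18 (.div (.reg 15) (.reg 17))))))
    (.seq (.iset 19 (.add (.mul (.reg 14) (.reg 10)) (.add (.mul (.div (.reg 18) (.lit 2))
      (.mul (.lit 2) (.reg 17))) (.mod (.reg 15) (.reg 17)))))
    (.seq (.iset 20 (.add (.reg 16) (.reg 18))) (.seq (.iset 21 (.add (.reg 19) (.reg 17)))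
    (.seq (.iset 22 (.add (.reg 13) (.reg 10)))
    (.seq (.rput 1 (.reg 22) (.add (.get 1 (.reg 19)) (.sub (.mul (.get 5 (.reg 20)) (.get 1 (.reg 21)))
      (.mul (.get 6 (.reg 20)) (.get 2 (.reg 21))))))
    (.rput 2 (.reg 22) (.add (.get 2 (.reg 19)) (.add (.mul (.get 5 (.reg 20)) (.get 2 (.reg 21)))
      (.mul (.get 6 (.reg 20)) (.get 1 (.reg 21)))))))))))

/-- The forward transform of the complex numbers in the arrays `1` and `2`. -/
def forward : Cmd := .for 13 11 forwardBody

theorem forward_spec [hb : Fact b.Prime] (hM : Machine W V) (hD : Dims b m d V) (hσ : Bdd V σ)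
    (hB : Base b m d K σ) :
    Run W V forward σ (K * 2 ^ K * 107 + 5) (fun τ => ∀ k ≤ K, ∀ i < 2 ^ K,
      τ.cx 1 2 (k * 2 ^ K + i) = fwd K (σ.cx 5 6) (σ.cx 1 2) k i) := by
  have hL0 : 0 < 2 ^ K := Nat.two_pow_pos K
  have hKL : K < 2 ^ K := Nat.lt_two_pow_self
  have hLle := hB.L_le
  have hsq := hD.sq_le
  have hN := hD.N_le
  have hV : 2 * (2 ^ K * 2 ^ K) ≤ V := by nlinarith
  have hV2 : 8 * 2 ^ K ≤ V := by omega
  have hLL : 2 ^ K ≤ 2 ^ K * 2 ^ K := Nat.le_mul_of_pos_left _ hL0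
  have hloop := Run.for (W := W) (V := V) (x := 13) (r := 11) (σ := σ) (c := forwardBody)
    (T := 100) (fun q τ => ∀ k ≤ K, ∀ i < 2 ^ K, k * 2 ^ K + i < 2 ^ K + q →
      τ.cx 1 2 (k * 2 ^ K + i) = fwd K (σ.cx 5 6) (σ.cx 1 2) k i) hM hσ rfl rfl rfl
    (fun _ _ _ h => h) (by
      intro k _ i hi hlt
      have : k = 0 := by
        by_contra h
        have := Nat.le_mul_of_pos_left (2 ^ K) (Nat.pos_of_ne_zero h)
        omega
      subst this
      simp [fwd]) (by
      rw [hB.r11]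
      intro q hq τ hτ hF hx hI
      have hBτ := hB.frame hF rfl
      have e5 : τ.rarr 5 = σ.rarr 5 := hF.rarr 5 rfl
      have e6 : τ.rarr 6 = σ.rarr 6 := hF.rarr 6 rfl
      refine Run.of_wp hM hτ rfl (by decide) ?_
      set k := q / 2 ^ K with hk
      set i := q % 2 ^ K with hi
      have hkK : k < K := by rw [hk, Nat.div_lt_iff_lt_mul hL0]; exact hq
      have hiL : i < 2 ^ K := Nat.mod_lt _ hL0
      have hqe : q = k * 2 ^ K + i := by
        rw [mul_comm]; exact (Nat.div_add_mod q (2 ^ K)).symm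
      have hpow := hBτ.pow (k + 1) (by omega)
      set n := 2 ^ (K - (k + 1)) with hn
      have hn0 : 0 < n := Nat.two_pow_pos _
      have hLn : 2 ^ K = n * 2 ^ (k + 1) := by rw [hn, ← pow_add]; congr 1; omega
      have hdivn : 2 ^ K / 2 ^ (k + 1) = n := by
        rw [hLn, Nat.mul_div_cancel _ (Nat.two_pow_pos _)]
      set c := i / n with hc
      have hcl : c < 2 ^ (k + 1) := by
        rw [hc, Nat.div_lt_iff_lt_mul hn0, mul_comm, ← hLn]; exact hiL
      have hrn : i % n < n := Nat.mod_lt _ hn0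
      have hbase : c / 2 * (2 * n) + i % n + n < 2 ^ K := by
        have h1 : c / 2 + 1 ≤ 2 ^ k := by rw [pow_succ] at hcl; omega
        have h2 := Nat.mul_le_mul_right (2 * n) h1
        rw [hLn, pow_succ]
        nlinarith
      have hI1 := hI k hkK.le (c / 2 * (2 * n) + i % n) (by omega) (by omega)
      have hI2 := hI k hkK.le (c / 2 * (2 * n) + i % n + n) (by omega) (by omega)
      set base := c / 2 * (2 * n) + i % n with hbased
      have hk1 : 2 ^ (k + 1) ≤ 2 ^ K := Nat.pow_le_pow_right (by norm_num) hkK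
      have hklt : k * 2 ^ K + 2 ^ K ≤ 2 ^ K * 2 ^ K := by
        have := Nat.mul_le_mul_right (2 ^ K) (show k + 1 ≤ 2 ^ K by omega)
        linarith
      have hnL : n ≤ 2 ^ K := by omega
      -- The cells that are read lie in row `k` and the written one in row `k + 1`, so writing the
      -- real part does not disturb the computation of the imaginary part.
      have hne1 : k * 2 ^ K + base ≠ q + 2 ^ K := by omega
      have hne2 : k * 2 ^ K + base + n ≠ q + 2 ^ K := by omega
      simp only [forwardBody, WP, IExpr.Safe, IExpr.eval, RExpr.Safe, RExpr.eval, hx,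
        setIreg_ireg, setIreg_rarr, setIreg_iarr, setRarr_ireg, setRarr_rarr, if_true, true_and,
        and_true, Nat.reduceEqDiff, if_false, hBτ.r10, ← hk, ← hi, hpow, hdivn, ← hc, ← hbased,
        if_neg hne1, if_neg hne2]
      refine ⟨hL0.ne', by omega, hL0.ne', by omega, by omega, (Nat.two_pow_pos _).ne', by omega,
        hn0.ne', by omega, ⟨by norm_num, hn0.ne'⟩, by omega, by omega, by omega, by omega, ?_⟩
      intro k' hk' i' hi' hlt
      by_cases he : k' * 2 ^ K + i' = q + 2 ^ K
      · have he' : k' * 2 ^ K + i' = (k + 1) * 2 ^ K + i := by rw [he, hqe]; ring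
        have e1 : k' = k + 1 := by
          have := congrArg (· / 2 ^ K) he'
          simpa [mul_comm _ (2 ^ K), Nat.mul_add_div hL0, Nat.div_eq_of_lt hi',
            Nat.div_eq_of_lt hiL] using this
        have e2 : i' = i := by rw [e1] at he'; omega
        rw [he, e1, e2, fwd, ← hn, ← hc, ← hbased, ← hI1, ← hI2]
        simp [Store.cx, Complex.ext_iff, e5, e6, add_assoc]
      · rw [← hI k' hk' i' hi' (by omega)]
        simp [Store.cx, he])
  rw [hB.r11] at hloop
  refine hloop.mono le_rfl ?_
  intro τ _ _ h k hk i hi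
  refine h k hk i hi ?_
  have := Nat.mul_le_mul_right (2 ^ K) hk
  omega

def squareBody : Cmd :=
  .seq (.iset 14 (.add (.reg 11) (.reg 13)))
    (.seq (.rput 3 (.reg 13) (.sub (.mul (.get 1 (.reg 14)) (.get 1 (.reg 14)))
      (.mul (.get 2 (.reg 14)) (.get 2 (.reg 14)))))
    (.rput 4 (.reg 13) (.add (.mul (.get 1 (.reg 14)) (.get 2 (.reg 14)))
      (.mul (.get 2 (.reg 14)) (.get 1 (.reg 14))))))

/-- Block lengths now grow with the row, and the position inside a double block decides between the
half sum and the half difference. Multiplication by the conjugate root appears as a change of signs.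
-/
def backwardBody : Cmd :=
  .seq (.seq (.seq (.iset 14 (.div (.reg 13) (.reg 10))) (.iset 15 (.mod (.reg 13) (.reg 10))))
    (.seq (.iset 17 (.get 5 (.reg 14)))
    (.seq (.iset 18 (.div (.reg 15) (.mul (.lit 2) (.reg 17))))
    (.seq (.iset 20 (.add (.div (.reg 10) (.reg 17)) (.mul (.lit 2) (.reg 18))))
    (.iset 22 (.add (.reg 13) (.reg 10)))))))
    (.ite (.ilt (.mod (.reg 15) (.mul (.lit 2) (.reg 17))) (.reg 17))
    (.seq (.iset 21 (.add (.reg 13) (.reg 17)))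
      (.seq (.rput 3 (.reg 22) (.div (.add (.get 3 (.reg 13)) (.get 3 (.reg 21))) (.ofInt (.lit 2))))
      (.rput 4 (.reg 22) (.div (.add (.get 4 (.reg 13)) (.get 4 (.reg 21))) (.ofInt (.lit 2))))))
    (.seq (.iset 21 (.sub (.reg 13) (.reg 17)))
      (.seq (.rput 3 (.reg 22) (.div (.add
        (.mul (.sub (.get 3 (.reg 21)) (.get 3 (.reg 13))) (.get 5 (.reg 20)))
        (.mul (.sub (.get 4 (.reg 21)) (.get 4 (.reg 13))) (.get 6 (.reg 20)))) (.ofInt (.lit 2))))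
      (.rput 4 (.reg 22) (.div (.sub
        (.mul (.sub (.get 4 (.reg 21)) (.get 4 (.reg 13))) (.get 5 (.reg 20)))
        (.mul (.sub (.get 3 (.reg 21)) (.get 3 (.reg 13))) (.get 6 (.reg 20)))) (.ofInt (.lit 2)))))))

/-- The inverse transform of the square of the last row of the arrays `1` and `2`. -/
def backward : Cmd := .seq (.for 13 10 squareBody) (.for 13 11 backwardBody)

theorem square_spec (hM : Machine W V) (hσ : Bdd V σ) {K : ℕ}
    (h10 : σ.ireg 10 = 2 ^ K) (h11 : σ.ireg 11 = K * 2 ^ K) (hV : K * 2 ^ K + 2 ^ K ≤ V) :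
    Run W V (.for 13 10 squareBody) σ (2 ^ K * 50 + 5) (fun τ => ∀ i < 2 ^ K,
      τ.cx 3 4 i = σ.cx 1 2 (K * 2 ^ K + i) * σ.cx 1 2 (K * 2 ^ K + i)) := by
  have hloop := Run.for (W := W) (V := V) (x := 13) (r := 10) (σ := σ) (c := squareBody)
    (T := 43) (fun q τ => ∀ i < q,
      τ.cx 3 4 i = σ.cx 1 2 (K * 2 ^ K + i) * σ.cx 1 2 (K * 2 ^ K + i)) hM hσ rfl rfl rfl
    (fun _ _ _ h => h) (by simp) (by
      rw [h10]
      intro q hq τ hτ hF hx hI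
      have e1 : τ.rarr 1 = σ.rarr 1 := hF.rarr 1 rfl
      have e2 : τ.rarr 2 = σ.rarr 2 := hF.rarr 2 rfl
      have e11 : τ.ireg 11 = K * 2 ^ K := (hF.ireg 11 rfl).trans h11
      refine Run.of_wp hM hτ rfl (by decide) ?_
      simp only [squareBody, WP, IExpr.Safe, IExpr.eval, RExpr.Safe, RExpr.eval, hx, e11,
        setIreg_ireg, setIreg_rarr, setRarr_ireg, setRarr_rarr, if_true, true_and,
        and_true, Nat.reduceEqDiff, if_false]
      refine ⟨by omega, ?_⟩
      intro i hi
      by_cases he : i = q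
      · rw [he]
        simp [Store.cx, Complex.ext_iff, e1, e2]
      · rw [← hI i (by omega)]
        simp [Store.cx, he])
  rw [h10] at hloop
  exact hloop

theorem backward_spec [hb : Fact b.Prime] (hM : Machine W V) (hD : Dims b m d V) (hσ : Bdd V σ)
    (hB : Base b m d K σ) :
    Run W V backward σ (2 ^ K * 50 + K * 2 ^ K * 107 + 10) (fun τ => ∃ s : ℕ → ℂ,
      (∀ i < 2 ^ K, s i = σ.cx 1 2 (K * 2 ^ K + i) * σ.cx 1 2 (K * 2 ^ K + i)) ∧
      ∀ k ≤ K, ∀ i < 2 ^ K, τ.cx 3 4 (k * 2 ^ K + i) = bwd K (σ.cx 5 6) s k i) := by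
  have hL0 : 0 < 2 ^ K := Nat.two_pow_pos K
  have hKL : K < 2 ^ K := Nat.lt_two_pow_self
  have hLle := hB.L_le
  have hsq := hD.sq_le
  have hN := hD.N_le
  have hV : 2 * (2 ^ K * 2 ^ K) ≤ V := by nlinarith
  have hV2 : 8 * 2 ^ K ≤ V := by omega
  have hLL : 2 ^ K ≤ 2 ^ K * 2 ^ K := Nat.le_mul_of_pos_left _ hL0
  have hVK : K * 2 ^ K + 2 ^ K ≤ V := by nlinarith
  refine Run.mono (T := (2 ^ K * 50 + 5) + (K * 2 ^ K * (100 + 7) + 5)) ?_ (by omega)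
    fun _ _ _ h => h
  refine Run.seq (square_spec hM hσ hB.r10 hB.r11 hVK) ?_
  intro σ1 hσ1 hF1 hs
  have hB1 := hB.frame hF1 rfl
  have hloop := Run.for (W := W) (V := V) (x := 13) (r := 11) (σ := σ1) (c := backwardBody)
    (T := 100) (fun q τ => ∀ k ≤ K, ∀ i < 2 ^ K, k * 2 ^ K + i < 2 ^ K + q →
      τ.cx 3 4 (k * 2 ^ K + i) = bwd K (σ.cx 5 6) (σ1.cx 3 4) k i) hM hσ1 rfl rfl rfl
    (fun _ _ _ h => h) (by
      intro k _ i hi hlt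
      have : k = 0 := by
        by_contra h
        have := Nat.le_mul_of_pos_left (2 ^ K) (Nat.pos_of_ne_zero h)
        omega
      subst this
      simp [bwd]) (by
      rw [hB1.r11]
      intro q hq τ hτ hF hx hI
      have hBτ := hB1.frame hF rfl
      have e5 : τ.rarr 5 = σ.rarr 5 := by rw [hF.rarr 5 rfl, hF1.rarr 5 rfl]
      have e6 : τ.rarr 6 = σ.rarr 6 := by rw [hF.rarr 6 rfl, hF1.rarr 6 rfl]
      refine Run.of_wp hM hτ rfl (by decide) ?_
      set k := q / 2 ^ K with hk
      set i := q % 2 ^ K with hi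
      have hkK : k < K := by rw [hk, Nat.div_lt_iff_lt_mul hL0]; exact hq
      have hiL : i < 2 ^ K := Nat.mod_lt _ hL0
      have hqe : q = k * 2 ^ K + i := by
        rw [mul_comm]; exact (Nat.div_add_mod q (2 ^ K)).symm
      have hpow := hBτ.pow k (by omega)
      set n := 2 ^ k with hn
      have hn0 : 0 < n := Nat.two_pow_pos _
      have hLn : 2 ^ K = 2 ^ (K - k) * n := by rw [hn, ← pow_add]; congr 1; omega
      have hdivn : 2 ^ K / n = 2 ^ (K - k) := by
        rw [hLn, Nat.mul_div_cancel _ hn0]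
      have hLn2 : 2 ^ K = 2 ^ (K - (k + 1)) * (2 * n) := by
        rw [hn, ← pow_succ', ← pow_add]; congr 1; omega
      set c := i / (2 * n) with hc
      have hcl : c < 2 ^ (K - (k + 1)) := by
        rw [hc, Nat.div_lt_iff_lt_mul (by omega), ← hLn2]; exact hiL
      have hir : i = c * (2 * n) + i % (2 * n) := by
        rw [mul_comm c]; exact (Nat.div_add_mod i (2 * n)).symm
      have hrlt : i % (2 * n) < 2 * n := Nat.mod_lt _ (by omega)
      have hbound : c * (2 * n) + 2 * n ≤ 2 ^ K := by
        rw [hLn2]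
        calc c * (2 * n) + 2 * n = (c + 1) * (2 * n) := by ring
          _ ≤ _ := Nat.mul_le_mul_right _ hcl
      have hcL : 2 * c ≤ 2 ^ K := by nlinarith
      have hKk : 2 ^ (K - k) ≤ 2 ^ K := Nat.pow_le_pow_right (by norm_num) (Nat.sub_le _ _)
      have hI0 := hI k hkK.le i hiL (by omega)
      have hklt : k * 2 ^ K + 2 ^ K ≤ 2 ^ K * 2 ^ K := by
        have := Nat.mul_le_mul_right (2 ^ K) (show k + 1 ≤ 2 ^ K by omega)
        linarith
      have fin : ∀ υ : Store, υ.cx 3 4 (q + 2 ^ K) = bwd K (σ.cx 5 6) (σ1.cx 3 4) (k + 1) i →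
          (∀ j, j ≠ q + 2 ^ K → υ.cx 3 4 j = τ.cx 3 4 j) →
          ∀ k ≤ K, ∀ i < 2 ^ K, k * 2 ^ K + i < 2 ^ K + (q + 1) →
          υ.cx 3 4 (k * 2 ^ K + i) = bwd K (σ.cx 5 6) (σ1.cx 3 4) k i := by
        intro υ h1 h2 k' hk' i' hi' hlt
        by_cases he : k' * 2 ^ K + i' = q + 2 ^ K
        · have he' : k' * 2 ^ K + i' = (k + 1) * 2 ^ K + i := by rw [he, hqe]; ring
          have e1 : k' = k + 1 := by
            have := congrArg (· / 2 ^ K) he'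
            simpa [mul_comm _ (2 ^ K), Nat.mul_add_div hL0, Nat.div_eq_of_lt hi',
              Nat.div_eq_of_lt hiL] using this
          have e2 : i' = i := by rw [e1] at he'; omega
          rw [he, e1, e2, h1]
        · rw [h2 _ he, hI k' hk' i' hi' (by omega)]
      have hne0 : q ≠ q + 2 ^ K := by omega
      simp only [backwardBody, WP, BExpr.Safe, BExpr.Holds, IExpr.Safe, IExpr.eval, RExpr.Safe,
        RExpr.eval, hx,
        setIreg_ireg, setIreg_rarr, setIreg_iarr, setRarr_ireg, setRarr_rarr, if_true, true_and,
        and_true, Nat.reduceEqDiff, if_false, hBτ.r10, ← hk, ← hi, hpow, hdivn, ← hc,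
        Nat.cast_ofNat, if_neg hne0]
      refine ⟨hL0.ne', by omega, hL0.ne', by omega, by omega, by omega, by omega,
        hn0.ne', by omega, by omega, by omega, fun hlt => ?_, fun hge => ?_⟩
      · have hI1 := hI k hkK.le (i + n) (by omega) (by omega)
        have hne2 : q + n ≠ q + 2 ^ K := by omega
        rw [← add_assoc, ← hqe] at hI1
        rw [← hqe] at hI0
        refine ⟨by omega, by norm_num, by norm_num, fin _ ?_ ?_⟩
        · rw [bwd, ← hn, if_pos hlt, ← hI0, ← hI1]
          apply Complex.ext <;> simp [Store.cx]
        · intro j hj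
          simp [Store.cx, hj]
      · have hI1 := hI k hkK.le (i - n) (by omega) (by omega)
        have hin : n ≤ i := by
          rw [not_lt] at hge; exact hge.trans (Nat.mod_le _ _)
        have hne2 : q - n ≠ q + 2 ^ K := by omega
        rw [← Nat.add_sub_assoc hin, ← hqe] at hI1
        rw [← hqe] at hI0
        refine ⟨by omega, by norm_num, by norm_num, fin _ ?_ ?_⟩
        · rw [bwd, ← hn, if_neg hge, ← hI0, ← hI1, ← hc]
          apply Complex.ext <;> simp [Store.cx, hne2, e5, e6]; ring
        · intro j hj
          simp [Store.cx, hj])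
  rw [hB1.r11] at hloop
  refine hloop.mono le_rfl ?_
  intro τ _ _ h
  refine ⟨σ1.cx 3 4, hs, fun k hk i hi => h k hk i hi ?_⟩
  have := Nat.mul_le_mul_right (2 ^ K) hk
  omega

end

end RealRAM

/-! ## The component-by-component loop -/

namespace PolyLattice

/-- The value `(1 - b) ⌊log_b x⌋ - b` at a point `x` of the lattice that belongs to the remainder
with code `y`. -/
noncomputable def kernelValue (b m y : ℕ) : ℝ :=
  (((b - 1) * (m + 1 - (Nat.digits b y).length) : ℕ) : ℝ) - b

/-- The kernel values, ordered by the powers of a generator with codes `E`. -/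
noncomputable def cyclicKernel (b m : ℕ) (E : ℕ → ℕ) (i : ℕ) : ℝ :=
  kernelValue b m (E (i % (b ^ m - 1)))

/-- The products `∏_{k ≤ s} (1 + γ_k ψ(i + J_k))`. -/
noncomputable def weightProd (ψ γ : ℕ → ℝ) (J : ℕ → ℕ) (s i : ℕ) : ℝ :=
  ∏ k ∈ Finset.Icc 1 s, (1 + γ k * ψ (i + J k))

/-- The cyclic correlation that is minimized in a step of the construction. -/
noncomputable def objective (n : ℕ) (ψ γ : ℕ → ℝ) (J : ℕ → ℕ) (s t : ℕ) : ℝ :=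
  ∑ i ∈ Finset.range n, weightProd ψ γ J s i * ψ (i + t)

theorem weightProd_congr {ψ γ : ℕ → ℝ} {J J' : ℕ → ℕ} {s : ℕ} (h : ∀ k ≤ s, J k = J' k) (i : ℕ) :
    weightProd ψ γ J s i = weightProd ψ γ J' s i :=
  Finset.prod_congr rfl fun k hk => by rw [h k (Finset.mem_Icc.1 hk).2]

theorem objective_congr {n : ℕ} {ψ γ : ℕ → ℝ} {J J' : ℕ → ℕ} {s : ℕ} (h : ∀ k ≤ s, J k = J' k)
    (t : ℕ) : objective n ψ γ J s t = objective n ψ γ J' s t :=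
  Finset.sum_congr rfl fun i _ => by rw [weightProd_congr h]

theorem weightProd_succ (ψ γ : ℕ → ℝ) (J : ℕ → ℕ) (s i : ℕ) :
    weightProd ψ γ J (s + 1) i = weightProd ψ γ J s i * (1 + γ (s + 1) * ψ (i + J (s + 1))) :=
  Finset.prod_Icc_succ_top (by omega) _

/-- The correlation of two real sequences as the imaginary part of the square of one complex
convolution. -/
theorem im_cconv_eq {L n t : ℕ} {f : ℕ → ℂ} {a ψ : ℕ → ℝ} (hL : 2 * n ≤ L) (ht : t < n)
    (hre : ∀ u < L, (f u).re = if u < n then a (n - 1 - u) else 0)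
    (him : ∀ u < L, (f u).im = ψ u) :
    (cconv L f f (n - 1 + t)).im = 2 * ∑ i ∈ Finset.range n, a i * ψ (i + t) := by
  set q := n - 1 + t with hq
  have hqL : q < L := by omega
  have hL0 : 0 < L := by omega
  have hmod : ∀ u < L, (q + L - u) % L = if u ≤ q then q - u else q + L - u := by
    intro u hu
    split_ifs with h
    · rw [show q + L - u = q - u + L by omega, Nat.add_mod_right, Nat.mod_eq_of_lt (by omega)]
    · exact Nat.mod_eq_of_lt (by omega)
  -- The involution `u ↦ q - u` modulo `L` exchanges the two cross terms of the imaginary part,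
  -- whence the factor `2`.
  have hsymm : ∑ u ∈ Finset.range L, (f u).im * (f ((q + L - u) % L)).re =
      ∑ u ∈ Finset.range L, (f u).re * (f ((q + L - u) % L)).im := by
    have hmem : ∀ u ∈ Finset.range L, (q + L - u) % L ∈ Finset.range L := fun u _ =>
      Finset.mem_range.2 (Nat.mod_lt _ hL0)
    have hinv : ∀ u ∈ Finset.range L, (q + L - (q + L - u) % L) % L = u := by
      intro u hu
      rw [Finset.mem_range] at hu
      have h1 : (q + L - u) % L < L := Nat.mod_lt _ hL0
      rw [hmod _ h1, hmod u hu]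
      split_ifs <;> omega
    refine Finset.sum_bij' (fun u _ => (q + L - u) % L) (fun u _ => (q + L - u) % L) hmem hmem
      hinv hinv ?_
    intro u hu
    rw [hinv u hu, mul_comm]
  have h1 : (cconv L f f q).im = 2 * ∑ u ∈ Finset.range L, (f u).re * (f ((q + L - u) % L)).im := by
    rw [cconv, Complex.im_sum]
    simp only [Complex.mul_im]
    rw [Finset.sum_add_distrib, hsymm, two_mul]
  rw [h1, ← Finset.sum_range_reflect (fun i => a i * ψ (i + t))]
  congr 1
  -- The real parts vanish for `u ≥ n`. For `u < n` there is no wraparound, and `q - u = (n - 1 - u)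
  -- + t` is the shifted index of the correlation.
  rw [← Finset.sum_subset (Finset.range_subset_range.2 (show n ≤ L by omega))]
  · refine Finset.sum_congr rfl fun u hu => ?_
    rw [Finset.mem_range] at hu
    rw [hre u (by omega), if_pos hu, hmod u (by omega), if_pos (by omega), him _ (by omega)]
    congr 2
    omega
  · intro u hu hu'
    rw [Finset.mem_range] at hu hu'
    rw [hre u hu, if_neg hu', zero_mul]

end PolyLattice

/-! ### Kernel tables and the steps of the construction as programs. -/

namespace RealRAM

open Polynomial PolyLattice

/-- The numbers of digits of the codes. -/
def lengthTable : Cmd :=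
  .for 13 4 (.iput 10 (.add (.reg 13) (.lit 1))
    (.add (.get 10 (.div (.add (.reg 13) (.lit 1)) (.reg 0))) (.lit 1)))

/-- The kernel values and the empty products. -/
def kernelTable : Cmd :=
  .for 13 10 (.seq
    (.rput 2 (.reg 13) (.sub (.ofInt (.mul (.sub (.reg 0) (.lit 1)) (.sub (.add (.reg 1) (.lit 1))
      (.get 10 (.get 6 (.mod (.reg 13) (.reg 5))))))) (.ofInt (.reg 0))))
    (.ite (.ilt (.reg 13) (.reg 5)) (.rput 1 (.reg 13) (.ofInt (.lit 1)))
      (.rput 1 (.reg 13) (.ofInt (.lit 0)))))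

section
variable {W V b m d K : ℕ} {σ : Store} [hb : Fact b.Prime]

theorem lengthTable_spec (hM : Machine W V) (hD : Dims b m d V) (hσ : Bdd V σ)
    (hB : Base b m d K σ) (h0 : σ.iarr 10 0 = 0) :
    Run W V lengthTable σ (b ^ m * 20 + 5) (fun τ => ∀ y < b ^ m,
      τ.iarr 10 y = (Nat.digits b y).length) := by
  have hN := hD.N_le
  have hb2 := hb.out.two_le
  have hloop := Run.for (W := W) (V := V) (x := 13) (r := 4) (σ := σ) (T := 13)
    (c := .iput 10 (.add (.reg 13) (.lit 1))
      (.add (.get 10 (.div (.add (.reg 13) (.lit 1)) (.reg 0))) (.lit 1)))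
    (fun i τ => ∀ y ≤ i, τ.iarr 10 y = (Nat.digits b y).length) hM hσ rfl rfl rfl
    (fun _ _ _ h => h) (by
      intro y hy
      obtain rfl : y = 0 := by omega
      simp [h0]) (by
      rw [hB.r4]
      intro i hi τ hτ hF hx hI
      have hr0 := (hB.frame hF rfl).r0
      have hdiv : (i + 1) / b < i + 1 := Nat.div_lt_self (by omega) hb2
      have h1 := hI ((i + 1) / b) (by omega)
      have h2 : (Nat.digits b (i + 1)).length = (Nat.digits b ((i + 1) / b)).length + 1 := by
        rw [Nat.digits_def' (by omega) (by omega), List.length_cons]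
      have h3 : (Nat.digits b ((i + 1) / b)).length ≤ m := by
        rw [Nat.digits_length_le_iff (by omega)]
        omega
      have h4 := hD.m_lt
      refine Run.of_wp hM hτ rfl (by decide) ?_
      simp only [WP, IExpr.Safe, IExpr.eval, hx, hr0, setIarr_iarr, if_true, true_and, and_true, h1]
      refine ⟨by omega, by omega, ?_⟩
      intro y hy
      split_ifs with h
      · rw [h, h2]
      · exact hI y (by omega))
  rw [hB.r4] at hloop
  exact hloop.mono le_rfl fun τ _ _ h y hy => h y hy.le

theorem kernelTable_spec (hM : Machine W V) (hD : Dims b m d V) (hσ : Bdd V σ)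
    (hB : Base b m d K σ) (hE : ∀ i < b ^ m, σ.iarr 6 i < b ^ m)
    (hlen : ∀ y < b ^ m, σ.iarr 10 y = (Nat.digits b y).length) :
    Run W V kernelTable σ (2 ^ K * 40 + 5) (fun τ => ∀ i < 2 ^ K,
      τ.rarr 2 i = cyclicKernel b m (σ.iarr 6) i ∧
      τ.rarr 1 i = if i < b ^ m - 1 then 1 else 0) := by
  have h2 := hD.two_le
  have hloop := Run.for (W := W) (V := V) (x := 13) (r := 10) (σ := σ) (T := 33)
    (c := .seq
      (.rput 2 (.reg 13) (.sub (.ofInt (.mul (.sub (.reg 0) (.lit 1))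
        (.sub (.add (.reg 1) (.lit 1))
        (.get 10 (.get 6 (.mod (.reg 13) (.reg 5))))))) (.ofInt (.reg 0))))
      (.ite (.ilt (.reg 13) (.reg 5)) (.rput 1 (.reg 13) (.ofInt (.lit 1)))
        (.rput 1 (.reg 13) (.ofInt (.lit 0)))))
    (fun q τ => ∀ i < q, τ.rarr 2 i = cyclicKernel b m (σ.iarr 6) i ∧
      τ.rarr 1 i = if i < b ^ m - 1 then 1 else 0) hM hσ rfl rfl rfl
    (fun _ _ _ h => h) (by simp) (by
      rw [hB.r10]
      intro q hq τ hτ hF hx hI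
      have hBτ := hB.frame hF rfl
      have e6 : τ.iarr 6 = σ.iarr 6 := hF.iarr 6 rfl
      have e10 : τ.iarr 10 = σ.iarr 10 := hF.iarr 10 rfl
      have hmod : q % (b ^ m - 1) < b ^ m - 1 := Nat.mod_lt _ (by omega)
      have hval := hlen _ (hE (q % (b ^ m - 1)) (by omega))
      refine Run.of_wp hM hτ rfl (by decide) ?_
      simp only [WP, BExpr.Safe, BExpr.Holds, IExpr.Safe, IExpr.eval, RExpr.Safe, RExpr.eval, hx,
        hBτ.r0, hBτ.r1, hBτ.r5, e6, e10, hval, setRarr_ireg, setRarr_rarr, if_true, true_and,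
        and_true, Nat.reduceEqDiff, if_false]
      refine ⟨by omega, fun hlt i hi => ?_, fun hlt i hi => ?_⟩
      all_goals
        by_cases he : i = q
        · subst he
          simp [cyclicKernel, kernelValue, hlt]
        · simp only [if_neg he]
          exact hI i (by omega))
  rw [hB.r10] at hloop
  exact hloop

/-- Searches for the exponent of the next component. -/
def searchExponent : Cmd :=
  -- Register `23` is the number of finished components. While it is `0` the exponent stays `0`, so
  -- the first component is `ζ ^ 0 = 1`.
  .seq (.iset 24 (.lit 0)) (.for 13 5 (.ite
    (.and (.ilt (.lit 0) (.reg 23))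
      (.not (.rle (.get 4 (.add (.reg 11) (.add (.sub (.reg 5) (.lit 1)) (.reg 24))))
        (.get 4 (.add (.reg 11) (.add (.sub (.reg 5) (.lit 1)) (.reg 13)))))))
    (.iset 24 (.reg 13)) .skip))

theorem searchExponent_spec (hM : Machine W V) (hD : Dims b m d V) (hσ : Bdd V σ)
    (hB : Base b m d K σ) :
    Run W V searchExponent σ (b ^ m * 40 + 10) (fun τ => τ.ireg 24 < b ^ m - 1 ∧
      (σ.ireg 23 = 0 → τ.ireg 24 = 0) ∧ (0 < σ.ireg 23 → ∀ t < b ^ m - 1,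
        σ.rarr 4 (K * 2 ^ K + (b ^ m - 1 - 1 + τ.ireg 24)) ≤
          σ.rarr 4 (K * 2 ^ K + (b ^ m - 1 - 1 + t)))) := by
  have h2 := hD.two_le
  have hN := hD.N_le
  refine Run.mono (T := 2 + ((b ^ m - 1) * (30 + 7) + 5)) ?_ (by omega) fun _ _ _ h => h
  refine Run.seq (Q := fun τ => τ = σ.setIreg 24 0) (Run.of_wp hM hσ rfl (by decide)
    (by simp [WP, IExpr.Safe, IExpr.eval]; omega)) ?_
  rintro σ1 hσ1 hF1 rfl
  have hB1 := hB.frame hF1 rfl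
  have hloop := Run.for (W := W) (V := V) (x := 13) (r := 5) (σ := σ.setIreg 24 0) (T := 30)
    (c := .ite
      (.and (.ilt (.lit 0) (.reg 23))
        (.not (.rle (.get 4 (.add (.reg 11) (.add (.sub (.reg 5) (.lit 1)) (.reg 24))))
          (.get 4 (.add (.reg 11) (.add (.sub (.reg 5) (.lit 1)) (.reg 13)))))))
      (.iset 24 (.reg 13)) .skip)
    (fun i τ => τ.ireg 24 < b ^ m - 1 ∧ (σ.ireg 23 = 0 → τ.ireg 24 = 0) ∧
      (0 < σ.ireg 23 → ∀ t < i, σ.rarr 4 (K * 2 ^ K + (b ^ m - 1 - 1 + τ.ireg 24)) ≤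
          σ.rarr 4 (K * 2 ^ K + (b ^ m - 1 - 1 + t)))) hM hσ1 rfl rfl rfl
    (fun i τ v h => by simpa using h) (by simp; omega) (by
      rw [hB1.r5]
      rintro i hi τ hτ hF hx ⟨I1, I2, I3⟩
      have hBτ := hB1.frame hF rfl
      have e4 : τ.rarr 4 = σ.rarr 4 := hF.rarr 4 rfl
      have e23 : τ.ireg 23 = σ.ireg 23 := by simpa using hF.ireg 23 rfl
      refine Run.of_wp hM hτ rfl (by decide) ?_
      simp only [WP, BExpr.Safe, BExpr.Holds, IExpr.Safe, IExpr.eval, RExpr.Safe, RExpr.eval, hx,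
        hBτ.r5, hBτ.r11, e4, e23, setIreg_ireg, if_true, true_and, and_true, not_and, not_le]
      refine ⟨?_, ?_⟩
      · rintro ⟨h0, h1⟩
        refine ⟨by omega, hi, fun h => by omega, fun _ t ht => ?_⟩
        rcases Nat.lt_or_ge t i with h | h
        · exact h1.le.trans (I3 h0 t h)
        · obtain rfl : t = i := by omega
          exact le_rfl
      · intro h1
        refine ⟨I1, I2, fun h0 t ht => ?_⟩
        rcases Nat.lt_or_ge t i with h | h
        · exact I3 h0 t h
        · obtain rfl : t = i := by omega
          exact not_lt.1 (h1 h0))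
  rw [hB1.r5] at hloop
  exact hloop

/-- Multiplies the products by the factors of the new component. -/
def updateProducts : Cmd :=
  .for 13 5 (.rput 1 (.reg 13) (.mul (.get 1 (.reg 13)) (.add (.ofInt (.lit 1))
    (.mul (.get 0 (.add (.reg 23) (.lit 1)))
      -- The products are stored in reverse order, so cell `u` needs the kernel at `N - 2 - u` plus
      -- the new exponent.
      (.get 2 (.add (.sub (.sub (.reg 5) (.lit 1)) (.reg 13)) (.reg 24)))))))

omit hb in
theorem updateProducts_spec (hM : Machine W V) (hσ : Bdd V σ) (hB : Base b m d K σ) :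
    Run W V updateProducts σ (b ^ m * 40 + 5) (fun τ => ∀ u, τ.rarr 1 u =
      if u < b ^ m - 1 then σ.rarr 1 u * (1 + σ.rarr 0 (σ.ireg 23 + 1) *
        σ.rarr 2 (b ^ m - 1 - 1 - u + σ.ireg 24)) else σ.rarr 1 u) := by
  have hloop := Run.for (W := W) (V := V) (x := 13) (r := 5) (σ := σ) (T := 33)
    (c := .rput 1 (.reg 13) (.mul (.get 1 (.reg 13)) (.add (.ofInt (.lit 1))
      (.mul (.get 0 (.add (.reg 23) (.lit 1)))
        (.get 2 (.add (.sub (.sub (.reg 5) (.lit 1)) (.reg 13)) (.reg 24)))))))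
    (fun i τ => ∀ u, τ.rarr 1 u =
      if u < i then σ.rarr 1 u * (1 + σ.rarr 0 (σ.ireg 23 + 1) *
        σ.rarr 2 (b ^ m - 1 - 1 - u + σ.ireg 24)) else σ.rarr 1 u) hM hσ rfl rfl rfl
    (fun _ _ _ h => h) (by simp) (by
      intro i hi τ hτ hF hx hI
      have hBτ := hB.frame hF rfl
      have e0 : τ.rarr 0 = σ.rarr 0 := hF.rarr 0 rfl
      have e2 : τ.rarr 2 = σ.rarr 2 := hF.rarr 2 rfl
      have e23 : τ.ireg 23 = σ.ireg 23 := hF.ireg 23 rfl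
      have e24 : τ.ireg 24 = σ.ireg 24 := hF.ireg 24 rfl
      refine Run.of_wp hM hτ rfl (by decide) ?_
      simp only [WP, IExpr.Safe, IExpr.eval, RExpr.Safe, RExpr.eval, hx,
        hBτ.r5, e0, e2, e23, e24, setRarr_rarr, if_true, true_and, and_true]
      intro u
      by_cases he : u = i
      · subst he
        simp [hI]
      · rw [if_neg he, hI u]
        have : u < i + 1 ↔ u < i := by omega
        simp only [this])
  rw [hB.r5] at hloop
  exact hloop.mono (by
    have : (b ^ m - 1) * (33 + 7) ≤ b ^ m * 40 := Nat.mul_le_mul_right _ (Nat.sub_le _ _)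
    omega) fun _ _ _ h => h

end

end RealRAM

namespace RealRAM

open Polynomial PolyLattice

/-- One step of the component-by-component construction. -/
def component : Cmd :=
  .seq forward (.seq backward (.seq searchExponent
    (.seq (.seq (.iput 11 (.add (.reg 23) (.lit 1)) (.reg 24))
      (.iput 0 (.add (.reg 23) (.lit 1)) (.get 6 (.reg 24)))) updateProducts)))

/-- The component-by-component construction. -/
def components : Cmd := .for 23 2 component

/-- The state after the construction of `s` components: the exponents are in array `11`, the
components in array `0`, and the products are in reverse order in the real array `1`. -/
structure CBCState (b m K : ℕ) (γ ψ : ℕ → ℝ) (E : ℕ → ℕ) (s : ℕ) (τ : Store) : Prop where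
  exponent_lt : ∀ k, 1 ≤ k → k ≤ s → τ.iarr 11 k < b ^ m - 1
  exponent_one : 1 ≤ s → τ.iarr 11 1 = 0
  code : ∀ k, 1 ≤ k → k ≤ s → τ.iarr 0 k = E (τ.iarr 11 k)
  le : ∀ k, 2 ≤ k → k ≤ s → ∀ t < b ^ m - 1,
    objective (b ^ m - 1) ψ γ (τ.iarr 11) (k - 1) (τ.iarr 11 k) ≤
      objective (b ^ m - 1) ψ γ (τ.iarr 11) (k - 1) t
  kernel : ∀ i < 2 ^ K, τ.rarr 2 i = ψ i
  prod : ∀ u < 2 ^ K, τ.rarr 1 u =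
    if u < b ^ m - 1 then weightProd ψ γ (τ.iarr 11) s (b ^ m - 1 - 1 - u) else 0

section
variable {W V b m d K : ℕ} {σ : Store} [hb : Fact b.Prime] {γ ψ : ℕ → ℝ} {E : ℕ → ℕ}

/-- The products and the kernel form row `0` of the forward transform and are not overwritten by it,
so they serve again in the next step. The last row of the inverse transform contains twice the
objective in its imaginary part, from index `N - 2` on. -/
theorem component_spec (hM : Machine W V) (hD : Dims b m d V) (hσ : Bdd V σ)
    (hB : Base b m d K σ) (hw : RootTree (2 ^ K) (σ.cx 5 6)) (hE : σ.iarr 6 = E)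
    {s : ℕ} (hs : s < d) (h23 : σ.ireg 23 = s)
    (hγ : σ.rarr 0 (s + 1) = γ (s + 1)) (hI : CBCState b m K γ ψ E s σ) :
    Run W V component σ (K * 2 ^ K * 214 + 2 ^ K * 50 + b ^ m * 80 + 100)
      (CBCState b m K γ ψ E (s + 1)) := by
  have h2 := hD.two_le
  have hN := hD.N_le
  have hd := hD.d_le
  have hsd : s + 1 ≤ d := hs
  have hL := hB.le_L
  have hL0 : 0 < 2 ^ K := Nat.two_pow_pos K
  refine Run.mono (T := (K * 2 ^ K * 107 + 5) + ((2 ^ K * 50 + K * 2 ^ K * 107 + 10) +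
    ((b ^ m * 40 + 10) + (20 + (b ^ m * 40 + 5))))) ?_ (by omega) fun _ _ _ h => h
  refine Run.seq (forward_spec hM hD hσ hB) ?_
  intro σ1 hσ1 hF1 h1
  have hB1 := hB.frame hF1 rfl
  refine Run.seq (backward_spec hM hD hσ1 hB1) ?_
  rintro σ2 hσ2 hF2 ⟨v, hv, hv2⟩
  have hB2 := hB1.frame hF2 rfl
  have hrow : ∀ i < 2 ^ K, σ1.cx 1 2 i = σ.cx 1 2 i := fun i hi => by
    simpa [fwd] using h1 0 (Nat.zero_le _) i hi
  have hcx : σ1.cx 5 6 = σ.cx 5 6 := by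
    unfold Store.cx; rw [hF1.rarr 5 rfl, hF1.rarr 6 rfl]
  have hconv : ∀ t < b ^ m - 1, σ2.rarr 4 (K * 2 ^ K + (b ^ m - 1 - 1 + t)) =
      2 * objective (b ^ m - 1) ψ γ (σ.iarr 11) s t := by
    intro t ht
    have e1 := hv2 K le_rfl (b ^ m - 1 - 1 + t) (by omega)
    rw [hcx, bwd_sq_fwd hw (σ.cx 1 2) (by omega) fun i hi => by rw [hv i hi, h1 K le_rfl i hi]] at e1
    have e2 := im_cconv_eq (L := 2 ^ K) (f := σ.cx 1 2)
      (a := weightProd ψ γ (σ.iarr 11) s) (ψ := ψ) (by omega) ht hI.prod hI.kernel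
    rw [← e1] at e2
    exact e2
  refine Run.seq (searchExponent_spec hM hD hσ2 hB2) ?_
  rintro σ3 hσ3 hF3 ⟨g1, g2, g3⟩
  have hB3 := hB2.frame hF3 rfl
  have e23 : σ2.ireg 23 = s := by rw [hF2.ireg 23 rfl, hF1.ireg 23 rfl, h23]
  have e23' : σ3.ireg 23 = s := by rw [hF3.ireg 23 rfl, e23]
  have e11 : σ3.iarr 11 = σ.iarr 11 := by
    rw [hF3.iarr 11 rfl, hF2.iarr 11 rfl, hF1.iarr 11 rfl]
  have e0 : σ3.iarr 0 = σ.iarr 0 := by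
    rw [hF3.iarr 0 rfl, hF2.iarr 0 rfl, hF1.iarr 0 rfl]
  have e6 : σ3.iarr 6 = E := by
    rw [hF3.iarr 6 rfl, hF2.iarr 6 rfl, hF1.iarr 6 rfl, hE]
  rw [e23] at g2 g3
  set j := σ3.ireg 24 with hj
  have hEV : E j < V := by rw [← e6]; exact hσ3.iarr 6 j
  refine Run.seq (Q := fun τ => τ = (σ3.setIarr 11 (s + 1) j).setIarr 0 (s + 1) (E j))
    (Run.of_wp hM hσ3 rfl (by decide) (by
      simp [WP, IExpr.Safe, IExpr.eval, e23', e6, ← hj]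
      omega)) ?_
  rintro σ4 hσ4 hF4 rfl
  have hB4 := hB3.frame hF4 rfl
  refine Run.mono (updateProducts_spec hM hσ4 hB4) le_rfl ?_
  rintro τ hτ hF5 hu
  have t11 : ∀ k, τ.iarr 11 k = if k = s + 1 then j else σ.iarr 11 k := by
    intro k; rw [hF5.iarr 11 rfl]; simp [e11]
  have t0 : ∀ k, τ.iarr 0 k = if k = s + 1 then E j else σ.iarr 0 k := by
    intro k; rw [hF5.iarr 0 rfl]; simp [e0]
  have hne : ∀ k ≤ s, τ.iarr 11 k = σ.iarr 11 k := fun k hk => by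
    rw [t11, if_neg (by omega)]
  have hself : τ.iarr 11 (s + 1) = j := by rw [t11, if_pos rfl]
  have r2 : ∀ i < 2 ^ K, σ3.rarr 2 i = ψ i := by
    intro i hi
    rw [hF3.rarr 2 rfl, hF2.rarr 2 rfl, ← hI.kernel i hi]
    exact (Complex.ext_iff.1 (hrow i hi)).2
  have r1 : ∀ i < 2 ^ K, σ3.rarr 1 i = σ.rarr 1 i := by
    intro i hi
    rw [hF3.rarr 1 rfl, hF2.rarr 1 rfl]
    exact (Complex.ext_iff.1 (hrow i hi)).1
  have r0 : σ3.rarr 0 (s + 1) = γ (s + 1) := by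
    rw [hF3.rarr 0 rfl, hF2.rarr 0 rfl, hF1.rarr 0 rfl, hγ]
  refine ⟨?_, ?_, ?_, ?_, ?_, ?_⟩
  · intro k hk hk'
    rw [t11]
    split_ifs with h
    · exact g1
    · exact hI.exponent_lt k hk (by omega)
  · intro _
    rw [t11]
    split_ifs with h
    · exact g2 (by omega)
    · exact hI.exponent_one (by omega)
  · intro k hk hk'
    rw [t11, t0]
    split_ifs with h
    · rfl
    · exact hI.code k hk (by omega)
  · intro k hk hk' t ht
    -- Only the exponent with index `s + 1` is new, and the objective of step `k ≤ s + 1` involves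
    -- exponents up to `k - 1 ≤ s`.
    rw [objective_congr (J' := σ.iarr 11) fun i hi => hne i (by omega),
      objective_congr (J' := σ.iarr 11) fun i hi => hne i (by omega)]
    rcases Nat.lt_or_ge s k with h | h
    · obtain rfl : k = s + 1 := by omega
      have := g3 (by omega) t ht
      rw [hconv t ht, hconv j g1] at this
      rw [hself, Nat.add_sub_cancel]
      linarith
    · rw [hne k h]
      exact hI.le k hk h t ht
  · intro i hi
    rw [hF5.rarr 2 rfl]
    exact r2 i hi
  · intro u hu'
    rw [hu u]
    simp only [setIarr_rarr, setIarr_ireg, e23', r0, ← hj, r1 u hu', hI.prod u hu']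
    split_ifs with h
    · rw [r2 _ (by omega), weightProd_succ, hself, weightProd_congr hne]
    · rfl

theorem components_spec (hM : Machine W V) (hD : Dims b m d V) (hσ : Bdd V σ)
    (hB : Base b m d K σ) (hw : RootTree (2 ^ K) (σ.cx 5 6)) (hE : σ.iarr 6 = E)
    (hγ : ∀ s, 1 ≤ s → s ≤ d → σ.rarr 0 s = γ s) (hI : CBCState b m K γ ψ E 0 σ) :
    Run W V components σ (d * (K * 2 ^ K * 214 + 2 ^ K * 50 + b ^ m * 80 + 107) + 5)
      (CBCState b m K γ ψ E d) := by
  have hloop := Run.for (W := W) (V := V) (x := 23) (r := 2) (σ := σ) (c := component)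
    (T := K * 2 ^ K * 214 + 2 ^ K * 50 + b ^ m * 80 + 100)
    (CBCState b m K γ ψ E) hM hσ rfl rfl rfl
    (fun _ _ _ h => ⟨h.1, h.2, h.3, h.4, h.5, h.6⟩) hI (by
      rw [hB.r2]
      intro s hs τ hτ hF hx hI
      refine component_spec hM hD hτ (hB.frame hF rfl) ?_ ?_ hs hx ?_ hI
      · unfold Store.cx at hw ⊢
        rw [hF.rarr 5 rfl, hF.rarr 6 rfl]
        exact hw
      · rw [hF.iarr 6 rfl, hE]
      · rw [hF.rarr 0 rfl]
        exact hγ (s + 1) (by omega) (by omega))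
  rw [hB.r2] at hloop
  exact hloop

end

end RealRAM

/-! ## The programs -/

namespace RealRAM

open Polynomial PolyLattice

/-- The construction of a generating vector for the modulus in register `3`. -/
def construct : Cmd :=
  .seq initRed (.seq findGenerator (.seq lengthTable (.seq kernelTable (.seq roots components))))

/-- The construction for a prescribed modulus. -/
def constructPrescribed : Cmd := .seq setup construct

/-- The construction with a modulus of its own. -/
def constructOwn : Cmd :=
  .seq setup (.seq findModulus (.seq construct (.iset 0 (.reg 3))))

section
variable {W V b m d K : ℕ} {σ : Store} [hb : Fact b.Prime] {γ : ℕ → ℝ} {p : (ZMod b)[X]}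

/-- The result of the construction: powers of a generator modulo `p` in array `6`, and a generating
vector in array `0`. -/
def Constructed (b m d : ℕ) [Fact b.Prime] (γ : ℕ → ℝ) (p : (ZMod b)[X]) (τ : Store) : Prop :=
  ∃ (K : ℕ) (ζ : AdjoinRoot p), orderOf ζ = b ^ m - 1 ∧ PowTab (AdjoinRoot.mk p) m ζ 6 τ ∧
    CBCState b m K γ (cyclicKernel b m (τ.iarr 6)) (τ.iarr 6) d τ

theorem construct_spec (hM : Machine W V) (hD : Dims b m d V) (hσ : Bdd V σ)
    (hB : Base b m d K σ) (h3 : digitPoly b (σ.ireg 3) = p) (hirr : Irreducible p)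
    (hdeg : p.natDegree = m) (h8 : ∀ y, σ.iarr 8 y = 0) (h10 : σ.iarr 10 0 = 0)
    (hγ : ∀ s, 1 ≤ s → s ≤ d → σ.rarr 0 s = γ s) :
    Run W V construct σ (d * (K * b ^ m) * 4000) (Constructed b m d γ p) := by
  have : Fact (Irreducible p) := ⟨hirr⟩
  have h2 := hD.two_le
  have hN := hD.N_le
  have hL := hB.le_L
  have hL4 := hB.L_le
  have hK : 1 ≤ K := by
    by_contra h
    obtain rfl : K = 0 := by omega
    simp at hL
    omega
  refine Run.mono (T := b ^ m * 300 + ((K * (b ^ m * 1300) + b ^ m * 400) + ((b ^ m * 20 + 5) +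
    ((2 ^ K * 40 + 5) + ((2 ^ K * 100 + 20) +
      (d * (K * 2 ^ K * 214 + 2 ^ K * 50 + b ^ m * 80 + 107) + 5)))))) ?_ ?_ fun _ _ _ h => h
  swap
  -- All costs are absorbed into `d K N`, using `2 ^ K ≤ 4 N`, `1 ≤ K` and `1 ≤ d`.
  · have e1 : K * 2 ^ K ≤ 4 * (K * b ^ m) := by nlinarith
    have e2 : b ^ m ≤ K * b ^ m := Nat.le_mul_of_pos_left _ hK
    have e3 : K * b ^ m ≤ d * (K * b ^ m) := Nat.le_mul_of_pos_left _ hD.one_le_d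
    have e4 : d * (K * 2 ^ K * 214 + 2 ^ K * 50 + b ^ m * 80 + 107) ≤
        d * (K * b ^ m * 1190) := Nat.mul_le_mul_left _ (by omega)
    have e5 : d * (K * b ^ m * 1190) = d * (K * b ^ m) * 1190 := by ring
    have e6 : K * (b ^ m * 1300) = K * b ^ m * 1300 := by ring
    omega
  subst h3
  refine Run.seq (initRed_spec hM hD hσ hB hdeg) ?_
  intro σ1 hσ1 hF1 hR
  have hB1 := hB.frame hF1 rfl
  refine Run.seq (findGenerator_spec hM hD hσ1 hB1 hdeg hR
    (by rw [hF1.iarr 8 rfl]; exact h8)) ?_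
  rintro σ2 hσ2 hF2 ⟨ζ, hζ, hP⟩
  have hB2 := hB1.frame hF2 rfl
  refine Run.seq (lengthTable_spec hM hD hσ2 hB2
    (by rw [hF2.iarr 10 rfl, hF1.iarr 10 rfl]; exact h10)) ?_
  intro σ3 hσ3 hF3 hlen
  have hB3 := hB2.frame hF3 rfl
  have e63 : σ3.iarr 6 = σ2.iarr 6 := hF3.iarr 6 rfl
  refine Run.seq (kernelTable_spec hM hD hσ3 hB3
    (fun i hi => by rw [e63]; exact (hP i hi.le).1) hlen) ?_
  intro σ4 hσ4 hF4 hker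
  have hB4 := hB3.frame hF4 rfl
  refine Run.seq (roots_spec hM hσ4 hB4.r10 (by omega)) ?_
  intro σ5 hσ5 hF5 hw
  have hB5 := hB4.frame hF5 rfl
  have e65 : σ5.iarr 6 = σ2.iarr 6 := by rw [hF5.iarr 6 rfl, hF4.iarr 6 rfl, e63]
  refine Run.mono (components_spec (γ := γ) (ψ := cyclicKernel b m (σ2.iarr 6))
    (E := σ2.iarr 6) hM hD hσ5 hB5 hw e65 ?_ ?_) le_rfl ?_
  · intro s hs hs'
    rw [hF5.rarr 0 rfl, hF4.rarr 0 rfl, hF3.rarr 0 rfl, hF2.rarr 0 rfl, hF1.rarr 0 rfl]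
    exact hγ s hs hs'
  · refine ⟨by omega, by omega, by omega, by omega, fun i hi => ?_, fun u hu => ?_⟩
    · rw [hF5.rarr 2 rfl, (hker i hi).1, e63]
    · rw [hF5.rarr 1 rfl, (hker u hu).2]
      simp [weightProd]
  · intro τ _ hF6 h
    have e6 : τ.iarr 6 = σ2.iarr 6 := by rw [hF6.iarr 6 rfl, e65]
    refine ⟨K, ζ, hζ, ?_, by rw [e6]; exact h⟩
    unfold PowTab
    rw [e6]
    exact hP

/-- The bound `32 d N²` for the integers that occur. -/
def wordBound (b m d : ℕ) : ℕ := 32 * (d * (b ^ m) ^ 2)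

omit hb in
theorem dims_wordBound (hm : 1 ≤ m) (hd : 1 ≤ d) : Dims b m d (wordBound b m d) :=
  ⟨hm, hd, le_rfl⟩

/-- As `d N ≥ 2`, the factor `32 = 2 ^ 5` is at most `(d N) ^ 5`. Hence `V ≤ (d N) ^ 7`, and eighth
powers stay below `(d N) ^ 56`. -/
theorem machine_wordBound (hm : 1 ≤ m) (hd : 1 ≤ d) {C : ℕ} (hC : 56 ≤ C) :
    Machine ((d * b ^ m) ^ C) (wordBound b m d) := by
  have h2 := (dims_wordBound (b := b) hm hd).two_le
  have h1 := (dims_wordBound (b := b) hm hd).N_le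
  have h2' : 2 ≤ d * b ^ m := h2.trans (Nat.le_mul_of_pos_left _ hd)
  refine ⟨by omega, ?_⟩
  have h3 : wordBound b m d ≤ (d * b ^ m) ^ 7 := by
    calc wordBound b m d ≤ 2 ^ 5 * (d * b ^ m) ^ 2 := by
          unfold wordBound
          rw [mul_pow]
          have : d ≤ d ^ 2 := Nat.le_self_pow (by norm_num) d
          have := Nat.mul_le_mul_right ((b ^ m) ^ 2) this
          omega
      _ ≤ (d * b ^ m) ^ 5 * (d * b ^ m) ^ 2 :=
          Nat.mul_le_mul_right _ (Nat.pow_le_pow_left h2' 5)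
      _ = (d * b ^ m) ^ 7 := by rw [← pow_add]
  calc wordBound b m d ^ 8 ≤ ((d * b ^ m) ^ 7) ^ 8 := Nat.pow_le_pow_left h3 8
    _ = (d * b ^ m) ^ 56 := by rw [← pow_mul]
    _ ≤ (d * b ^ m) ^ C := Nat.pow_le_pow_right (by omega) hC

theorem bdd_input (hm : 1 ≤ m) (hd : 1 ≤ d) {e : ℕ} (he : e < b ^ (m + 1)) :
    Bdd (wordBound b m d) (input b m d e γ) := by
  have hD := dims_wordBound (b := b) hm hd
  have h1 := hD.N_le
  have h2 := hD.two_le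
  have h3 := hD.d_le
  have h4 := hD.m_lt
  have h5 := hD.b_le
  have h6 := hD.sq_le
  have h7 : e < b ^ m * b ^ m := he.trans_le (by
    rw [pow_succ]; exact Nat.mul_le_mul_left _ h5)
  refine ⟨fun x => ?_, fun a i => ?_⟩
  · simp only [input]
    split_ifs <;> omega
  · simp only [input]
    omega

/-- `2 ^ K ≤ 4 N ≤ N ^ 3` because `N ≥ 2`, so `K ≤ (3 / log 2) log N`, and `3 / log 2 < 5`. -/
theorem Base.le_log (hD : Dims b m d V) (hB : Base b m d K σ) :
    (K : ℝ) ≤ 5 * Real.log (b ^ m : ℕ) := by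
  have h2 : (2 : ℝ) ≤ (b ^ m : ℕ) := by exact_mod_cast hD.two_le
  have h4 : ((2 : ℝ) ^ K) ≤ 4 * (b ^ m : ℕ) := by exact_mod_cast hB.L_le
  have h5 : (2 : ℝ) ^ K ≤ ((b ^ m : ℕ) : ℝ) ^ 3 := by
    nlinarith [mul_nonneg (mul_nonneg (show (0 : ℝ) ≤ (b ^ m : ℕ) by linarith)
      (sub_nonneg.2 h2)) (show (0 : ℝ) ≤ (b ^ m : ℕ) + 2 by linarith)]
  have h6 := Real.log_le_log (by positivity) h5
  rw [Real.log_pow, Real.log_pow] at h6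
  have h7 : Real.log 2 ≤ Real.log (b ^ m : ℕ) := Real.log_le_log (by norm_num) h2
  have h8 := Real.log_two_gt_d9
  push_cast at h6 ⊢
  nlinarith

theorem time_le (hD : Dims b m d V) (hB : Base b m d K σ) {t c : ℕ} {C : ℕ}
    (ht : t ≤ d * (K * b ^ m) * c) (hC : 5 * c ≤ C) :
    (t : ℝ) ≤ C * (d * (b ^ m : ℕ) * Real.log (b ^ m : ℕ)) := by
  have h1 := hB.le_log hD
  have h2 : (t : ℝ) ≤ d * (K * (b ^ m : ℕ)) * c := by exact_mod_cast ht
  have h3 : (5 : ℝ) * c ≤ C := by exact_mod_cast hC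
  have h4 : (0 : ℝ) ≤ Real.log (b ^ m : ℕ) := Real.log_natCast_nonneg _
  calc (t : ℝ) ≤ d * (K * (b ^ m : ℕ)) * c := h2
    _ ≤ d * (5 * Real.log (b ^ m : ℕ) * (b ^ m : ℕ)) * c := by gcongr
    _ = 5 * c * (d * (b ^ m : ℕ) * Real.log (b ^ m : ℕ)) := by ring
    _ ≤ _ := by gcongr

/-- `m ≤ K` lets the `O(m N)` cost of the sieve disappear in `K N`. -/
theorem Base.le_K (hD : Dims b m d V) (hB : Base b m d K σ) : 1 ≤ K ∧ m ≤ K := by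
  have h1 := hB.le_L
  have h2 : 2 ^ m ≤ b ^ m := Nat.pow_le_pow_left hb.out.two_le m
  have h3 : 2 ^ m ≤ 2 ^ K := by omega
  have h4 := (Nat.pow_le_pow_iff_right (by norm_num)).1 h3
  exact ⟨hD.1.trans h4, h4⟩

theorem constructPrescribed_spec (hm : 1 ≤ m) (hd : 1 ≤ d) {C : ℕ} (hC : 30000 ≤ C) {e : ℕ}
    (hirr : Irreducible (digitPoly b e)) (hdeg : (digitPoly b e).natDegree = m) :
    ∃ t τ, Exec ((d * b ^ m) ^ C) constructPrescribed (input b m d e γ) t τ ∧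
      (t : ℝ) ≤ C * (d * (b ^ m : ℕ) * Real.log (b ^ m : ℕ)) ∧
      Constructed b m d γ (digitPoly b e) τ := by
  have hM := machine_wordBound (b := b) hm hd (C := C) (by omega)
  have hD := dims_wordBound (b := b) hm hd
  have hσ := bdd_input (b := b) (γ := γ) hm hd (lt_pow_of_natDegree hdeg)
  obtain ⟨t1, σ1, x1, y1, hσ1, hF1, K, hB⟩ := setup_spec hM hD hσ rfl rfl rfl rfl
  obtain ⟨t2, τ, x2, y2, -, -, h⟩ := construct_spec (γ := γ) hM hD hσ1 hB
    (by rw [hF1.ireg 3 rfl]; rfl) hirr hdeg (by rw [hF1.iarr 8 rfl]; exact fun _ => rfl)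
    (by rw [hF1.iarr 10 rfl]; rfl) (by
      intro s hs hs'
      rw [hF1.rarr 0 rfl]
      simp [input, hs, hs'])
  refine ⟨t1 + t2, τ, .seq _ _ _ _ _ _ _ x1 x2, ?_, h⟩
  -- The costs `300 N` and `4000 d K N` fit below `6000 d K N`, and `K ≤ 5 log N` gives the constant
  -- `5 * 6000 = 30000`.
  refine time_le hD hB (c := 6000) ?_ (by omega)
  have h1 := (hB.le_K hD).1
  have h2 : b ^ m ≤ d * (K * b ^ m) := by
    rw [← mul_assoc]; exact Nat.le_mul_of_pos_left _ (Nat.mul_pos hd h1)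
  omega

theorem constructOwn_spec (hm : 1 ≤ m) (hd : 1 ≤ d) {C : ℕ} (hC : 30000 ≤ C) :
    ∃ t τ, Exec ((d * b ^ m) ^ C) constructOwn (input b m d 0 γ) t τ ∧
      (t : ℝ) ≤ C * (d * (b ^ m : ℕ) * Real.log (b ^ m : ℕ)) ∧
      Irreducible (outModulus b τ) ∧ (outModulus b τ).natDegree = m ∧
      Constructed b m d γ (outModulus b τ) τ := by
  have hM := machine_wordBound (b := b) hm hd (C := C) (by omega)
  have hD := dims_wordBound (b := b) hm hd
  have hσ := bdd_input (b := b) (γ := γ) hm hd (e := 0) (pow_pos hb.out.pos _)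
  obtain ⟨t1, σ1, x1, y1, hσ1, hF1, K, hB⟩ := setup_spec hM hD hσ rfl rfl rfl rfl
  obtain ⟨t2, σ2, x2, y2, hσ2, hF2, hirr, hdeg⟩ := findModulus_spec hM hD hσ1 hB
    (by rw [hF1.iarr 3 rfl]; exact fun _ _ => rfl) (by rw [hF1.iarr 9 rfl]; exact fun _ => rfl)
  obtain ⟨t3, σ3, x3, y3, hσ3, hF3, h⟩ := construct_spec (γ := γ) hM hD hσ2 (hB.frame hF2 rfl)
    rfl hirr hdeg (by rw [hF2.iarr 8 rfl, hF1.iarr 8 rfl]; exact fun _ => rfl)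
    (by rw [hF2.iarr 10 rfl, hF1.iarr 10 rfl]; rfl) (by
      intro s hs hs'
      rw [hF2.rarr 0 rfl, hF1.rarr 0 rfl]
      simp [input, hs, hs'])
  obtain ⟨t4, τ, x4, y4, -, -, hτ⟩ := Run.of_wp (c := .iset 0 (.reg 3)) (T := 2)
    (Q := fun τ => τ = σ3.setIreg 0 (σ3.ireg 3)) hM hσ3 rfl (by decide)
    ⟨trivial, hσ3.ireg 3, rfl⟩
  subst hτ
  have e3 : σ3.ireg 3 = σ2.ireg 3 := hF3.ireg 3 rfl
  have hout : outModulus b (σ3.setIreg 0 (σ3.ireg 3)) = digitPoly b (σ2.ireg 3) := by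
    simp [outModulus, e3]
  obtain ⟨K', ζ, g1, g2, g3⟩ := h
  refine ⟨t1 + (t2 + (t3 + t4)), _, .seq _ _ _ _ _ _ _ x1 (.seq _ _ _ _ _ _ _ x2
    (.seq _ _ _ _ _ _ _ x3 x4)), ?_, by rw [hout]; exact hirr, by rw [hout]; exact hdeg, by
      rw [hout]
      exact ⟨K', ζ, g1, g2, ⟨g3.1, g3.2, g3.3, g3.4, g3.5, g3.6⟩⟩⟩
  refine time_le hD hB (c := 6000) ?_ (by omega)
  obtain ⟨h1, h1'⟩ := hB.le_K hD
  have h2 : b ^ m ≤ d * (K * b ^ m) := by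
    rw [← mul_assoc]; exact Nat.le_mul_of_pos_left _ (Nat.mul_pos hd h1)
  have h3 : m * (b ^ m * 600) ≤ d * (K * b ^ m) * 600 := by
    rw [← mul_assoc, ← mul_assoc]
    refine Nat.mul_le_mul_right _ (Nat.mul_le_mul_right _ ?_)
    exact h1'.trans (Nat.le_mul_of_pos_left _ hd)
  have h4 := hD.two_le
  omega

end

end RealRAM

/-! ## The quality function -/

namespace PolyLattice

open Polynomial

section
variable {b m : ℕ} [hb : Fact b.Prime]

theorem toLaurentInv_coeff (f : (ZMod b)[X]) (ℓ : ℤ) :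
    (toLaurentInv b f).coeff ℓ = if ℓ ≤ 0 then f.coeff (-ℓ).toNat else 0 := by
  have hC : ∀ c : ZMod b, algebraMap (ZMod b) (LaurentSeries (ZMod b)) c = HahnSeries.C c := by
    intro c
    rw [HahnSeries.algebraMap_apply', ← PowerSeries.C_eq_algebraMap, HahnSeries.ofPowerSeries_C]
  rw [toLaurentInv, aeval_def, eval₂_eq_sum_range, HahnSeries.coeff_sum]
  have h : ∀ i ∈ Finset.range (f.natDegree + 1),
      (algebraMap (ZMod b) (LaurentSeries (ZMod b)) (f.coeff i) *
        (HahnSeries.single (-1 : ℤ) (1 : ZMod b)) ^ i).coeff ℓ =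
        if i = (-ℓ).toNat ∧ ℓ ≤ 0 then f.coeff i else 0 := by
    intro i _
    rw [hC, HahnSeries.C_mul_eq_smul, HahnSeries.coeff_smul, HahnSeries.single_pow, HahnSeries.coeff_single, one_pow]
    have : ℓ = i • (-1 : ℤ) ↔ i = (-ℓ).toNat ∧ ℓ ≤ 0 := by
      rw [nsmul_eq_mul]; omega
    simp only [this]
    split_ifs <;> simp
  refine (Finset.sum_congr rfl h).trans ?_
  split_ifs with h0
  · simp only [h0, and_true]
    rw [Finset.sum_ite_eq' (Finset.range (f.natDegree + 1))]
    split_ifs with h1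
    · rfl
    · rw [coeff_eq_zero_of_natDegree_lt]
      simpa [Nat.lt_succ_iff] using h1
  · simp [h0]

theorem orderTop_toLaurentInv {f : (ZMod b)[X]} (hf : f ≠ 0) :
    (toLaurentInv b f).orderTop = ((-(f.natDegree : ℤ) : ℤ) : WithTop ℤ) := by
  refine HahnSeries.orderTop_eq_of_le ?_ ?_
  · rw [HahnSeries.mem_support, toLaurentInv_coeff, if_pos (by omega)]
    simpa using hf
  · intro ℓ hℓ
    rw [HahnSeries.mem_support, toLaurentInv_coeff] at hℓ
    by_contra hlt
    refine hℓ ?_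
    rw [if_pos (by omega), coeff_eq_zero_of_natDegree_lt (by omega)]

theorem toLaurentInv_ne_zero {f : (ZMod b)[X]} (hf : f ≠ 0) : toLaurentInv b f ≠ 0 := by
  rw [← HahnSeries.orderTop_ne_top, orderTop_toLaurentInv hf]
  exact WithTop.coe_ne_top

omit hb in
/-- The sum of a base `b` expansion whose first nonzero digit has index at least `v + 1`. -/
theorem sum_digits_le {t : ℕ → ℕ} {v : ℕ} (hb2 : 2 ≤ b) (ht : ∀ l, t l < b)
    (h0 : ∀ l ≤ v, t l = 0) :
    v ≤ m → ∑ l ∈ Finset.Icc 1 m, (t l : ℝ) / (b : ℝ) ^ l ≤ 1 / (b : ℝ) ^ v - 1 / (b : ℝ) ^ m := by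
  intro hm
  induction m, hm using Nat.le_induction with
  | base =>
    rw [sub_self]
    refine (Finset.sum_eq_zero fun l hl => ?_).le
    rw [h0 l (Finset.mem_Icc.1 hl).2]
    simp
  | succ m hm ih =>
    rw [Finset.sum_Icc_succ_top (by omega)]
    have hb0 : (0 : ℝ) < b := by positivity
    have h1 : (t (m + 1) : ℝ) ≤ b - 1 := by
      have : (t (m + 1) + 1 : ℝ) ≤ b := by exact_mod_cast ht (m + 1)
      linarith
    have h2 : (t (m + 1) : ℝ) / (b : ℝ) ^ (m + 1) ≤ (b - 1) / (b : ℝ) ^ (m + 1) := by gcongr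
    have h3 : ((b : ℝ) - 1) / (b : ℝ) ^ (m + 1) = 1 / (b : ℝ) ^ m - 1 / (b : ℝ) ^ (m + 1) := by
      field_simp
      ring
    linarith

/-- If the first nonzero digit has index `w`, the value is at least `b ^ (-w)` and at most `b ^ (-(w
- 1)) - b ^ (-m)`. The truncation at `m` makes the upper bound strict. -/
theorem floor_logb_vm {L : LaurentSeries (ZMod b)} {w : ℕ} (hw : 1 ≤ w) (hwm : w ≤ m)
    (h0 : ∀ l : ℕ, 1 ≤ l → l < w → L.coeff l = 0) (hne : L.coeff w ≠ 0) :
    ⌊Real.logb b (vm b m L)⌋ = -(w : ℤ) := by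
  have hb2 := hb.out.two_le
  have hb0 : (0 : ℝ) < b := by exact_mod_cast hb.out.pos
  -- The digit at index `0` is set to zero, since the coefficient of `L` there is unconstrained and
  -- does not enter `vm`.
  set t : ℕ → ℕ := fun l => if l = 0 then 0 else (L.coeff (l : ℤ)).val with ht
  have hvm : vm b m L = ∑ l ∈ Finset.Icc 1 m, (t l : ℝ) / (b : ℝ) ^ l := by
    refine Finset.sum_congr rfl fun l hl => ?_
    have := (Finset.mem_Icc.1 hl).1
    simp only [ht]
    rw [if_neg (by omega)]
  have htb : ∀ l, t l < b := by
    intro l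
    simp only [ht]
    split_ifs
    · omega
    · exact ZMod.val_lt _
  have hup := sum_digits_le (m := m) (v := w - 1) hb2 htb (by
    intro l hl
    simp only [ht]
    split_ifs with h
    · rfl
    · rw [h0 l (by omega) (by omega), ZMod.val_zero]) (by omega)
  have hlow : 1 / (b : ℝ) ^ w ≤ vm b m L := by
    rw [hvm]
    have h1 : (1 : ℝ) ≤ t w := by
      have : t w ≠ 0 := by
        simp only [ht]
        rw [if_neg (by omega)]
        rwa [Ne, ZMod.val_eq_zero]
      exact_mod_cast Nat.one_le_iff_ne_zero.2 this
    calc 1 / (b : ℝ) ^ w ≤ (t w : ℝ) / (b : ℝ) ^ w := by gcongr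
      _ ≤ _ := Finset.single_le_sum (f := fun l => (t l : ℝ) / (b : ℝ) ^ l)
        (fun l _ => by positivity) (Finset.mem_Icc.2 ⟨hw, hwm⟩)
  have hpos : 0 < vm b m L := lt_of_lt_of_le (by positivity) hlow
  have hlt : vm b m L < 1 / (b : ℝ) ^ (w - 1) := by
    rw [hvm]
    have : 0 < 1 / (b : ℝ) ^ m := by positivity
    linarith
  rw [Real.floor_logb_natCast]
  apply le_antisymm
  · rw [← Int.lt_add_one_iff, ← Int.lt_zpow_iff_log_lt hb2 hpos]
    rw [show -(w : ℤ) + 1 = -((w - 1 : ℕ) : ℤ) by omega, zpow_neg, zpow_natCast, ← one_div]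
    exact hlt
  · rw [← Int.zpow_le_iff_le_log hb2 hpos, zpow_neg, zpow_natCast, ← one_div]
    exact hlow
  · exact hpos.le

/-- The kernel at the point of a polynomial lattice depends on the residue of `n g` modulo `p`. -/
theorem kernel_point {p g : (ZMod b)[X]} (hp : p.natDegree = m) (hp0 : p ≠ 0) {n y : ℕ} (hy : y ≠ 0)
    (hy' : y < b ^ m) (h : AdjoinRoot.mk p (digitPoly b y) = AdjoinRoot.mk p (digitPoly b n * g)) :
    (1 - (b : ℝ)) * (⌊Real.logb b (point b m p g n)⌋ : ℝ) - b = kernelValue b m y := by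
  have hb2 := hb.out.two_le
  rw [eq_comm, AdjoinRoot.mk_eq_mk] at h
  obtain ⟨u, hu⟩ := h
  set r := digitPoly b y with hr
  have hr0 : r ≠ 0 := by rwa [hr, Ne, digitPoly_eq_zero_iff]
  have hrdeg : r.natDegree = Nat.log b y := natDegree_digitPoly hy
  have hlog : Nat.log b y < m := Nat.log_lt_of_lt_pow hy hy'
  have hP := toLaurentInv_ne_zero hp0
  set x := toLaurentInv b r / toLaurentInv b p with hx
  have hxo : x.orderTop = ((m - Nat.log b y : ℕ) : ℤ) := by
    have h1 : x * toLaurentInv b p = toLaurentInv b r := div_mul_cancel₀ _ hP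
    have h2 := congrArg HahnSeries.orderTop h1
    rw [HahnSeries.orderTop_mul, orderTop_toLaurentInv hp0, orderTop_toLaurentInv hr0, hp,
      hrdeg] at h2
    have h3 : x.orderTop ≠ ⊤ := by
      rw [HahnSeries.orderTop_ne_top]
      exact div_ne_zero (toLaurentInv_ne_zero hr0) hP
    obtain ⟨o, ho⟩ := WithTop.ne_top_iff_exists.1 h3
    rw [← ho] at h2 ⊢
    norm_cast at h2 ⊢
    omega
  -- `n g` and `r` differ by a multiple `p u`. After division by `p` this is the polynomial `u`,
  -- which has no coefficients at positive powers of `x⁻¹`.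
  have hcoeff : ∀ l : ℕ, 1 ≤ l →
      (toLaurentInv b (digitPoly b n * g) / toLaurentInv b p).coeff (l : ℤ) = x.coeff l := by
    intro l hl
    rw [sub_eq_iff_eq_add.1 hu, map_add, add_div, map_mul, mul_div_cancel_left₀ _ hP,
      HahnSeries.coeff_add, toLaurentInv_coeff, if_neg (by omega), zero_add]
  have hfl := floor_logb_vm (m := m) (L := toLaurentInv b (digitPoly b n * g) / toLaurentInv b p)
    (w := m - Nat.log b y) (by omega) (by omega)
    (fun l hl hl' => by
      rw [hcoeff l hl]
      refine HahnSeries.coeff_eq_zero_of_lt_orderTop ?_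
      rw [hxo]
      exact_mod_cast hl')
    (by
      rw [hcoeff _ (by omega)]
      intro h0
      exact HahnSeries.orderTop_ne_of_coeff_eq_zero h0 hxo)
  rw [point, hfl, kernelValue, Nat.length_digits b y (by omega) hy]
  rw [show m + 1 - (Nat.log b y + 1) = m - Nat.log b y by omega, Nat.cast_mul,
    Nat.cast_sub (by omega : 1 ≤ b)]
  push_cast
  ring

/-- Every nonzero residue is a power of the generator. -/
theorem exists_pow_eq {p : (ZMod b)[X]} [Fact (Irreducible p)] (hm : 1 ≤ m)
    (hp : p.natDegree = m) {ζ : AdjoinRoot p} (hζ : orderOf ζ = b ^ m - 1) {κ : AdjoinRoot p}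
    (hκ : κ ≠ 0) : ∃ i < b ^ m - 1, ζ ^ i = κ := by
  have hprim := IsPrimitiveRoot.orderOf ζ
  have h1 : 1 < b ^ m := Nat.one_lt_pow (by omega) hb.out.one_lt
  have : NeZero (b ^ m - 1) := ⟨by omega⟩
  rw [hζ] at hprim
  exact hprim.eq_pow_of_pow_eq_one (pow_card_sub_one hm hp hκ)

/-- The quality function for product weights. -/
theorem quality_productWeights (γ : ℕ → ℝ) (p : (ZMod b)[X]) (s : ℕ) (g : ℕ → (ZMod b)[X]) :
    quality b m (productWeights γ) p s g = ∑ n ∈ Finset.Icc 1 (b ^ m - 1),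
      (∏ j ∈ Finset.Icc 1 s, (1 + γ j *
        ((1 - (b : ℝ)) * (⌊Real.logb b (point b m p (g j) n)⌋ : ℝ) - b)) - 1) := by
  unfold quality productWeights Lfun
  simp only [Finset.mul_sum, ← Finset.prod_mul_distrib]
  rw [Finset.sum_comm]
  refine Finset.sum_congr rfl fun n _ => ?_
  -- Expanding the product over subsets; the empty subset contributes the `1` that is subtracted.
  rw [Finset.prod_one_add, Finset.sum_filter]
  rw [← Finset.sum_erase_add _ _ (Finset.empty_mem_powerset (Finset.Icc 1 s)),
    ← Finset.sum_erase_add (Finset.powerset _) _ (Finset.empty_mem_powerset (Finset.Icc 1 s))]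
  simp only [Finset.prod_empty, add_sub_cancel_right, Finset.not_nonempty_empty, if_false, add_zero]
  refine Finset.sum_congr rfl fun u hu => ?_
  rw [if_pos (Finset.nonempty_iff_ne_empty.2 (Finset.ne_of_mem_erase hu))]

/-- The quality function in terms of the discrete logarithms `J` of the components. -/
theorem quality_eq_sum_weightProd {p : (ZMod b)[X]} [Fact (Irreducible p)] (hm : 1 ≤ m)
    (hp : p.natDegree = m) {ζ : AdjoinRoot p} (hζ : orderOf ζ = b ^ m - 1) {E : ℕ → ℕ}
    (hE : ∀ i ≤ b ^ m, E i < b ^ m ∧ AdjoinRoot.mk p (digitPoly b (E i)) = ζ ^ i) (γ : ℕ → ℝ)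
    {s : ℕ} {g : ℕ → (ZMod b)[X]} {J : ℕ → ℕ}
    (hg : ∀ j ∈ Finset.Icc 1 s, AdjoinRoot.mk p (g j) = ζ ^ J j) :
    quality b m (productWeights γ) p s g =
      ∑ i ∈ Finset.range (b ^ m - 1), (weightProd (cyclicKernel b m E) γ J s i - 1) := by
  have hirr : Irreducible p := Fact.out
  have hpos : 0 < b ^ m := pow_pos hb.out.pos m
  have h2 : 2 ≤ b ^ m := hb.out.two_le.trans (Nat.le_self_pow (by omega) b)
  have hζ0 : ζ ≠ 0 := by
    rintro rfl
    rw [orderOf_eq_zero_iff'.2] at hζ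
    · omega
    · intro n hn; simp [zero_pow hn.ne']
  have hE0 : ∀ i ≤ b ^ m, E i ≠ 0 := by
    intro i hi h0
    have := (hE i hi).2
    rw [h0] at this
    exact pow_ne_zero i hζ0 (by simpa using this.symm)
  rw [quality_productWeights]
  symm
  -- The nonzero codes are exactly the codes of `ζ ^ i` for `i < N - 1`, so summing over `n` is
  -- summing over `i`.
  refine Finset.sum_bij (fun i _ => E i) ?_ ?_ ?_ ?_
  · intro i hi
    rw [Finset.mem_range] at hi
    have h1 := hE0 i (by omega)
    have h3 := (hE i (by omega)).1
    rw [Finset.mem_Icc]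
    omega
  · intro i hi j hj hij
    rw [Finset.mem_range] at hi hj
    have h1 := (hE i (by omega)).2
    rw [hij, (hE j (by omega)).2] at h1
    exact pow_injOn_Iio_orderOf (by rw [hζ]; exact hi) (by rw [hζ]; exact hj) h1.symm
  · intro n hn
    rw [Finset.mem_Icc] at hn
    obtain ⟨i, hi, h1⟩ := exists_pow_eq hm hp hζ (κ := AdjoinRoot.mk p (digitPoly b n)) (by
      rw [Ne, mk_digitPoly_eq_zero hp hpos (by omega)]
      omega)
    refine ⟨i, Finset.mem_range.2 hi, ?_⟩
    exact mk_digitPoly_injOn hp (hE i (by omega)).1 (by omega) ((hE i (by omega)).2.trans h1)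
  · intro i hi
    rw [Finset.mem_range] at hi
    rw [weightProd]
    congr 1
    refine Finset.prod_congr rfl fun j hj => ?_
    have hlt : (i + J j) % (b ^ m - 1) < b ^ m - 1 := Nat.mod_lt _ (by omega)
    rw [kernel_point hp hirr.ne_zero (hE0 _ (by omega)) (hE ((i + J j) % (b ^ m - 1)) (by omega)).1,
      cyclicKernel]
    rw [(hE _ (by omega)).2, map_mul, (hE i (by omega)).2, hg j hj, ← pow_add, ← hζ,
      pow_mod_orderOf]

/-- With the earlier components fixed, the quality is a constant plus `γ (s + 1)` times the
objective at the exponent of the last component. Every competitor is a power of `ζ`, and positivity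
of the weight preserves the inequality. -/
theorem isCBCVector_of_objective_le {p : (ZMod b)[X]} [Fact (Irreducible p)] (hm : 1 ≤ m)
    (hp : p.natDegree = m) {ζ : AdjoinRoot p} (hζ : orderOf ζ = b ^ m - 1) {E : ℕ → ℕ}
    (hE : ∀ i ≤ b ^ m, E i < b ^ m ∧ AdjoinRoot.mk p (digitPoly b (E i)) = ζ ^ i) {γ : ℕ → ℝ}
    {d : ℕ} (hd : 1 ≤ d) (hγ : ∀ j ∈ Finset.Icc 1 d, 0 < γ j) {G J : ℕ → ℕ}
    (hJ : ∀ k, 1 ≤ k → k ≤ d → J k < b ^ m - 1) (hJ1 : J 1 = 0)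
    (hG : ∀ k, 1 ≤ k → k ≤ d → G k = E (J k))
    (hle : ∀ k, 2 ≤ k → k ≤ d → ∀ t < b ^ m - 1,
      objective (b ^ m - 1) (cyclicKernel b m E) γ J (k - 1) (J k) ≤
        objective (b ^ m - 1) (cyclicKernel b m E) γ J (k - 1) t) :
    IsCBCVector b m d (productWeights γ) p (fun j => digitPoly b (G j)) := by
  have hirr : Irreducible p := Fact.out
  have hpos : 0 < b ^ m := pow_pos hb.out.pos m
  have hmk : ∀ k, 1 ≤ k → k ≤ d → AdjoinRoot.mk p (digitPoly b (G k)) = ζ ^ J k := by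
    intro k hk hk'
    rw [hG k hk hk', (hE _ (by have := hJ k hk hk'; omega)).2]
  have hlt : ∀ k, 1 ≤ k → k ≤ d → G k < b ^ m := by
    intro k hk hk'
    rw [hG k hk hk']
    exact (hE _ (by have := hJ k hk hk'; omega)).1
  have h1lt : 1 < b ^ m := Nat.one_lt_pow (by omega) hb.out.one_lt
  have hζ0 : ζ ≠ 0 := by
    rintro rfl
    rw [orderOf_eq_zero_iff'.2] at hζ
    · omega
    · intro n hn; simp [zero_pow hn.ne']
  refine ⟨?_, fun s hs => ?_⟩
  · have h1 := hmk 1 le_rfl hd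
    rw [hJ1, pow_zero] at h1
    have : G 1 = 1 := mk_digitPoly_injOn hp (hlt 1 le_rfl hd) h1lt (by rw [h1, digitPoly_one, map_one])
    simp [this]
  rw [Finset.mem_Icc] at hs
  obtain ⟨s, rfl⟩ : ∃ k, s = k + 1 := ⟨s - 1, by omega⟩
  refine ⟨⟨?_, degree_digitPoly_lt.2 (hlt _ (by omega) hs.2)⟩, ?_⟩
  · intro h0
    have := hmk (s + 1) (by omega) hs.2
    rw [show digitPoly b (G (s + 1)) = 0 from h0, map_zero] at this
    exact pow_ne_zero _ hζ0 this.symm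
  rintro h ⟨hh0, hhdeg⟩
  obtain ⟨t, ht, ht'⟩ := exists_pow_eq hm hp hζ (κ := AdjoinRoot.mk p h) (by
    rw [Ne, AdjoinRoot.mk_eq_zero]
    intro hdvd
    refine hh0 (eq_zero_of_dvd_of_degree_lt hdvd ?_)
    rwa [degree_eq_natDegree hirr.ne_zero, hp])
  rw [quality_eq_sum_weightProd hm hp hζ hE γ (J := J)
      fun j hj => hmk j (Finset.mem_Icc.1 hj).1 ((Finset.mem_Icc.1 hj).2.trans hs.2),
    quality_eq_sum_weightProd hm hp hζ hE γ (J := Function.update J (s + 1) t) ?_]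
  · have hsum : ∀ J' : ℕ → ℕ, (∀ k ≤ s, J' k = J k) →
        ∑ i ∈ Finset.range (b ^ m - 1), (weightProd (cyclicKernel b m E) γ J' (s + 1) i - 1) =
        ∑ i ∈ Finset.range (b ^ m - 1), (weightProd (cyclicKernel b m E) γ J s i - 1) +
          γ (s + 1) * objective (b ^ m - 1) (cyclicKernel b m E) γ J s (J' (s + 1)) := by
      intro J' hJ'
      rw [objective, Finset.mul_sum, ← Finset.sum_add_distrib]
      refine Finset.sum_congr rfl fun i _ => ?_
      rw [weightProd_succ, weightProd_congr hJ']
      ring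
    rw [hsum J fun _ _ => rfl, hsum _ fun k hk => Function.update_of_ne (by omega) _ _,
      Function.update_self]
    have h3 := hle (s + 1) hs.1 hs.2 t ht
    rw [Nat.add_sub_cancel] at h3
    have h4 := hγ (s + 1) (Finset.mem_Icc.2 ⟨by omega, hs.2⟩)
    gcongr
  · intro j hj
    rw [Finset.mem_Icc] at hj
    by_cases hjs : j = s + 1
    · subst hjs
      rw [Function.update_self, Function.update_self, ht']
    · rw [Function.update_of_ne hjs, Function.update_of_ne hjs]
      exact hmk j hj.1 (hj.2.trans hs.2)

end

end PolyLattice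

open PolyLattice in
theorem proposition2 :
    ∃ (P Q : RealRAM.Cmd) (C : ℕ),
      ∀ (b : ℕ) [Fact b.Prime] (m d : ℕ) (γ : ℕ → ℝ), 1 ≤ m → 1 ≤ d →
        (∀ j ∈ Finset.Icc 1 d, 0 < γ j) →
        -- `P` chooses an irreducible modulus itself and constructs a generating vector for it
        (∃ (t : ℕ) (σ : RealRAM.Store),
          RealRAM.Exec ((d * b ^ m) ^ C) P (RealRAM.input b m d 0 γ) t σ ∧
          (t : ℝ) ≤ C * (d * (b ^ m : ℕ) * Real.log (b ^ m : ℕ)) ∧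
          Irreducible (outModulus b σ) ∧ (outModulus b σ).natDegree = m ∧
          IsCBCVector b m d (productWeights γ) (outModulus b σ) (outVector b σ)) ∧
        -- `Q` constructs a generating vector for any prescribed irreducible modulus
        (∀ e : ℕ, Irreducible (digitPoly b e) → (digitPoly b e).natDegree = m →
          ∃ (t : ℕ) (σ : RealRAM.Store),
            RealRAM.Exec ((d * b ^ m) ^ C) Q (RealRAM.input b m d e γ) t σ ∧
            (t : ℝ) ≤ C * (d * (b ^ m : ℕ) * Real.log (b ^ m : ℕ)) ∧
            IsCBCVector b m d (productWeights γ) (digitPoly b e) (outVector b σ)) := by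
  -- The constant is `30000`, kept opaque so that the power with exponent `C` is never evaluated.
  obtain ⟨C, hC⟩ : ∃ C : ℕ, 30000 ≤ C := ⟨_, le_rfl⟩
  refine ⟨RealRAM.constructOwn, RealRAM.constructPrescribed, C, ?_⟩
  intro b _ m d γ hm hd hγ
  have key : ∀ (p : Polynomial (ZMod b)) (τ : RealRAM.Store), Irreducible p → p.natDegree = m →
      RealRAM.Constructed b m d γ p τ →
      IsCBCVector b m d (productWeights γ) p (outVector b τ) := by
    rintro p τ hirr hp ⟨K, ζ, hζ, hE, h⟩
    have : Fact (Irreducible p) := ⟨hirr⟩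
    exact isCBCVector_of_objective_le hm hp hζ hE hd hγ h.exponent_lt (h.exponent_one hd)
      h.code h.le
  constructor
  · obtain ⟨t, τ, h1, h2, h3, h4, h5⟩ := RealRAM.constructOwn_spec (b := b) (γ := γ) hm hd hC
    exact ⟨t, τ, h1, h2, h3, h4, key _ τ h3 h4 h5⟩
  · intro e hirr hdeg
    obtain ⟨t, τ, h1, h2, h3⟩ := RealRAM.constructPrescribed_spec (γ := γ) hm hd hC hirr hdeg
    exact ⟨t, τ, h1, h2, key _ τ hirr hdeg h3⟩
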